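/- Texts are finite sequences of characters from a fixed finite alphabet. A Pseudo-Formal proof $P$ is a sequence of modules $v_1,\dots,v_n$, $v=(P_v,c_v,\pi_v)$ with premises $P_v$ (a finite list of texts), a conclusion $c_v$ and a proof $\pi_v$ (texts), together with an acyclic directed graph $G$ and a forest $T$ on the modules. There is an edge $v\to u$ in $G$ exactly when $\pi_v$ invokes $c_u$; each invocation is a place in the text $\pi_v$, and invocations of different modules begin at different characters. The parent of $v$ in $T$ is the module whose scope $v$ directly inherits. For constants $D\ge 0$ and $L\ge 1$, the proof $P$ is good if the depth of $T$ is at most $D$ and, in each module, the length of $c_v$, the length of $\pi_v$, and the number and the total length of the premises in $P_v$ are at most $L$. The module context of $v$ is $$C_v(P)=\bigl((P_u)_{u\in \mathrm{Anc}_T(v)},\,(c_u)_{u:\,(v,u)\in E_G},\,P_v,\,c_v,\,\pi_v\bigr),$$ where $\mathrm{Anc}_T(v)$ is the set of proper ancestors of $v$ in $T$ and nodes are listed in the left-to-right depth-first order of $T$; it is serialized as a word over the characters and three delimiters. A block-wise verification algorithm $A$ is given by a fixed module verifier $V$: a Turing machine (with finitely many stacks) that halts on every module context with output accept or reject, in time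 linear in the serialized length. $A$ accepts $P$ if and only if $V$ accepts $C_v(P)$ for every module $v$. A fixed-size Transformer is a decoder-only Transformer with a finite vocabulary, finitely many layers and heads, fixed rational parameters, projected pre-norm (each sublayer is applied to the layer-normalization of a linear image of the residual stream), ReLU feedforward sublayers, strict causal saturated attention (each head averages the values over the strictly earlier positions of maximal score), no positional encoding, and hidden states rounded after each sublayer to $O(\log N)$ bits on a context of $N$ tokens. A call on a prompt is greedy decoding until the first token "accept" or "reject", which is the result of the call; its context length is the number of prompt tokens plus the number of generated tokens. Theorem. Let $A$ be a block-wise verification algorithm with module verifier $V$. There are a fixed-size Transformer $T_1$ and a constant $c_A$, depending only on $A$, such that for all $D\ge0$, $L\ge1$, $n$ and every good Pseudo-Formal proof $P$ with $n$ modules and constants $D,L$, the algorithm $A$ on $P$ is simulated by $O(n)$ calls to $T_1$: each call is made on the serialization of a module context $C_v(P)$, every module occurs, each call returns the verdict of $V$ on $C_v(P)$ with context length at most $c_A\,L\,(L+D+1)$ (which does not depend on $n$), and $A$ accepts $P$ if and only if all calls return accept. -/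

import Mathlib

open scoped BigOperators

namespace PseudoFormal

/-! ## Pseudo-Formal proofs over a character alphabet `α` -/

/-- A proof module: a set of premises (written as a list of texts), a conclusion and a proof,
all of them sequences of characters. -/
structure PFModule (α : Type) where
  premises : List (List α)
  conclusion : List α
  proof : List α

/-- A Pseudo-Formal proof: a sequence of `n` modules, an invocation graph and a scope forest.

`citation v i = some u` says that the phrase of the proof text of `v` that begins at its `i`-th
character invokes the conclusion of `u`; so an invocation is a place in the proof text, and
different invocations begin at different characters.
`parent v = some u` says that `v` directly inherits the scope of `u`; as every module has at most
one parent, acyclicity makes the scope graph a forest. -/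
structure PFProof (α : Type) where
  n : ℕ
  modules : Fin n → PFModule α
  citation : (v : Fin n) → Fin (modules v).proof.length → Option (Fin n)
  parent : Fin n → Option (Fin n)
  invocation_acyclic : ∀ v, ¬ Relation.TransGen (fun a b => ∃ i, citation a i = some b) v v
  scope_acyclic : ∀ v, ¬ Relation.TransGen (fun a b => parent a = some b) v v

namespace PFProof

variable {α : Type}

/-- The edges of the dependency graph `G`: the proof of `v` invokes the conclusion of `u`. -/
def Invokes (P : PFProof α) (v u : Fin P.n) : Prop :=
  ∃ i, P.citation v i = some u

/-- `u` is a (proper) ancestor of `v` in the scope forest `T`. -/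
def IsAncestor (P : PFProof α) (v u : Fin P.n) : Prop :=
  Relation.TransGen (fun a b => P.parent a = some b) v u

/-- The path that ends in `v` and starts `k` scope levels above `v`, or at the root of `v` if that
is nearer. -/
def pathFrom (P : PFProof α) : ℕ → Fin P.n → List (Fin P.n)
  | 0, v => [v]
  | k + 1, v =>
    match P.parent v with
    | none => [v]
    | some u => P.pathFrom k u ++ [v]

/-- The path of the scope forest from a root to `v` (it has at most `n` nodes). -/
def rootPath (P : PFProof α) (v : Fin P.n) : List (Fin P.n) :=
  P.pathFrom P.n v

open Classical in
/-- The nodes with property `S`, listed in the left-to-right depth-first order of the scope forest,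
in which roots and siblings are visited in the order of the sequence of modules.  Depth-first
traversal (a node before its descendants, the subtrees of siblings one after the other) is the
lexicographic order of the root paths. -/
noncomputable def dfsList (P : PFProof α) (S : Fin P.n → Prop) : List (Fin P.n) :=
  ((List.finRange P.n).filter fun u => decide (S u)).mergeSort
    fun a b => decide (P.rootPath a ≤ P.rootPath b)

/-- The ancestors `Anc_T(v)` in depth-first order. -/
noncomputable def ancestors (P : PFProof α) (v : Fin P.n) : List (Fin P.n) :=
  P.dfsList (P.IsAncestor v)

/-- The dependencies `Dep_G(v)` in depth-first order. -/
noncomputable def dependencies (P : PFProof α) (v : Fin P.n) : List (Fin P.n) :=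
  P.dfsList (P.Invokes v)

/-- The depth of the scope forest: the largest number of edges on a path from a node up to its
root, that is, the largest number of ancestors. -/
noncomputable def scopeDepth (P : PFProof α) : ℕ :=
  Finset.univ.sup fun v => (P.ancestors v).length

/-- A good Pseudo-Formal proof with constants `D` and `L`: the depth of the scope forest is at most
`D`; in each module the length of the conclusion, the length of the proof, and the number and the
total length of the premises are at most `L`. -/
structure IsGood (P : PFProof α) (D L : ℕ) : Prop where
  depth_le : P.scopeDepth ≤ D
  conclusion_le : ∀ v, (P.modules v).conclusion.length ≤ L
  proof_le : ∀ v, (P.modules v).proof.length ≤ L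
  premises_count_le : ∀ v, (P.modules v).premises.length ≤ L
  premises_length_le : ∀ v, (((P.modules v).premises).map List.length).sum ≤ L

end PFProof

/-! ## Module contexts and their serialization -/

/-- The data that a module verifier sees. -/
structure ModuleContext (α : Type) where
  ancestorPremises : List (List (List α))
  dependencyConclusions : List (List α)
  premises : List (List α)
  conclusion : List α
  proof : List α

/-- The module context `C_v(P)`. -/
noncomputable def PFProof.context {α : Type} (P : PFProof α) (v : Fin P.n) : ModuleContext α where
  ancestorPremises := (P.ancestors v).map fun u => (P.modules u).premises
  dependencyConclusions := (P.dependencies v).map fun u => (P.modules u).conclusion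
  premises := (P.modules v).premises
  conclusion := (P.modules v).conclusion
  proof := (P.modules v).proof

/-- Symbols of serialized contexts: characters, and three delimiters that end a text, a list of
texts, and a section of the context. -/
inductive Sym (α : Type) where
  | char (a : α)
  | endText
  | endList
  | endSection

/-- A text followed by its delimiter. -/
def serializeText {α : Type} (s : List α) : List (Sym α) :=
  s.map Sym.char ++ [Sym.endText]

/-- A list of texts followed by its delimiter. -/
def serializeTexts {α : Type} (l : List (List α)) : List (Sym α) :=
  l.flatMap serializeText ++ [Sym.endList]

/-- The serialization of a module context. -/
def ModuleContext.serialize {α : Type} (C : ModuleContext α) : List (Sym α) :=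
  C.ancestorPremises.flatMap serializeTexts ++ [Sym.endSection] ++
  serializeTexts C.dependencyConclusions ++ [Sym.endSection] ++
  serializeTexts C.premises ++ [Sym.endSection] ++
  serializeText C.conclusion ++ [Sym.endSection] ++
  serializeText C.proof ++ [Sym.endSection]

/-- The tuples that are the module context of some module of some Pseudo-Formal proof. -/
def ModuleContext.IsRealized {α : Type} (C : ModuleContext α) : Prop :=
  ∃ (P : PFProof α) (v : Fin P.n), P.context v = C

/-! ## Block-wise verification algorithms -/

/-- A block-wise verification algorithm, given by its module verifier `check`: a Turing machine
which, on the serialization of any module context `C`, halts with output `check C`, in time at most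
linear in the length of that serialization. -/
structure BlockwiseVerifier (α : Type) where
  check : ModuleContext α → Bool
  machine : Turing.TM2ComputableInTime
    (fun C : {C : ModuleContext α // C.IsRealized} => C.1.serialize)
    Computability.encodeBool
    (fun C => check C.1)
  linear_time : ∃ a b : ℕ, ∀ N, machine.time N ≤ a * N + b

/-- The algorithm accepts `P` if and only if all module checks accept. -/
def BlockwiseVerifier.Accepts {α : Type} (A : BlockwiseVerifier α) (P : PFProof α) : Prop :=
  ∀ v : Fin P.n, A.check (P.context v) = true

/-! ## Transformers

Decoder-only Transformers with projected pre-norm and strict causal saturated attention (each head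
averages the values over all strictly earlier positions of maximal score), without positional
encoding.  The finitely many parameters are fixed rational numbers.  Hidden states have logarithmic
precision: on a context of `N` tokens they are fixed-point numbers of `O(log N)` bits, and the
result of every sublayer is rounded to such numbers. -/

/-- Rounding to the fixed-point numbers with `p` fractional bits and absolute value at most
`2 ^ p`. -/
noncomputable def roundTo (p : ℕ) (x : ℝ) : ℝ :=
  max (-(2 : ℝ) ^ p) (min ((2 : ℝ) ^ p) ((round (x * (2 : ℝ) ^ p) : ℝ) / (2 : ℝ) ^ p))

/-- Layer normalization: subtract the mean and divide by the Euclidean norm (the zero vector stays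
zero). -/
noncomputable def layerNorm {d : ℕ} (x : Fin d → ℝ) : Fin d → ℝ :=
  let y : Fin d → ℝ := fun i => x i - (∑ j, x j) / d
  fun i => y i / √(∑ j, y j ^ 2)

/-- A rational matrix acting on a real vector. -/
noncomputable def applyMatrix {m n : ℕ} (M : Matrix (Fin n) (Fin m) ℚ) (x : Fin m → ℝ) :
    Fin n → ℝ :=
  fun i => ∑ j, (M i j : ℝ) * x j

/-- An affine map with rational coefficients. -/
structure Affine (m n : ℕ) where
  weight : Matrix (Fin n) (Fin m) ℚ
  bias : Fin n → ℚ

/-- The value of an affine map. -/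
noncomputable def Affine.apply {m n : ℕ} (f : Affine m n) (x : Fin m → ℝ) : Fin n → ℝ :=
  fun i => applyMatrix f.weight x i + (f.bias i : ℝ)

/-- An attention head on a residual stream of dimension `d`. -/
structure Head (d : ℕ) where
  dim : ℕ
  query : Affine d dim
  key : Affine d dim
  value : Affine d dim
  output : Matrix (Fin d) (Fin dim) ℚ

open Classical in
/-- The strictly earlier positions of maximal score, for the head `H` at position `i`. -/
noncomputable def Head.attended {d N : ℕ} (H : Head d) (z : Fin N → Fin d → ℝ) (i : Fin N) :
    Finset (Fin N) :=
  Finset.univ.filter fun j => j < i ∧ ∀ j' < i,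
    (∑ k, H.query.apply (z i) k * H.key.apply (z j') k) ≤
      ∑ k, H.query.apply (z i) k * H.key.apply (z j) k

/-- The output of the head `H` at position `i` (zero at the first position, which attends to
nothing). -/
noncomputable def Head.apply {d N : ℕ} (H : Head d) (z : Fin N → Fin d → ℝ) (i : Fin N) :
    Fin d → ℝ :=
  applyMatrix H.output fun k =>
    (∑ j ∈ H.attended z i, H.value.apply (z j) k) / ((H.attended z i).card : ℝ)

/-- A layer: an attention sublayer and a feedforward sublayer of width `ffDim`, each with the matrix
of its projected pre-norm. -/
structure Layer (d : ℕ) where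
  heads : List (Head d)
  attnProj : Matrix (Fin d) (Fin d) ℚ
  ffDim : ℕ
  ffProj : Matrix (Fin d) (Fin d) ℚ
  ffIn : Affine d ffDim
  ffOut : Affine ffDim d

/-- The attention sublayer, with residual connection, rounded to precision `p`. -/
noncomputable def Layer.attention {d N : ℕ} (Λ : Layer d) (p : ℕ) (h : Fin N → Fin d → ℝ) :
    Fin N → Fin d → ℝ :=
  fun i c => roundTo p
    (h i c + (Λ.heads.map fun H =>
      H.apply (fun j => layerNorm (applyMatrix Λ.attnProj (h j))) i c).sum)

/-- The feedforward sublayer (one hidden layer of ReLUs), with residual connection, rounded to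
precision `p`. -/
noncomputable def Layer.feedforward {d N : ℕ} (Λ : Layer d) (p : ℕ) (h : Fin N → Fin d → ℝ) :
    Fin N → Fin d → ℝ :=
  fun i c => roundTo p
    (h i c + Λ.ffOut.apply
      (fun k => max 0 (Λ.ffIn.apply (layerNorm (applyMatrix Λ.ffProj (h i))) k)) c)

/-- The tokens of a Transformer that reads symbols from `S`: the input symbols, `w` work tokens, and
the two verdicts (`true` for accept and `false` for reject). -/
inductive Token (S : Type) (w : ℕ) where
  | input (s : S)
  | work (i : Fin w)
  | verdict (b : Bool)

/-- A Transformer of fixed size; only the number of bits of the hidden states grows, as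
`precision * (⌊log₂ N⌋ + 1)`, with the length `N` of the context. -/
structure Transformer (S : Type) where
  work : ℕ
  dim : ℕ
  precision : ℕ
  embed : Token S work → Fin dim → ℚ
  layers : List (Layer dim)
  unembed : Token S work → Fin dim → ℚ
  unembedBias : Token S work → ℚ

namespace Transformer

variable {S : Type}

/-- The precision on contexts of length `N`. -/
def bits (T : Transformer S) (N : ℕ) : ℕ :=
  T.precision * (Nat.log 2 N + 1)

/-- The hidden states after the last layer, at all positions of the context `x`. -/
noncomputable def hidden (T : Transformer S) (x : List (Token S T.work)) :
    Fin x.length → Fin T.dim → ℝ :=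
  T.layers.foldl (fun h Λ => Λ.feedforward (T.bits x.length) (Λ.attention (T.bits x.length) h))
    fun i c => roundTo (T.bits x.length) (T.embed x[i] c : ℝ)

/-- The logit of the token `t` at position `i` of the context `x`. -/
noncomputable def logit (T : Transformer S) (x : List (Token S T.work)) (i : Fin x.length)
    (t : Token S T.work) : ℝ :=
  (∑ c, (T.unembed t c : ℝ) * T.hidden x i c) + (T.unembedBias t : ℝ)

/-- One decoding step: `t` is the unique token of maximal logit at the last position of the nonempty
context `x`. -/
def Next (T : Transformer S) (x : List (Token S T.work)) (t : Token S T.work) : Prop :=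
  ∃ i : Fin x.length, i.1 + 1 = x.length ∧ ∀ s, s ≠ t → T.logit x i s < T.logit x i t

/-- Started on the context `x`, greedy decoding generates the tokens `y`. -/
def Generates (T : Transformer S) (x y : List (Token S T.work)) : Prop :=
  ∀ i : Fin y.length, T.Next (x ++ y.take i) y[i]

/-- A call on the prompt `s`: decoding goes on until the first verdict token, which is `b`; by then
the context (prompt and generated tokens) has length `ℓ`. -/
def Returns (T : Transformer S) (s : List S) (b : Bool) (ℓ : ℕ) : Prop :=
  ∃ y : List (Token S T.work), (∀ b', Token.verdict b' ∉ y) ∧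
    T.Generates (s.map Token.input) (y ++ [Token.verdict b]) ∧
    ℓ = s.length + (y.length + 1)

end Transformer

end PseudoFormal

/-!
A fixed Transformer can run a multi-stack machine on its own output, with a constant number of
decoded tokens per machine step.  This is applied to the module verifier: the calls are the modules
themselves, a context serializes to `O(L (L + D + 1))` symbols, because a module has at most `D`
ancestors and at most `L` dependencies (different ones are invoked at different characters), and the
verifier takes linear time.  Decoding is deterministic, so all calls return accept if and only if the
verifier accepts all contexts.

The simulation passes through two intermediate notions.

* A `Program` has stacks that are empty at the start and an input that is read once.  A `TM2` machine
  becomes a program (`Compiler.outputs_of_tm2Outputs`): its input stack is the stack of the program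
  on top of the unread input.
* A `TokenSystem` keeps the memory of a program in the history of tokens (`Program.tokenSystem`).
  Every token refers to one pointer (of a stack, or of the input) and moves it by `-1`, `0` or `1`, so
  that the position of a pointer is a sum over the history; and it adds `-1`, `0` or `1` times a symbol
  to the memory cell at its pointer, so that the content of a cell is a sum over the history too: a
  push adds a symbol and a pop subtracts it again.  The next token depends on the last one and on the
  content of one memory cell or one input symbol (`Program.Outputs.exists_chain`).

Saturated attention computes these sums (`TokenSystem.exists_transformer`).  As a head averages over
an unknown number `s` of positions, the pointer `h` is first obtained as the pair of averages
`(h / s, 1 / s)`, the second one being the average of the indicator of the first position; layer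
normalization turns the pair into the unit vector in direction `(h, 1)`.  Position `j` obtains the
direction `(j, 1)` in the same way, so that attention from `h` to `j` by inner products selects the
position `j = h`: the directions of different numbers below `N` have an inner product of at most
`1 - 1 / (2 N ^ 4)` (`dir_inner_le`), and the rounding errors for `24 (log₂ N + 1)` bits are smaller.
This lookup yields the input symbol at the position of the input pointer.  It also yields a code of
`h` that is copied from position `h`, and hence is exactly the same wherever the pointer has the same
value, whatever the rounding errors (`code_injective`, `cellScore_le`).  So a second lookup, with
codes and pointers as keys, attends exactly to the history of a memory cell (`RVal_eq`), and the
average of the contributions is a positive multiple of the symbol in the cell.  Layer normalization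
makes it large enough for the units of the last feedforward sublayer, one for each pair of a last
token and an observation.
-/

namespace PseudoFormal

/-! ### Rounding -/

theorem round_le_round_of_le {x y : ℝ} (h : x ≤ y) : round x ≤ round y := by
  rw [round_eq, round_eq]
  exact Int.floor_mono (by gcongr)

theorem roundTo_mono (p : ℕ) : Monotone (roundTo p) := by
  intro x y h
  unfold roundTo
  gcongr
  exact round_le_round_of_le (by gcongr)

theorem roundTo_intCast_div (p : ℕ) (k : ℤ) (h : |(k : ℝ)| ≤ 2 ^ p * 2 ^ p) :
    roundTo p (k / 2 ^ p) = k / 2 ^ p := by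
  have h2 : (0 : ℝ) < 2 ^ p := by positivity
  obtain ⟨h3, h4⟩ := abs_le.1 h
  unfold roundTo
  rw [div_mul_cancel₀ _ h2.ne', round_intCast, min_eq_right, max_eq_right]
  · rw [le_div_iff₀ h2]; linarith
  · rw [div_le_iff₀ h2]; linarith

theorem roundTo_intCast (p : ℕ) (k : ℤ) (h : |(k : ℝ)| ≤ 2 ^ p) : roundTo p k = k := by
  have h2 : (0 : ℝ) < 2 ^ p := by positivity
  have := roundTo_intCast_div p (k * 2 ^ p) (by
    push_cast; rw [abs_mul, abs_of_pos h2]; gcongr)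
  simpa [h2.ne'] using this

@[simp] theorem roundTo_zero (p : ℕ) : roundTo p 0 = 0 := by
  simpa using roundTo_intCast p 0 (by simp)

@[simp] theorem roundTo_one (p : ℕ) : roundTo p 1 = 1 := by
  simpa using roundTo_intCast p 1 (by simpa using one_le_pow₀ (one_le_two : (1 : ℝ) ≤ 2))

theorem roundTo_nonneg {p : ℕ} {x : ℝ} (h : 0 ≤ x) : 0 ≤ roundTo p x := by
  simpa using roundTo_mono p h

theorem one_le_roundTo {p : ℕ} {x : ℝ} (h : 1 ≤ x) : 1 ≤ roundTo p x := by
  simpa using roundTo_mono p h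

theorem roundTo_le_one {p : ℕ} {x : ℝ} (h : x ≤ 1) : roundTo p x ≤ 1 := by
  simpa using roundTo_mono p h

theorem half_le_roundTo {p : ℕ} (hp : 1 ≤ p) {x : ℝ} (h : 1 / 2 ≤ x) : 1 / 2 ≤ roundTo p x := by
  obtain ⟨q, rfl⟩ : ∃ q, p = q + 1 := ⟨p - 1, by omega⟩
  have h2 : (1 : ℝ) ≤ 2 ^ q := one_le_pow₀ one_le_two
  have h3 := roundTo_intCast_div (q + 1) (2 ^ q) (by
    push_cast; rw [abs_of_nonneg (by positivity), pow_succ]; nlinarith)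
  have h4 : (((2 ^ q : ℤ) : ℝ)) / 2 ^ (q + 1) = 1 / 2 := by
    push_cast; rw [pow_succ]; field_simp
  rw [h4] at h3
  rw [← h3]
  exact roundTo_mono _ h

theorem roundTo_pos {p : ℕ} {x : ℝ} (h : 1 / 2 ^ p ≤ x) : 0 < roundTo p x := by
  have h1 := roundTo_intCast_div p 1 (by
    have : (1 : ℝ) ≤ 2 ^ p := one_le_pow₀ one_le_two
    push_cast; rw [abs_one]; nlinarith)
  have h2 := roundTo_mono p h
  push_cast at h1
  rw [h1] at h2
  exact lt_of_lt_of_le (by positivity) h2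

theorem exists_roundTo_eq (p : ℕ) (x : ℝ) :
    ∃ k : ℤ, roundTo p x = k / 2 ^ p ∧ |(k : ℝ)| ≤ 2 ^ p * 2 ^ p := by
  have h2 : (0 : ℝ) < 2 ^ p := by positivity
  have e1 : ((2 ^ p * 2 ^ p : ℤ) : ℝ) / 2 ^ p = 2 ^ p := by push_cast; field_simp
  have e2 : ((-(2 ^ p * 2 ^ p) : ℤ) : ℝ) / 2 ^ p = -2 ^ p := by push_cast; field_simp
  unfold roundTo
  rcases le_total ((round (x * 2 ^ p) : ℝ) / 2 ^ p) (2 ^ p) with h | h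
  · rw [min_eq_right h]
    rcases le_total (-(2 : ℝ) ^ p) ((round (x * 2 ^ p) : ℝ) / 2 ^ p) with h' | h'
    · rw [max_eq_right h']
      refine ⟨_, rfl, abs_le.2 ⟨?_, ?_⟩⟩
      · rw [le_div_iff₀ h2] at h'; linarith
      · rw [div_le_iff₀ h2] at h; linarith
    · rw [max_eq_left h']
      refine ⟨_, e2.symm, ?_⟩
      push_cast; rw [abs_neg, abs_of_pos (by positivity)]
  · rw [min_eq_left h, max_eq_right (by linarith)]
    refine ⟨_, e1.symm, ?_⟩
    push_cast; rw [abs_of_pos (by positivity)]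

/-- Values that are already rounded are left alone, so a sublayer that adds nothing to a coordinate
preserves it. -/
@[simp] theorem roundTo_roundTo (p : ℕ) (x : ℝ) : roundTo p (roundTo p x) = roundTo p x := by
  obtain ⟨k, h, hk⟩ := exists_roundTo_eq p x
  rw [h, roundTo_intCast_div p k hk]

theorem abs_roundTo_sub_le' {p : ℕ} {x : ℝ} (h : |x| ≤ 2 ^ p) :
    |roundTo p x - x| ≤ 1 / 2 ^ p := by
  have h2 : (0 : ℝ) < 2 ^ p := by positivity
  obtain ⟨h3, h4⟩ := abs_le.1 h
  have h5 : ((-(2 ^ p * 2 ^ p) : ℤ) : ℝ) ≤ x * 2 ^ p := by push_cast; nlinarith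
  have h6 : x * 2 ^ p ≤ ((2 ^ p * 2 ^ p : ℤ) : ℝ) := by push_cast; nlinarith
  have h7 : -(2 ^ p * 2 ^ p) ≤ round (x * (2 : ℝ) ^ p) := by
    simpa only [round_intCast] using round_le_round_of_le h5
  have h8 : round (x * (2 : ℝ) ^ p) ≤ 2 ^ p * 2 ^ p := by
    simpa only [round_intCast] using round_le_round_of_le h6
  have h7' : -((2 : ℝ) ^ p * 2 ^ p) ≤ (round (x * (2 : ℝ) ^ p) : ℝ) := by exact_mod_cast h7
  have h8' : (round (x * (2 : ℝ) ^ p) : ℝ) ≤ 2 ^ p * 2 ^ p := by exact_mod_cast h8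
  unfold roundTo
  rw [min_eq_right, max_eq_right]
  · have h9 := abs_sub_round (x * (2 : ℝ) ^ p)
    rw [abs_sub_comm] at h9
    have : (round (x * (2 : ℝ) ^ p) : ℝ) / 2 ^ p - x
        = (round (x * (2 : ℝ) ^ p) - x * 2 ^ p) / 2 ^ p := by field_simp
    rw [this, abs_div, abs_of_pos h2]
    gcongr
    linarith
  · rw [le_div_iff₀ h2]; linarith
  · rw [div_le_iff₀ h2]; linarith

theorem abs_roundTo_sub_le {p : ℕ} {x : ℝ} (h : |x| ≤ 1) : |roundTo p x - x| ≤ 1 / 2 ^ p :=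
  abs_roundTo_sub_le' (h.trans (one_le_pow₀ one_le_two))

/-! ### Normalization -/

/-- Layer normalization of a vector `x` together with its negative, on the first half: such a
doubled vector has mean zero, so only the division by its Euclidean norm is left. -/
noncomputable def nrm {ι : Type*} [Fintype ι] (x : ι → ℝ) : ι → ℝ :=
  fun c => x c / √(2 * ∑ k, x k ^ 2)

section
variable {ι : Type*} [Fintype ι] (x : ι → ℝ)

theorem nrm_eq_div {r : ℝ} (hr : 0 ≤ r) (h : 2 * ∑ k, x k ^ 2 = r ^ 2) (c : ι) :
    nrm x c = x c / r := by
  rw [nrm, h, Real.sqrt_sq hr]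

end

/-- Relative stability of normalizing a planar vector: if `(x, y)` is within `ε` of `(h, 1) / s`,
then its direction is within `3 s ε` of the direction of `(h, 1)`. -/
theorem abs_normalize_sub_le {h s x y ε : ℝ} (hh : 0 ≤ h) (hs : 1 ≤ s) (hx : |x - h / s| ≤ ε)
    (hy : |y - 1 / s| ≤ ε) (hε : s * ε ≤ 1 / 8) :
    |x / √(x ^ 2 + y ^ 2) - h / √(h ^ 2 + 1)| ≤ 3 * (s * ε) ∧
    |y / √(x ^ 2 + y ^ 2) - 1 / √(h ^ 2 + 1)| ≤ 3 * (s * ε) := by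
  have hs0 : 0 < s := by linarith
  set η := s * ε with hη
  have hX : |s * x - h| ≤ η := by
    have : s * x - h = s * (x - h / s) := by field_simp
    rw [this, abs_mul, abs_of_pos hs0]; exact mul_le_mul_of_nonneg_left hx hs0.le
  have hY : |s * y - 1| ≤ η := by
    have : s * y - 1 = s * (y - 1 / s) := by field_simp
    rw [this, abs_mul, abs_of_pos hs0]; exact mul_le_mul_of_nonneg_left hy hs0.le
  set X := s * x with hXd
  set Y := s * y with hYd
  have hη0 : 0 ≤ η := (abs_nonneg _).trans hX
  have hR : √(x ^ 2 + y ^ 2) = √(X ^ 2 + Y ^ 2) / s := by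
    rw [hXd, hYd, mul_pow, mul_pow, ← mul_add, Real.sqrt_mul (by positivity), Real.sqrt_sq hs0.le]
    field_simp
  have ex : x / √(x ^ 2 + y ^ 2) = X / √(X ^ 2 + Y ^ 2) := by
    rw [hR, hXd]; field_simp
  have ey : y / √(x ^ 2 + y ^ 2) = Y / √(X ^ 2 + Y ^ 2) := by
    rw [hR, hYd]; field_simp
  rw [ex, ey]
  obtain ⟨hX1, hX2⟩ := abs_le.1 hX
  obtain ⟨hY1, hY2⟩ := abs_le.1 hY
  have hYpos : 7 / 8 ≤ Y := by linarith
  set R := √(X ^ 2 + Y ^ 2) with hRd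
  set r := √(h ^ 2 + 1) with hrd
  have hR2 : R ^ 2 = X ^ 2 + Y ^ 2 := Real.sq_sqrt (by positivity)
  have hr2 : r ^ 2 = h ^ 2 + 1 := Real.sq_sqrt (by positivity)
  have hr1 : 1 ≤ r := Real.one_le_sqrt.2 (by nlinarith)
  have hR0 : 0 < R := Real.sqrt_pos.2 (by nlinarith [sq_nonneg X])
  have hXR : |X| ≤ R := Real.abs_le_sqrt (by nlinarith [sq_nonneg Y])
  have hYR : |Y| ≤ R := Real.abs_le_sqrt (by nlinarith [sq_nonneg X])
  have hhr : h ≤ r := Real.le_sqrt_of_sq_le (by linarith)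
  have hRr : |r - R| ≤ 2 * η := by
    have hprod : (r - R) * (r + R) = (h - X) * (h + X) + (1 - Y) * (1 + Y) := by
      linear_combination hr2 - hR2
    have h1 : |(r - R) * (r + R)| ≤ 2 * η * (r + R) := by
      rw [hprod]
      refine (abs_add_le _ _).trans ?_
      rw [abs_mul, abs_mul, abs_sub_comm h, abs_sub_comm 1]
      have a1 : |h + X| ≤ r + R := (abs_add_le _ _).trans (by rw [abs_of_nonneg hh]; linarith)
      have a2 : |1 + Y| ≤ r + R := (abs_add_le _ _).trans (by rw [abs_one]; linarith)
      have := mul_le_mul hX a1 (abs_nonneg _) hη0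
      have := mul_le_mul hY a2 (abs_nonneg _) hη0
      linarith
    rw [abs_mul, abs_of_pos (by linarith : 0 < r + R)] at h1
    exact le_of_mul_le_mul_right h1 (by linarith)
  have key : ∀ A a : ℝ, |A - a| ≤ η → |A| ≤ R → |A / R - a / r| ≤ 3 * η := by
    intro A a h1 h2
    have e : A / R - a / r = ((A - a) + (A / R) * (r - R)) / r := by
      field_simp; ring
    rw [e, abs_div, abs_of_pos (by linarith : 0 < r), div_le_iff₀ (by linarith)]
    refine (abs_add_le _ _).trans ?_
    rw [abs_mul, abs_div, abs_of_pos hR0]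
    have h3 : |A| / R ≤ 1 := (div_le_one hR0).2 h2
    have h4 : |A| / R * |r - R| ≤ 1 * (2 * η) :=
      mul_le_mul h3 hRr (abs_nonneg _) zero_le_one
    nlinarith
  exact ⟨key X h hX hXR, key Y 1 hY hYR⟩

/-- Distinct natural numbers up to `n` have directions `(a, 1)`, `(b, 1)` whose cosine stays away
from `1`. -/
theorem cos_le_of_ne {a b n : ℕ} (hab : a ≠ b) (ha : a < n) (hb : b < n) :
    (a * b + 1 : ℝ) / (√((a : ℝ) ^ 2 + 1) * √((b : ℝ) ^ 2 + 1)) ≤ 1 - 1 / (2 * (n : ℝ) ^ 4) := by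
  have hn : (1 : ℝ) ≤ n := by exact_mod_cast (by omega : 1 ≤ n)
  have ha' : (a : ℝ) + 1 ≤ n := by exact_mod_cast ha
  have hb' : (b : ℝ) + 1 ≤ n := by exact_mod_cast hb
  have ha0 : (0 : ℝ) ≤ a := a.cast_nonneg
  have hb0 : (0 : ℝ) ≤ b := b.cast_nonneg
  have hsq : (1 : ℝ) ≤ ((a : ℝ) - b) ^ 2 := by
    have : (1 : ℤ) ≤ ((a : ℤ) - b) ^ 2 := by
      have : ((a : ℤ) - b) ≠ 0 := by omega
      have := sq_pos_of_ne_zero this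
      omega
    exact_mod_cast this
  rw [← Real.sqrt_mul (by positivity)]
  set M := ((a : ℝ) ^ 2 + 1) * ((b : ℝ) ^ 2 + 1) with hM
  have hM1 : M ≤ (n : ℝ) ^ 4 := by
    have h1 : (a : ℝ) ^ 2 + 1 ≤ (n : ℝ) ^ 2 := by nlinarith
    have h2 : (b : ℝ) ^ 2 + 1 ≤ (n : ℝ) ^ 2 := by nlinarith
    calc M ≤ (n : ℝ) ^ 2 * (n : ℝ) ^ 2 := mul_le_mul h1 h2 (by positivity) (by positivity)
      _ = _ := by ring
  have hM0 : 0 < M := by positivity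
  have hMs : 0 < √M := Real.sqrt_pos.2 hM0
  set t := (a * b + 1 : ℝ) / √M with ht
  have ht2 : t ^ 2 = 1 - ((a : ℝ) - b) ^ 2 / M := by
    rw [ht, div_pow, Real.sq_sqrt hM0.le]
    rw [eq_sub_iff_add_eq, ← add_div, div_eq_one_iff_eq hM0.ne', hM]; ring
  have h4 : 1 / (n : ℝ) ^ 4 ≤ ((a : ℝ) - b) ^ 2 / M := by
    rw [div_le_div_iff₀ (by positivity) hM0]; nlinarith [sq_nonneg ((n : ℝ) ^ 2)]
  have h5 : 1 / (2 * (n : ℝ) ^ 4) = (1 / (n : ℝ) ^ 4) / 2 := by field_simp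
  rw [h5]
  nlinarith [sq_nonneg (t - 1)]

/-! ### Layers given by rational linear maps -/

/-- Linear functionals with rational coefficients. -/
def IsRatLinear {ι : Type*} [Fintype ι] (f : (ι → ℝ) → ℝ) : Prop :=
  ∃ w : ι → ℚ, ∀ x, f x = ∑ c, (w c : ℝ) * x c

namespace IsRatLinear

variable {ι : Type*} [Fintype ι]

theorem zero : IsRatLinear fun _ : ι → ℝ => 0 :=
  ⟨fun _ => 0, by simp⟩

theorem coord (a : ι) : IsRatLinear fun x : ι → ℝ => x a := by
  classical
  exact ⟨fun c => if c = a then 1 else 0, by simp [apply_ite (Rat.cast : ℚ → ℝ)]⟩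

theorem add {f g : (ι → ℝ) → ℝ} (hf : IsRatLinear f) (hg : IsRatLinear g) :
    IsRatLinear fun x => f x + g x := by
  obtain ⟨v, hv⟩ := hf
  obtain ⟨w, hw⟩ := hg
  exact ⟨v + w, fun x => by simp [hv, hw, add_mul, Finset.sum_add_distrib]⟩

theorem const_mul (q : ℚ) {f : (ι → ℝ) → ℝ} (hf : IsRatLinear f) :
    IsRatLinear fun x => q * f x := by
  obtain ⟨v, hv⟩ := hf
  exact ⟨fun c => q * v c, fun x => by simp [hv, Finset.mul_sum, mul_assoc]⟩

theorem sub {f g : (ι → ℝ) → ℝ} (hf : IsRatLinear f) (hg : IsRatLinear g) :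
    IsRatLinear fun x => f x - g x := by
  have := hf.add (hg.const_mul (-1))
  simpa [sub_eq_add_neg] using this

theorem sum {κ : Type*} (s : Finset κ) {f : κ → (ι → ℝ) → ℝ} (hf : ∀ k, IsRatLinear (f k)) :
    IsRatLinear fun x => ∑ k ∈ s, f k x := by
  classical
  induction s using Finset.induction_on with
  | empty => simpa using zero
  | insert a s ha ih => simpa [Finset.sum_insert ha] using (hf a).add ih

theorem of_ite {p : Prop} {_ : Decidable p} {f g : (ι → ℝ) → ℝ} (hf : IsRatLinear f)
    (hg : IsRatLinear g) : IsRatLinear fun x => if p then f x else g x := by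
  split_ifs
  exacts [hf, hg]

end IsRatLinear

/-- The data of a Transformer layer whose coordinates are indexed by `ι`: the projections of the
two sublayers, query, key and value of the only head, and the input map of the feedforward sublayer,
whose hidden unit `c` is added to coordinate `c`. -/
structure LayerSpec (ι : Type*) where
  attnProj : (ι → ℝ) → ι → ℝ
  query : (ι → ℝ) → ι → ℝ
  key : (ι → ℝ) → ι → ℝ
  value : (ι → ℝ) → ι → ℝ
  ffProj : (ι → ℝ) → ι → ℝ
  ffIn : (ι → ℝ) → ι → ℝ

open Classical in
/-- The strictly earlier positions of maximal score. -/
noncomputable def attendedSet {N : ℕ} (score : Fin N → Fin N → ℝ) (i : Fin N) : Finset (Fin N) :=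
  Finset.univ.filter fun j => j < i ∧ ∀ j' < i, score i j' ≤ score i j

namespace LayerSpec

variable {ι : Type*} [Fintype ι]

/-- All maps of the layer are linear with rational coefficients. -/
structure IsRational (Λ : LayerSpec ι) : Prop where
  attnProj : ∀ c, IsRatLinear fun x => Λ.attnProj x c
  query : ∀ c, IsRatLinear fun x => Λ.query x c
  key : ∀ c, IsRatLinear fun x => Λ.key x c
  value : ∀ c, IsRatLinear fun x => Λ.value x c
  ffProj : ∀ c, IsRatLinear fun x => Λ.ffProj x c
  ffIn : ∀ c, IsRatLinear fun x => Λ.ffIn x c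

/-- The score of position `j` for the query at position `i`. -/
noncomputable def score (Λ : LayerSpec ι) {N : ℕ} (h : Fin N → ι → ℝ) (i j : Fin N) : ℝ :=
  ∑ c, Λ.query (nrm (Λ.attnProj (h i))) c * Λ.key (nrm (Λ.attnProj (h j))) c

/-- The attention sublayer. -/
noncomputable def attention (Λ : LayerSpec ι) (p : ℕ) {N : ℕ} (h : Fin N → ι → ℝ) :
    Fin N → ι → ℝ := fun i c =>
  roundTo p (h i c +
    (∑ j ∈ attendedSet (Λ.score h) i, Λ.value (nrm (Λ.attnProj (h j))) c) /
      ((attendedSet (Λ.score h) i).card : ℝ))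

/-- The feedforward sublayer. -/
noncomputable def feedforward (Λ : LayerSpec ι) (p : ℕ) {N : ℕ} (h : Fin N → ι → ℝ) :
    Fin N → ι → ℝ := fun i c =>
  roundTo p (h i c + max 0 (Λ.ffIn (nrm (Λ.ffProj (h i))) c))

end LayerSpec

section Encoding

variable {ι : Type*} {d : ℕ} (e : Fin d ≃ ι ⊕ ι)

/-- A pair of vectors indexed by `ι` as a vector in the residual stream. -/
def pairVec (x y : ι → ℝ) : Fin d → ℝ := fun c => Sum.elim x y (e c)

/-- The matrix that maps a pair `(x, y)` to the pair `(a x, b x)`. -/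
def pairMatrix (a b : ι → ι → ℚ) : Matrix (Fin d) (Fin d) ℚ := fun r c =>
  Sum.elim (fun k => Sum.elim (a k) (b k) (e r)) (fun _ => 0) (e c)

variable [Fintype ι]

theorem applyMatrix_pairMatrix (a b : ι → ι → ℚ) (x y : ι → ℝ) :
    applyMatrix (pairMatrix e a b) (pairVec e x y) =
      pairVec e (fun r => ∑ c, (a c r : ℝ) * x c) (fun r => ∑ c, (b c r : ℝ) * x c) := by
  funext r
  unfold applyMatrix pairMatrix pairVec
  rw [← e.symm.sum_comp]
  simp only [Equiv.apply_symm_apply, Fintype.sum_sum_type, Sum.elim_inl, Sum.elim_inr, Rat.cast_zero,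
    zero_mul, Finset.sum_const_zero, add_zero]
  cases e r <;> simp

theorem sum_pairVec (x y : ι → ℝ) : ∑ c, pairVec e x y c = ∑ c, x c + ∑ c, y c := by
  unfold pairVec
  rw [← e.symm.sum_comp]
  simp [Fintype.sum_sum_type]

theorem layerNorm_pairVec_neg (x : ι → ℝ) :
    layerNorm (pairVec e x (-x)) = pairVec e (nrm x) (-nrm x) := by
  have h0 : ∑ c, pairVec e x (-x) c = 0 := by rw [sum_pairVec]; simp
  have h1 : ∑ c, pairVec e x (-x) c ^ 2 = 2 * ∑ c, x c ^ 2 := by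
    have : (fun c => pairVec e x (-x) c ^ 2) = pairVec e (fun c => x c ^ 2) (fun c => x c ^ 2) := by
      funext c; unfold pairVec; cases e c <;> simp
    rw [this, sum_pairVec]; ring
  funext c
  unfold layerNorm
  simp only [h0, zero_div, sub_zero, h1]
  unfold pairVec nrm
  cases e c <;> simp [neg_div]

theorem Affine.apply_pairMatrix (a : ι → ι → ℚ) (x y : ι → ℝ) :
    (Affine.mk (pairMatrix e a 0) 0).apply (pairVec e x y) =
      pairVec e (fun r => ∑ c, (a c r : ℝ) * x c) 0 := by
  funext r
  simp only [Affine.apply, applyMatrix_pairMatrix, Pi.zero_apply, Rat.cast_zero, add_zero,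
    zero_mul, Finset.sum_const_zero]
  rfl

open Classical in
/-- The projection of pairs onto the first half. -/
noncomputable def fstMatrix : Matrix (Fin d) (Fin d) ℚ :=
  pairMatrix e (fun c r => if c = r then 1 else 0) 0

theorem applyMatrix_fstMatrix (x y : ι → ℝ) :
    applyMatrix (fstMatrix e) (pairVec e x y) = pairVec e x 0 := by
  classical
  rw [fstMatrix, applyMatrix_pairMatrix]
  funext c
  unfold pairVec
  cases e c <;> simp [apply_ite (Rat.cast : ℚ → ℝ)]

/-- Every rational layer indexed by `ι` is realized by a Transformer layer, on residual streams whose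
second half is zero. -/
theorem LayerSpec.IsRational.exists_layer {Λ : LayerSpec ι} (hΛ : Λ.IsRational) :
    ∃ Λ' : Layer d, ∀ (N p : ℕ) (h : Fin N → ι → ℝ),
      Λ'.feedforward p (Λ'.attention p fun i => pairVec e (h i) 0) =
        fun i => pairVec e (Λ.feedforward p (Λ.attention p h) i) 0 := by
  classical
  choose pa hpa using hΛ.attnProj
  choose q hq using hΛ.query
  choose k hk using hΛ.key
  choose v hv using hΛ.value
  choose pf hpf using hΛ.ffProj
  choose fi hfi using hΛ.ffIn
  let lin (w : ι → ι → ℚ) : Affine d d := ⟨pairMatrix e (fun c r => w r c) 0, 0⟩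
  let proj (w : ι → ι → ℚ) : Matrix (Fin d) (Fin d) ℚ :=
    pairMatrix e (fun c r => w r c) (fun c r => -w r c)
  have hproj : ∀ (w : ι → ι → ℚ) (f : (ι → ℝ) → ι → ℝ),
      (∀ c x, f x c = ∑ a, (w c a : ℝ) * x a) → ∀ x : ι → ℝ,
      layerNorm (applyMatrix (proj w) (pairVec e x 0)) = pairVec e (nrm (f x)) (-nrm (f x)) := by
    intro w f hf x
    rw [← layerNorm_pairVec_neg, applyMatrix_pairMatrix]
    congr 2
    · funext c; exact (hf c x).symm
    · funext c; simp [hf]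
  have hlin : ∀ (w : ι → ι → ℚ) (f : (ι → ℝ) → ι → ℝ),
      (∀ c x, f x c = ∑ a, (w c a : ℝ) * x a) → ∀ x y : ι → ℝ,
      (lin w).apply (pairVec e x y) = pairVec e (f x) 0 := by
    intro w f hf x y
    rw [Affine.apply_pairMatrix]
    congr 1
    funext c; exact (hf c x).symm
  have hdot : ∀ a b : ι → ℝ, ∑ c, pairVec e a 0 c * pairVec e b 0 c = ∑ c, a c * b c := by
    intro a b
    have : (fun c => pairVec e a 0 c * pairVec e b 0 c) = pairVec e (fun c => a c * b c) 0 := by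
      funext c; unfold pairVec; cases e c <;> simp
    rw [this, sum_pairVec]; simp
  let H : Head d := ⟨d, lin q, lin k, lin v, fstMatrix e⟩
  refine ⟨⟨[H], proj pa, d, proj pf, lin fi, ⟨fstMatrix e, 0⟩⟩, fun N p h => ?_⟩
  have hatt : Layer.attention (⟨[H], proj pa, d, proj pf, lin fi, ⟨fstMatrix e, 0⟩⟩ : Layer d)
      p (fun i => pairVec e (h i) 0) = fun i => pairVec e (Λ.attention p h i) 0 := by
    funext i r
    have hset : H.attended (fun j => layerNorm (applyMatrix (proj pa) (pairVec e (h j) 0))) i =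
        attendedSet (Λ.score h) i := by
      unfold Head.attended attendedSet LayerSpec.score
      simp only [H, hproj pa _ hpa, hlin q _ hq, hlin k _ hk, hdot]
    simp only [Layer.attention, List.map_cons, List.map_nil, List.sum_cons, List.sum_nil, add_zero,
      Head.apply, hset]
    have hval : (fun c => (∑ j ∈ attendedSet (Λ.score h) i,
        H.value.apply (layerNorm (applyMatrix (proj pa) (pairVec e (h j) 0))) c) /
          ((attendedSet (Λ.score h) i).card : ℝ)) =
        pairVec e (fun c => (∑ j ∈ attendedSet (Λ.score h) i,
          Λ.value (nrm (Λ.attnProj (h j))) c) / ((attendedSet (Λ.score h) i).card : ℝ)) 0 := by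
      funext c
      simp only [H, hproj pa _ hpa, hlin v _ hv]
      unfold pairVec
      cases e c <;> simp
    have : applyMatrix H.output (fun c => (∑ j ∈ attendedSet (Λ.score h) i,
        H.value.apply (layerNorm (applyMatrix (proj pa) (pairVec e (h j) 0))) c) /
          ((attendedSet (Λ.score h) i).card : ℝ)) =
        pairVec e (fun c => (∑ j ∈ attendedSet (Λ.score h) i,
          Λ.value (nrm (Λ.attnProj (h j))) c) / ((attendedSet (Λ.score h) i).card : ℝ)) 0 := by
      rw [hval]
      exact applyMatrix_fstMatrix e _ _
    rw [this]
    unfold pairVec LayerSpec.attention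
    cases e r <;> simp
  rw [hatt]
  funext i r
  simp only [Layer.feedforward, hproj pf _ hpf, hlin fi _ hfi]
  have hmax : (fun c => max 0 (pairVec e (Λ.ffIn (nrm (Λ.ffProj (Λ.attention p h i)))) 0 c)) =
      pairVec e (fun c => max 0 (Λ.ffIn (nrm (Λ.ffProj (Λ.attention p h i))) c)) 0 := by
    funext c; unfold pairVec; cases e c <;> simp
  rw [hmax]
  simp only [Affine.apply, Pi.zero_apply, Rat.cast_zero, add_zero]
  rw [applyMatrix_fstMatrix]
  unfold pairVec LayerSpec.feedforward
  cases e r <;> simp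

end Encoding

/-! ### Token systems -/

/-- A discrete-memory process on the tokens of a context.  Every token is focused on one counter;
the token adds `delta` to the height of that counter and, before that, adds `contrib` to the memory
cell whose address is the counter together with its height.  The next token is a function of the last
token and of an observation (`none`, the symbol in a memory cell, or an input symbol), and
`relevant` says which observations the token depends on. -/
structure TokenSystem (S G F : Type) (w : ℕ) where
  focus : Token S w → F
  delta : Token S w → ℤ
  contrib : Token S w → G → ℤ
  relevant : Token S w → G ⊕ S → Prop
  next : Token S w → Option (G ⊕ S) → Token S w
  delta_input : ∀ s, delta (.input s) = 0
  contrib_input : ∀ s g, contrib (.input s) g = 0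

/-- Whether a token is part of the prompt. -/
def IsInput {S : Type} {w : ℕ} : Token S w → Prop
  | .input _ => True
  | _ => False

/-- Coordinates of the residual stream: the one-hot code of the token, the content `R` of a memory
cell and its normalization `U`, an input symbol `I`, the units that decide on the next token, and
scalars.  The scalars are: `nf`, the indicator of all positions but the first; `inv`, the reciprocal
of the position; `ht` and `wt`, the averages of the changes of the focused counter and of the
indicator of the first position; `P₁` and `P₂`, the direction of the position; `Q₁` and `Q₂`, the
direction of the height of the focused counter; `C₁` and `C₂`, the code of that height. -/
inductive Coord (T G S : Type)
  | tok (t : T)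
  | R (g : G)
  | U (g : G)
  | I (s : S)
  | unit (t : T) (o : Option (G ⊕ S))
  | nf | inv | ht | wt | P₁ | P₂ | Q₁ | Q₂ | C₁ | C₂

namespace Coord

variable {T G S : Type}

/-- The coordinates as a disjoint union. -/
def equivSum : Coord T G S ≃ T ⊕ G ⊕ G ⊕ S ⊕ (T × Option (G ⊕ S)) ⊕ Fin 10 where
  toFun
    | tok t => .inl t
    | R g => .inr (.inl g)
    | U g => .inr (.inr (.inl g))
    | I s => .inr (.inr (.inr (.inl s)))
    | unit t o => .inr (.inr (.inr (.inr (.inl (t, o)))))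
    | nf => .inr (.inr (.inr (.inr (.inr 0))))
    | inv => .inr (.inr (.inr (.inr (.inr 1))))
    | ht => .inr (.inr (.inr (.inr (.inr 2))))
    | wt => .inr (.inr (.inr (.inr (.inr 3))))
    | P₁ => .inr (.inr (.inr (.inr (.inr 4))))
    | P₂ => .inr (.inr (.inr (.inr (.inr 5))))
    | Q₁ => .inr (.inr (.inr (.inr (.inr 6))))
    | Q₂ => .inr (.inr (.inr (.inr (.inr 7))))
    | C₁ => .inr (.inr (.inr (.inr (.inr 8))))
    | C₂ => .inr (.inr (.inr (.inr (.inr 9))))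
  invFun
    | .inl t => tok t
    | .inr (.inl g) => R g
    | .inr (.inr (.inl g)) => U g
    | .inr (.inr (.inr (.inl s))) => I s
    | .inr (.inr (.inr (.inr (.inl (t, o))))) => unit t o
    | .inr (.inr (.inr (.inr (.inr k)))) => ![nf, inv, ht, wt, P₁, P₂, Q₁, Q₂, C₁, C₂] k
  left_inv a := by cases a <;> rfl
  right_inv a := by
    rcases a with t | g | g | s | ⟨t, o⟩ | k
    iterate 5 rfl
    fin_cases k <;> rfl

variable [Fintype T] [Fintype G] [Fintype S]

instance : Fintype (Coord T G S) := Fintype.ofEquiv _ equivSum.symm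

theorem sum_eq (f : Coord T G S → ℝ) : ∑ k, f k =
    ∑ t, f (tok t) + ∑ g, f (R g) + ∑ g, f (U g) + ∑ s, f (I s) + ∑ a : T × _, f (unit a.1 a.2) +
      (f nf + f inv + f ht + f wt + f P₁ + f P₂ + f Q₁ + f Q₂ + f C₁ + f C₂) := by
  rw [← equivSum.symm.sum_comp]
  simp only [Fintype.sum_sum_type]
  have : ∀ k : Fin 10, equivSum.symm (.inr (.inr (.inr (.inr (.inr k))))) =
    (![nf, inv, ht, wt, P₁, P₂, Q₁, Q₂, C₁, C₂] k : Coord T G S) := fun _ => rfl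
  simp only [this, Fin.sum_univ_succ]
  simp [equivSum]
  ring

end Coord

/-- The values of all coordinates at one position. -/
structure Features (T G S : Type) where
  tok : T
  R : G → ℝ := 0
  U : G → ℝ := 0
  I : S → ℝ := 0
  unit : T → Option (G ⊕ S) → ℝ := 0
  nf : ℝ := 0
  inv : ℝ := 0
  ht : ℝ := 0
  wt : ℝ := 0
  P₁ : ℝ := 0
  P₂ : ℝ := 0
  Q₁ : ℝ := 0
  Q₂ : ℝ := 0
  C₁ : ℝ := 0
  C₂ : ℝ := 0

open Classical in
/-- The one-hot code of `a`. -/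
noncomputable def oneHot {T : Type} (a t : T) : ℝ := if a = t then 1 else 0

section OneHot

variable {T : Type} (a : T)

@[simp] theorem oneHot_self : oneHot a a = 1 := if_pos rfl

theorem oneHot_of_ne {a t : T} (h : a ≠ t) : oneHot a t = 0 := if_neg h

@[simp] theorem roundTo_oneHot (p : ℕ) (t : T) : roundTo p (oneHot a t) = oneHot a t := by
  unfold oneHot; split_ifs <;> simp

variable [Fintype T]

@[simp] theorem sum_mul_oneHot (f : T → ℝ) : ∑ t, f t * oneHot a t = f a := by
  classical
  simp [oneHot]

@[simp] theorem sum_oneHot : ∑ t, oneHot a t = 1 := by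
  classical
  simp [oneHot]

@[simp] theorem sum_oneHot_sq : ∑ t, oneHot a t ^ 2 = 1 := by
  classical
  simp [oneHot]

theorem sum_apply_oneHot (f : T → ℝ → ℝ) (hf : ∀ t, f t 0 = 0) :
    ∑ t, f t (oneHot a t) = f a 1 := by
  rw [Finset.sum_eq_single a]
  · simp
  · intro t _ h
    rw [oneHot_of_ne h.symm, hf]
  · simp

end OneHot

/-- The residual vector with given features. -/
noncomputable def Features.vec {T G S : Type} (F : Features T G S) : Coord T G S → ℝ
  | .tok t => oneHot F.tok t
  | .R g => F.R g
  | .U g => F.U g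
  | .I s => F.I s
  | .unit t o => F.unit t o
  | .nf => F.nf
  | .inv => F.inv
  | .ht => F.ht
  | .wt => F.wt
  | .P₁ => F.P₁
  | .P₂ => F.P₂
  | .Q₁ => F.Q₁
  | .Q₂ => F.Q₂
  | .C₁ => F.C₁
  | .C₂ => F.C₂

namespace TokenSystem

variable {S G F : Type} {w : ℕ} (τ : TokenSystem S G F w)
variable [Fintype (Token S w)] [Fintype G] [Fintype S]

/-! ### The layers

Normalization is applied to vectors that contain the one-hot code of the token, and whose norm is
known or bounded for this reason.  The sum of the one-hot code serves as the constant `1`.  In the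
first three layers the norm, in the sense of `nrm`, is exactly `2`, and a factor of `2` in the values
compensates for it. -/

/-- The first layer tells the first position, which attends to nothing, from the others. -/
def layer₁ : LayerSpec (Coord (Token S w) G S) where
  attnProj x
    | .tok t => x (.tok t)
    | .nf => ∑ t, x (.tok t)
    | _ => 0
  query _ _ := 0
  key _ _ := 0
  value z
    | .nf => (2 : ℚ) * z .nf
    | _ => 0
  ffProj _ _ := 0
  ffIn _ _ := 0

/-- The second layer computes the direction `(i, 1)` at position `i`.  The average of the indicator
of the first position over all earlier positions is `1 / i`; the first position itself is treated
as `(0, 1)`. -/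
def layer₂ : LayerSpec (Coord (Token S w) G S) where
  attnProj x
    | .tok t => x (.tok t)
    | .nf => x .nf
    | .inv => ∑ t, x (.tok t) - x .nf
    | _ => 0
  query _ _ := 0
  key _ _ := 0
  value z
    | .inv => (2 : ℚ) * z .inv
    | _ => 0
  ffProj x
    | .P₁ => x .nf
    | .P₂ => x .inv + (∑ t, x (.tok t) - x .nf)
    | _ => 0
  ffIn z
    | .P₁ => z .P₁
    | .P₂ => z .P₂
    | _ => 0

open Classical in
/-- The third layer computes the direction `(h, 1)`, where `h` is the height of the focused
counter.  The head attends to the earlier generated tokens with the same focus, and to the first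
position, whose indicator then has the average `1 / s` over the `s` attended positions. -/
noncomputable def layer₃ : LayerSpec (Coord (Token S w) G S) where
  attnProj x
    | .tok t => x (.tok t)
    | .nf => x .nf
    | .inv => ∑ t, x (.tok t) - x .nf
    | _ => 0
  query z
    | .tok t => ∑ t', if τ.focus t' = τ.focus t then z (.tok t') else 0
    | .nf => ∑ t, z (.tok t)
    | _ => 0
  key z
    | .tok t => if IsInput t then 0 else z (.tok t)
    | .nf => z .inv
    | _ => 0
  value z
    | .ht => (2 : ℚ) * ∑ t, ((τ.delta t : ℤ) : ℚ) * z (.tok t)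
    | .wt => (2 : ℚ) * z .inv
    | _ => 0
  ffProj x
    | .Q₁ => x .ht
    | .Q₂ => x .wt + (∑ t, x (.tok t) - x .nf)
    | _ => 0
  ffIn z
    | .Q₁ => z .Q₁
    | .Q₂ => z .Q₂
    | _ => 0

/-- The fourth layer looks up the position whose index is the height of the focused counter.  Here
the norm is only approximately `2`; a one-hot entry becomes about `1 / 2`, and the factor `3 / 2`
places it safely between `1 / 2` and `1`. -/
noncomputable def layer₄ : LayerSpec (Coord (Token S w) G S) where
  attnProj x
    | .tok t => x (.tok t)
    | .P₁ => x .P₁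
    | .P₂ => x .P₂
    | .Q₁ => x .Q₁
    | .Q₂ => x .Q₂
    | _ => 0
  query z
    | .P₁ => z .Q₁
    | .P₂ => z .Q₂
    | _ => 0
  key z
    | .P₁ => z .P₁
    | .P₂ => z .P₂
    | _ => 0
  value z
    | .C₁ => z .P₁
    | .C₂ => z .P₂
    | .I s => (3 / 2 : ℚ) * z (.tok (.input s))
    | _ => 0
  ffProj _ _ := 0
  ffIn _ _ := 0

open Classical in
/-- The fifth layer adds up the contributions to the memory cell of the present address. -/
noncomputable def layer₅ : LayerSpec (Coord (Token S w) G S) where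
  attnProj x
    | .tok t => x (.tok t)
    | .C₁ => x .C₁
    | .C₂ => x .C₂
    | _ => 0
  query z
    | .tok t => ∑ t', if τ.focus t' = τ.focus t then z (.tok t') else 0
    | .C₁ => z .C₁
    | .C₂ => z .C₂
    | _ => 0
  key z
    | .tok t => z (.tok t)
    | .C₁ => z .C₁
    | .C₂ => z .C₂
    | _ => 0
  value z
    | .R g => ∑ t, ((τ.contrib t g : ℤ) : ℚ) * z (.tok t)
    | _ => 0
  ffProj x
    | .R g => x (.R g)
    | _ => 0
  ffIn z
    | .U g => z (.R g)
    | _ => 0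

/-- The coordinate that signals an observation. -/
def signal (z : Coord (Token S w) G S → ℝ) : G ⊕ S → ℝ
  | .inl g => z (.U g)
  | .inr s => z (.I s)

variable (S G w) in
/-- A factor of at least twice the norm of the projected vector in the last layer, so that a positive
unit is not rounded to zero. -/
def gain : ℚ := 4 * (1 + Fintype.card G + Fintype.card S)

open Classical in
/-- The sixth layer recognizes the pair of last token and observation.  A relevant observation has a
signal between `1 / 2` and `1` if it is the actual one, and `0` otherwise. -/
noncomputable def layer₆ : LayerSpec (Coord (Token S w) G S) where
  attnProj _ _ := 0
  query _ _ := 0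
  key _ _ := 0
  value _ _ := 0
  ffProj x
    | .tok t => x (.tok t)
    | .U g => x (.U g)
    | .I s => x (.I s)
    | _ => 0
  ffIn z
    | .unit t none => gain S G *
        (z (.tok t) - (2 : ℚ) * ∑ o, if τ.relevant t o then signal z o else 0)
    | .unit t (some o) => if τ.relevant t o then
        gain S G * (z (.tok t) + signal z o - ∑ t', z (.tok t')) else 0
    | _ => 0

section Rational
open IsRatLinear

theorem isRational_layer₁ : (layer₁ : LayerSpec (Coord (Token S w) G S)).IsRational where
  attnProj c := by cases c <;> first | exact coord _ | exact sum _ fun t => coord _ | exact zero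
  query _ := zero
  key _ := zero
  value c := by cases c <;> first | exact zero | exact const_mul _ (coord _)
  ffProj _ := zero
  ffIn _ := zero

theorem isRational_layer₂ : (layer₂ : LayerSpec (Coord (Token S w) G S)).IsRational where
  attnProj c := by
    cases c <;> first | exact coord _ | exact sub (sum _ fun t => coord _) (coord _) | exact zero
  query _ := zero
  key _ := zero
  value c := by cases c <;> first | exact zero | exact const_mul _ (coord _)
  ffProj c := by
    cases c <;> first
      | exact coord _ | exact add (coord _) (sub (sum _ fun t => coord _) (coord _)) | exact zero
  ffIn c := by cases c <;> first | exact coord _ | exact zero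

theorem isRational_layer₃ : τ.layer₃.IsRational where
  attnProj c := by
    cases c <;> first | exact coord _ | exact sub (sum _ fun t => coord _) (coord _) | exact zero
  query c := by
    cases c <;> first
      | exact sum _ fun t => coord _ | exact sum _ fun t => of_ite (coord _) zero | exact zero
  key c := by
    cases c <;> first | exact coord _ | exact of_ite zero (coord _) | exact zero
  value c := by
    cases c <;> first
      | exact zero | exact const_mul _ (coord _)
      | exact const_mul _ (sum _ fun t => const_mul _ (coord _))
  ffProj c := by
    cases c <;> first
      | exact coord _ | exact add (coord _) (sub (sum _ fun t => coord _) (coord _)) | exact zero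
  ffIn c := by cases c <;> first | exact coord _ | exact zero

theorem isRational_layer₄ : (layer₄ : LayerSpec (Coord (Token S w) G S)).IsRational where
  attnProj c := by cases c <;> first | exact coord _ | exact zero
  query c := by cases c <;> first | exact coord _ | exact zero
  key c := by cases c <;> first | exact coord _ | exact zero
  value c := by cases c <;> first | exact zero | exact coord _ | exact const_mul _ (coord _)
  ffProj _ := zero
  ffIn _ := zero

theorem isRational_layer₅ : τ.layer₅.IsRational where
  attnProj c := by cases c <;> first | exact coord _ | exact zero
  query c := by
    cases c <;> first | exact coord _ | exact sum _ fun t => of_ite (coord _) zero | exact zero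
  key c := by cases c <;> first | exact coord _ | exact zero
  value c := by cases c <;> first | exact zero | exact sum _ fun t => const_mul _ (coord _)
  ffProj c := by cases c <;> first | exact coord _ | exact zero
  ffIn c := by cases c <;> first | exact coord _ | exact zero

theorem isRatLinear_signal (o : G ⊕ S) :
    IsRatLinear fun z : Coord (Token S w) G S → ℝ => signal z o := by
  cases o <;> exact coord _

theorem isRational_layer₆ : τ.layer₆.IsRational where
  attnProj _ := zero
  query _ := zero
  key _ := zero
  value _ := zero
  ffProj c := by cases c <;> first | exact coord _ | exact zero
  ffIn c := by
    rcases c with _ | _ | _ | _ | ⟨t, _ | o⟩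
    case unit.none =>
      exact const_mul _ (sub (coord _) (const_mul _
        (sum _ fun o => of_ite (isRatLinear_signal o) zero)))
    case unit.some =>
      exact of_ite (const_mul _ (sub (add (coord _) (isRatLinear_signal o)) (sum _ fun t => coord _)))
        zero
    all_goals exact zero

end Rational

end TokenSystem

namespace TokenSystem

variable {S G F : Type} {w : ℕ} (τ : TokenSystem S G F w)

/-! ### The values computed by the layers -/

section Values

variable {N : ℕ} (p : ℕ) (tok : Fin N → Token S w)

/-- The indicator of the positions other than the first. -/
noncomputable def nfVal (i : Fin N) : ℝ := if i.1 = 0 then 0 else 1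

/-- The reciprocal of the position, and `0` at the first position. -/
noncomputable def invVal (i : Fin N) : ℝ :=
  roundTo p ((∑ j ∈ Finset.Iio i, (1 - nfVal j)) / ((Finset.Iio i).card : ℝ))

/-- The direction of the position, scaled by `1 / √2`: first coordinate. -/
noncomputable def P₁Val (i : Fin N) : ℝ :=
  roundTo p (max 0 (nfVal i / √(2 * (nfVal i ^ 2 + (invVal p i + (1 - nfVal i)) ^ 2))))

/-- The direction of the position, scaled by `1 / √2`: second coordinate. -/
noncomputable def P₂Val (i : Fin N) : ℝ :=
  roundTo p (max 0 ((invVal p i + (1 - nfVal i)) /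
    √(2 * (nfVal i ^ 2 + (invVal p i + (1 - nfVal i)) ^ 2))))

open Classical in
/-- The positions over which the height of the focused counter is averaged: the first position, and
the earlier generated positions with the same focus. -/
noncomputable def peers (i : Fin N) : Finset (Fin N) :=
  Finset.univ.filter fun j => j < i ∧
    (j.1 = 0 ∨ (¬ IsInput (tok j) ∧ τ.focus (tok j) = τ.focus (tok i)))

/-- The average change of the focused counter. -/
noncomputable def htVal (i : Fin N) : ℝ :=
  roundTo p ((∑ j ∈ τ.peers tok i, (τ.delta (tok j) : ℝ)) / ((τ.peers tok i).card : ℝ))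

/-- The reciprocal of the number of positions that are averaged over. -/
noncomputable def wtVal (i : Fin N) : ℝ :=
  roundTo p ((∑ j ∈ τ.peers tok i, (1 - nfVal j)) / ((τ.peers tok i).card : ℝ))

/-- The direction of the height of the focused counter, scaled by `1 / √2`: first coordinate. -/
noncomputable def Q₁Val (i : Fin N) : ℝ :=
  roundTo p (max 0 (τ.htVal p tok i /
    √(2 * (τ.htVal p tok i ^ 2 + (τ.wtVal p tok i + (1 - nfVal i)) ^ 2))))

/-- The direction of the height of the focused counter, scaled by `1 / √2`: second coordinate. -/
noncomputable def Q₂Val (i : Fin N) : ℝ :=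
  roundTo p (max 0 ((τ.wtVal p tok i + (1 - nfVal i)) /
    √(2 * (τ.htVal p tok i ^ 2 + (τ.wtVal p tok i + (1 - nfVal i)) ^ 2))))

/-- The norm in the lookup layer, which is close to `2`. -/
noncomputable def lookupNorm (i : Fin N) : ℝ :=
  √(2 * (1 + P₁Val p i ^ 2 + P₂Val p i ^ 2 + τ.Q₁Val p tok i ^ 2 + τ.Q₂Val p tok i ^ 2))

/-- The scores in the lookup layer. -/
noncomputable def lookupScore (i j : Fin N) : ℝ :=
  τ.Q₁Val p tok i / τ.lookupNorm p tok i * (P₁Val p j / τ.lookupNorm p tok j) +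
  τ.Q₂Val p tok i / τ.lookupNorm p tok i * (P₂Val p j / τ.lookupNorm p tok j)

/-- The positions that the lookup layer attends to. -/
noncomputable def lookupSet (i : Fin N) : Finset (Fin N) := attendedSet (τ.lookupScore p tok) i

/-- The code of the height of the focused counter: first coordinate. -/
noncomputable def C₁Val (i : Fin N) : ℝ :=
  roundTo p ((∑ j ∈ τ.lookupSet p tok i, P₁Val p j / τ.lookupNorm p tok j) /
    ((τ.lookupSet p tok i).card : ℝ))

/-- The code of the height of the focused counter: second coordinate. -/
noncomputable def C₂Val (i : Fin N) : ℝ :=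
  roundTo p ((∑ j ∈ τ.lookupSet p tok i, P₂Val p j / τ.lookupNorm p tok j) /
    ((τ.lookupSet p tok i).card : ℝ))

/-- The strength of the input symbol `s` at the position whose index is the height of the focused
counter. -/
noncomputable def IVal (i : Fin N) (s : S) : ℝ :=
  roundTo p ((∑ j ∈ τ.lookupSet p tok i,
    3 / 2 * (oneHot (tok j) (.input s) / τ.lookupNorm p tok j)) /
    ((τ.lookupSet p tok i).card : ℝ))

/-- The norm in the memory layer. -/
noncomputable def cellNorm (i : Fin N) : ℝ :=
  √(2 * (1 + τ.C₁Val p tok i ^ 2 + τ.C₂Val p tok i ^ 2))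

open Classical in
/-- The scores in the memory layer. -/
noncomputable def cellScore (i j : Fin N) : ℝ :=
  (if τ.focus (tok i) = τ.focus (tok j) then 1 / τ.cellNorm p tok i else 0) *
    (1 / τ.cellNorm p tok j) +
  τ.C₁Val p tok i / τ.cellNorm p tok i * (τ.C₁Val p tok j / τ.cellNorm p tok j) +
  τ.C₂Val p tok i / τ.cellNorm p tok i * (τ.C₂Val p tok j / τ.cellNorm p tok j)

/-- The positions that the memory layer attends to. -/
noncomputable def cellSet (i : Fin N) : Finset (Fin N) := attendedSet (τ.cellScore p tok) i

/-- The content of the addressed memory cell, up to a positive factor. -/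
noncomputable def RVal (i : Fin N) (g : G) : ℝ :=
  roundTo p ((∑ j ∈ τ.cellSet p tok i, τ.contrib (tok j) g * (1 / τ.cellNorm p tok j)) /
    ((τ.cellSet p tok i).card : ℝ))

variable [Fintype G] [Fintype S]

/-- The normalized content of the addressed memory cell. -/
noncomputable def UVal (i : Fin N) (g : G) : ℝ :=
  roundTo p (max 0 (τ.RVal p tok i g / √(2 * ∑ g', τ.RVal p tok i g' ^ 2)))

/-- The strength of an observation at position `i`. -/
noncomputable def signalVal (i : Fin N) : G ⊕ S → ℝ
  | .inl g => τ.UVal p tok i g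
  | .inr s => τ.IVal p tok i s

/-- The norm in the last layer. -/
noncomputable def outNorm (i : Fin N) : ℝ :=
  √(2 * (1 + ∑ g, τ.UVal p tok i g ^ 2 + ∑ s, τ.IVal p tok i s ^ 2))

open Classical in
/-- The unit for the last token `t` and a given observation. -/
noncomputable def unitVal (i : Fin N) (t : Token S w) : Option (G ⊕ S) → ℝ
  | none => roundTo p (max 0 (gain S G * (oneHot (tok i) t -
      2 * ∑ o, if τ.relevant t o then τ.signalVal p tok i o else 0) / τ.outNorm p tok i))
  | some o => if τ.relevant t o then
      roundTo p (max 0 (gain S G * (oneHot (tok i) t + τ.signalVal p tok i o - 1) /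
        τ.outNorm p tok i)) else 0

end Values

section States

variable [Fintype (Token S w)] [Fintype G] [Fintype S] {N : ℕ} (p : ℕ) (tok : Fin N → Token S w)

theorem attendedSet_of_const {N : ℕ} {score : Fin N → Fin N → ℝ} {a : ℝ}
    (h : ∀ i j, score i j = a) (i : Fin N) : attendedSet score i = Finset.Iio i := by
  classical
  ext j
  simp [attendedSet, h]

/-- The features at the start. -/
def features₀ (i : Fin N) : Features (Token S w) G S where
  tok := tok i

/-- The features after the first layer. -/
noncomputable def features₁ (i : Fin N) : Features (Token S w) G S where
  tok := tok i
  nf := nfVal i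

/-- The features after the second layer. -/
noncomputable def features₂ (i : Fin N) : Features (Token S w) G S where
  tok := tok i
  nf := nfVal i
  inv := invVal p i
  P₁ := P₁Val p i
  P₂ := P₂Val p i

/-- The features after the third layer. -/
noncomputable def features₃ (i : Fin N) : Features (Token S w) G S where
  tok := tok i
  nf := nfVal i
  inv := invVal p i
  P₁ := P₁Val p i
  P₂ := P₂Val p i
  ht := τ.htVal p tok i
  wt := τ.wtVal p tok i
  Q₁ := τ.Q₁Val p tok i
  Q₂ := τ.Q₂Val p tok i

end States
end TokenSystem

namespace TokenSystem

variable {S G F : Type} {w : ℕ} (τ : TokenSystem S G F w)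
variable {N : ℕ} (p : ℕ) (tok : Fin N → Token S w)

@[simp] theorem roundTo_nfVal (i : Fin N) : roundTo p (nfVal i) = nfVal i := by
  unfold nfVal; split_ifs <;> simp

@[simp] theorem roundTo_invVal (i : Fin N) : roundTo p (invVal p i) = invVal p i :=
  roundTo_roundTo _ _

@[simp] theorem roundTo_P₁Val (i : Fin N) : roundTo p (P₁Val p i) = P₁Val p i :=
  roundTo_roundTo _ _

@[simp] theorem roundTo_P₂Val (i : Fin N) : roundTo p (P₂Val p i) = P₂Val p i :=
  roundTo_roundTo _ _

@[simp] theorem roundTo_htVal (i : Fin N) : roundTo p (τ.htVal p tok i) = τ.htVal p tok i :=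
  roundTo_roundTo _ _

@[simp] theorem roundTo_wtVal (i : Fin N) : roundTo p (τ.wtVal p tok i) = τ.wtVal p tok i :=
  roundTo_roundTo _ _

@[simp] theorem roundTo_Q₁Val (i : Fin N) : roundTo p (τ.Q₁Val p tok i) = τ.Q₁Val p tok i :=
  roundTo_roundTo _ _

@[simp] theorem roundTo_Q₂Val (i : Fin N) : roundTo p (τ.Q₂Val p tok i) = τ.Q₂Val p tok i :=
  roundTo_roundTo _ _

@[simp] theorem roundTo_C₁Val (i : Fin N) : roundTo p (τ.C₁Val p tok i) = τ.C₁Val p tok i :=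
  roundTo_roundTo _ _

@[simp] theorem roundTo_C₂Val (i : Fin N) : roundTo p (τ.C₂Val p tok i) = τ.C₂Val p tok i :=
  roundTo_roundTo _ _

@[simp] theorem roundTo_IVal (i : Fin N) (s : S) :
    roundTo p (τ.IVal p tok i s) = τ.IVal p tok i s :=
  roundTo_roundTo _ _

@[simp] theorem roundTo_RVal (i : Fin N) (g : G) :
    roundTo p (τ.RVal p tok i g) = τ.RVal p tok i g :=
  roundTo_roundTo _ _

@[simp] theorem roundTo_UVal [Fintype G] (i : Fin N) (g : G) :
    roundTo p (τ.UVal p tok i g) = τ.UVal p tok i g :=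
  roundTo_roundTo _ _

theorem roundTo_features₁ (i : Fin N) (k : Coord (Token S w) G S) :
    roundTo p ((features₁ tok i).vec k) = (features₁ tok i).vec k := by
  classical
  cases k <;> simp [Features.vec, features₁]

variable [Fintype G] [Fintype S]

/-- The features after the fourth layer. -/
noncomputable def features₄ (i : Fin N) : Features (Token S w) G S :=
  { τ.features₃ p tok i with
    C₁ := τ.C₁Val p tok i
    C₂ := τ.C₂Val p tok i
    I := τ.IVal p tok i }

/-- The features after the fifth layer. -/
noncomputable def features₅ (i : Fin N) : Features (Token S w) G S :=
  { τ.features₄ p tok i with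
    R := τ.RVal p tok i
    U := τ.UVal p tok i }

/-- The features after the last layer. -/
noncomputable def features₆ (i : Fin N) : Features (Token S w) G S :=
  { τ.features₅ p tok i with
    unit := τ.unitVal p tok i }

variable [Fintype (Token S w)]

theorem attention_layer₁ : layer₁.attention p (fun i => (features₀ tok i : Features _ G S).vec) =
    fun i => (features₁ tok i).vec := by
  classical
  have hn : ∀ i, nrm (layer₁.attnProj (features₀ tok i : Features _ G S).vec) .nf = 1 / 2 := by
    intro i
    rw [nrm_eq_div _ (r := 2) (by norm_num)]
    · simp [layer₁, Features.vec, features₀]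
    · rw [Coord.sum_eq]; simp [layer₁, Features.vec, features₀]; norm_num
  funext i k
  rw [LayerSpec.attention, attendedSet_of_const (a := 0) (by intro i j; simp [LayerSpec.score, layer₁])]
  cases k
  case nf =>
    simp only [layer₁] at hn ⊢
    simp only [hn]
    simp only [Features.vec, features₀, features₁, nfVal]
    by_cases h : i.1 = 0
    · simp [h]
    · simp [h]
  all_goals simp [layer₁, Features.vec, features₀, features₁]

theorem feedforward_of_zero {ι : Type*} [Fintype ι] {Λ : LayerSpec ι} (h : ∀ z c, Λ.ffIn z c = 0)
    {v : Fin N → ι → ℝ} (hv : ∀ i c, roundTo p (v i c) = v i c) : Λ.feedforward p v = v := by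
  funext i c
  simp [LayerSpec.feedforward, h, hv]

theorem feedforward_layer₁ : layer₁.feedforward p
    (fun i => (features₁ tok i : Features _ G S).vec) = fun i => (features₁ tok i).vec :=
  feedforward_of_zero p (fun _ _ => rfl) (roundTo_features₁ p tok)

theorem sublayers_layer₂ : layer₂.feedforward p
    (layer₂.attention p (fun i => (features₁ tok i : Features _ G S).vec)) =
      fun i => (features₂ p tok i).vec := by
  classical
  have hn : ∀ i, nrm (layer₂.attnProj (features₁ tok i : Features _ G S).vec) .inv =
      (1 - nfVal i) / 2 := by
    intro i
    rw [nrm_eq_div _ (r := 2) (by norm_num)]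
    · simp [layer₂, Features.vec, features₁]
    · rw [Coord.sum_eq]; simp [layer₂, Features.vec, features₁, nfVal]; split_ifs <;> norm_num
  have ha : layer₂.attention p (fun i => (features₁ tok i : Features _ G S).vec) =
      fun i => ({features₁ tok i with inv := invVal p i} : Features (Token S w) G S).vec := by
    funext i k
    rw [LayerSpec.attention, attendedSet_of_const (a := 0)
      (by intro i j; simp [LayerSpec.score, layer₂])]
    cases k
    case inv =>
      simp only [layer₂] at hn ⊢
      simp only [hn]
      simp [Features.vec, features₁, invVal, mul_div_cancel₀]
    all_goals simp [layer₂, Features.vec, features₁]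
  rw [ha]
  funext i k
  simp only [LayerSpec.feedforward]
  cases k <;> simp [layer₂, Features.vec, features₁, features₂, P₁Val, P₂Val, nrm, Coord.sum_eq]

theorem sublayers_layer₃ (hfirst : ∀ j : Fin N, j.1 = 0 → IsInput (tok j)) : τ.layer₃.feedforward p
    (τ.layer₃.attention p (fun i => (features₂ p tok i : Features _ G S).vec)) =
      fun i => (τ.features₃ p tok i).vec := by
  classical
  have hn : ∀ i k, nrm (τ.layer₃.attnProj (features₂ p tok i : Features _ G S).vec) k =
      τ.layer₃.attnProj (features₂ p tok i : Features _ G S).vec k / 2 := by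
    intro i k
    rw [nrm_eq_div _ (r := 2) (by norm_num)]
    rw [Coord.sum_eq]; simp [layer₃, Features.vec, features₂, nfVal]; split_ifs <;> norm_num
  have hs : ∀ i j, τ.layer₃.score (fun i => (features₂ p tok i : Features _ G S).vec) i j =
      1 / 4 * if j.1 = 0 ∨ (¬ IsInput (tok j) ∧ τ.focus (tok j) = τ.focus (tok i)) then 1 else 0 := by
    intro i j
    rw [LayerSpec.score, Coord.sum_eq]
    simp only [layer₃] at hn ⊢
    simp only [hn]
    simp only [Features.vec, features₂, nfVal, sum_oneHot, Finset.sum_const_zero, add_zero,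
      mul_zero]
    have h1 : ∀ t, (∑ t', if τ.focus t' = τ.focus t then oneHot (tok i) t' / 2 else 0) =
        if τ.focus (tok i) = τ.focus t then 1 / 2 else 0 := fun t =>
      sum_apply_oneHot (tok i) (fun t' r => if τ.focus t' = τ.focus t then r / 2 else 0) (by simp)
    have h2 := sum_apply_oneHot (tok j) (fun t r =>
      (if τ.focus (tok i) = τ.focus t then 1 / 2 else 0) * if IsInput t then 0 else r / 2) (by simp)
    simp only [h1, h2, ← Finset.sum_div, sum_oneHot]
    rw [eq_comm (a := τ.focus (tok j))]
    by_cases h3 : j.1 = 0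
    · simp [h3, hfirst j h3]
      norm_num
    · by_cases h4 : IsInput (tok j)
      · simp [h3, h4]
      · by_cases h5 : τ.focus (tok i) = τ.focus (tok j)
        · simp [h3, h4, h5]
          norm_num
        · simp [h3, h4, h5]
  have hA : ∀ i, attendedSet (τ.layer₃.score (fun i => (features₂ p tok i : Features _ G S).vec)) i
      = τ.peers tok i := by
    intro i
    ext j
    simp only [attendedSet, peers, Finset.mem_filter, Finset.mem_univ, true_and, hs]
    refine and_congr_right fun hj => ⟨fun h => ?_, fun h j' _ => ?_⟩
    · by_contra hc
      have := h ⟨0, by omega⟩ (by rw [Fin.lt_def] at hj ⊢; simp; omega)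
      rw [if_neg hc] at this
      norm_num at this
    · rw [if_pos h]
      split_ifs <;> norm_num
  have ha : τ.layer₃.attention p (fun i => (features₂ p tok i : Features _ G S).vec) =
      fun i => ({features₂ p tok i with
        ht := τ.htVal p tok i, wt := τ.wtVal p tok i} : Features (Token S w) G S).vec := by
    funext i k
    rw [LayerSpec.attention, hA]
    cases k
    case ht =>
      simp only [layer₃] at hn ⊢
      simp only [hn]
      simp [Features.vec, features₂, htVal, ← mul_div_assoc, ← Finset.sum_div]
    case wt =>
      simp only [layer₃] at hn ⊢
      simp only [hn]
      simp [Features.vec, features₂, wtVal, mul_div_cancel₀]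
    all_goals simp [layer₃, Features.vec, features₂]
  rw [ha]
  funext i k
  simp only [LayerSpec.feedforward]
  cases k <;> simp [layer₃, Features.vec, features₂, features₃, Q₁Val, Q₂Val, nrm, Coord.sum_eq]

theorem sublayers_layer₄ : layer₄.feedforward p
    (layer₄.attention p (fun i => (τ.features₃ p tok i : Features _ G S).vec)) =
      fun i => (τ.features₄ p tok i).vec := by
  classical
  have hn : ∀ i k, nrm (layer₄.attnProj (τ.features₃ p tok i : Features _ G S).vec) k =
      layer₄.attnProj (τ.features₃ p tok i : Features _ G S).vec k / τ.lookupNorm p tok i := by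
    intro i k
    rw [nrm, Coord.sum_eq, lookupNorm]
    congr 3
    simp [layer₄, Features.vec, features₃]
    ring
  have hs : layer₄.score (fun i => (τ.features₃ p tok i : Features _ G S).vec) =
      τ.lookupScore p tok := by
    funext i j
    rw [LayerSpec.score, Coord.sum_eq, lookupScore]
    simp only [layer₄] at hn ⊢
    simp only [hn]
    simp [Features.vec, features₃]
  have ha : layer₄.attention p (fun i => (τ.features₃ p tok i : Features _ G S).vec) =
      fun i => (τ.features₄ p tok i).vec := by
    funext i k
    rw [LayerSpec.attention, hs]
    change roundTo p (_ + (∑ j ∈ τ.lookupSet p tok i, _) / ((τ.lookupSet p tok i).card : ℝ)) = _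
    cases k
    case C₁ =>
      simp only [layer₄] at hn ⊢
      simp only [hn]
      simp [Features.vec, features₃, features₄, C₁Val]
    case C₂ =>
      simp only [layer₄] at hn ⊢
      simp only [hn]
      simp [Features.vec, features₃, features₄, C₂Val]
    case I s =>
      simp only [layer₄] at hn ⊢
      simp only [hn]
      simp [Features.vec, features₃, features₄, IVal]
    all_goals simp [layer₄, Features.vec, features₃, features₄]
  rw [ha]
  refine feedforward_of_zero p (fun _ _ => rfl) fun i k => ?_
  cases k <;> simp [Features.vec, features₃, features₄]

theorem sublayers_layer₅ : τ.layer₅.feedforward p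
    (τ.layer₅.attention p (fun i => (τ.features₄ p tok i : Features _ G S).vec)) =
      fun i => (τ.features₅ p tok i).vec := by
  classical
  have hn : ∀ i k, nrm (τ.layer₅.attnProj (τ.features₄ p tok i : Features _ G S).vec) k =
      τ.layer₅.attnProj (τ.features₄ p tok i : Features _ G S).vec k / τ.cellNorm p tok i := by
    intro i k
    rw [nrm, Coord.sum_eq, cellNorm]
    congr 3
    simp [layer₅, Features.vec, features₃, features₄]
    ring
  have hs : τ.layer₅.score (fun i => (τ.features₄ p tok i : Features _ G S).vec) =
      τ.cellScore p tok := by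
    funext i j
    rw [LayerSpec.score, Coord.sum_eq, cellScore]
    simp only [layer₅] at hn ⊢
    simp only [hn]
    simp only [Features.vec, features₃, features₄, Finset.sum_const_zero, add_zero,
      mul_zero, zero_add]
    have h1 : ∀ t, (∑ t', if τ.focus t' = τ.focus t then
        oneHot (tok i) t' / τ.cellNorm p tok i else 0) =
        if τ.focus (tok i) = τ.focus t then 1 / τ.cellNorm p tok i else 0 := fun t =>
      sum_apply_oneHot (tok i) (fun t' r => if τ.focus t' = τ.focus t then
        r / τ.cellNorm p tok i else 0) (by simp)
    have h2 := sum_apply_oneHot (tok j) (fun t r =>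
      (if τ.focus (tok i) = τ.focus t then 1 / τ.cellNorm p tok i else 0) *
        (r / τ.cellNorm p tok j)) (by simp)
    simp only [h1, h2]
    ring
  have ha : τ.layer₅.attention p (fun i => (τ.features₄ p tok i : Features _ G S).vec) =
      fun i => ({τ.features₄ p tok i with R := τ.RVal p tok i} : Features _ G S).vec := by
    funext i k
    rw [LayerSpec.attention, hs]
    change roundTo p (_ + (∑ j ∈ τ.cellSet p tok i, _) / ((τ.cellSet p tok i).card : ℝ)) = _
    cases k
    case R g =>
      simp only [layer₅] at hn ⊢
      simp only [hn]
      simp [Features.vec, features₃, features₄, RVal]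
      congr 2
      refine Finset.sum_congr rfl fun j _ => ?_
      simpa using sum_apply_oneHot (tok j) (fun t r =>
        (τ.contrib t g : ℝ) * (r / τ.cellNorm p tok j)) (by simp)
    all_goals simp [layer₅, Features.vec, features₃, features₄]
  rw [ha]
  funext i k
  simp only [LayerSpec.feedforward]
  cases k <;> simp [layer₅, Features.vec, features₃, features₄, features₅, UVal, nrm, Coord.sum_eq]

theorem sublayers_layer₆ : τ.layer₆.feedforward p
    (τ.layer₆.attention p (fun i => (τ.features₅ p tok i : Features _ G S).vec)) =
      fun i => (τ.features₆ p tok i).vec := by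
  classical
  have ha : τ.layer₆.attention p (fun i => (τ.features₅ p tok i : Features _ G S).vec) =
      fun i => (τ.features₅ p tok i).vec := by
    funext i k
    rw [LayerSpec.attention]
    cases k <;> simp [layer₆, Features.vec, features₃, features₄, features₅]
  rw [ha]
  funext i k
  have hn : ∀ k, nrm (τ.layer₆.ffProj (τ.features₅ p tok i : Features _ G S).vec) k =
      τ.layer₆.ffProj (τ.features₅ p tok i : Features _ G S).vec k / τ.outNorm p tok i := by
    intro k
    rw [nrm, Coord.sum_eq, outNorm]
    congr 3
    simp [layer₆, Features.vec, features₃, features₄, features₅]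
  have hsig : ∀ o, signal (nrm (τ.layer₆.ffProj (τ.features₅ p tok i : Features _ G S).vec)) o =
      τ.signalVal p tok i o / τ.outNorm p tok i := by
    intro o
    cases o <;> simp only [signal, hn] <;>
      simp [layer₆, Features.vec, features₃, features₄, features₅, signalVal]
  simp only [LayerSpec.feedforward]
  rcases k with _ | _ | _ | _ | ⟨t, _ | o⟩
  case unit.none =>
    simp only [layer₆] at hn hsig ⊢
    simp only [hn, hsig]
    simp [Features.vec, features₃, features₄, features₅, features₆, unitVal]
    congr 2
    have hdiv : ∀ o, (if τ.relevant t o then τ.signalVal p tok i o / τ.outNorm p tok i else 0) =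
        (if τ.relevant t o then τ.signalVal p tok i o else 0) / τ.outNorm p tok i := by
      intro o; split_ifs <;> simp
    simp only [hdiv, ← Finset.sum_div]
    ring
  case unit.some =>
    simp only [layer₆] at hn hsig ⊢
    simp only [hn, hsig]
    simp [Features.vec, features₃, features₄, features₅, features₆, unitVal]
    split_ifs
    · rw [← Finset.sum_div, sum_oneHot]
      congr 2
      ring
    · simp
  all_goals simp [layer₆, Features.vec, features₃, features₄, features₅, features₆]

end TokenSystem

/-! ### Directions of natural numbers -/

/-- The first coordinate of the unit vector in direction `(h, 1)`. -/
noncomputable def dir₁ (h : ℝ) : ℝ := h / √(h ^ 2 + 1)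

/-- The second coordinate of the unit vector in direction `(h, 1)`. -/
noncomputable def dir₂ (h : ℝ) : ℝ := 1 / √(h ^ 2 + 1)

theorem dir_sq_add_sq (h : ℝ) : dir₁ h ^ 2 + dir₂ h ^ 2 = 1 := by
  have : (0 : ℝ) < h ^ 2 + 1 := by positivity
  rw [dir₁, dir₂, div_pow, div_pow, Real.sq_sqrt this.le, ← add_div, one_pow, div_self this.ne']

theorem dir₁_nonneg {h : ℝ} (hh : 0 ≤ h) : 0 ≤ dir₁ h := by unfold dir₁; positivity

theorem dir₂_nonneg (h : ℝ) : 0 ≤ dir₂ h := by unfold dir₂; positivity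

theorem dir₁_le_one (h : ℝ) : dir₁ h ≤ 1 := by
  nlinarith [dir_sq_add_sq h, sq_nonneg (dir₂ h)]

theorem dir₂_le_one (h : ℝ) : dir₂ h ≤ 1 := by
  nlinarith [dir_sq_add_sq h, sq_nonneg (dir₁ h)]

/-- The inner product of the directions of distinct natural numbers is bounded away from `1`. -/
theorem dir_inner_le {a b n : ℕ} (hab : a ≠ b) (ha : a < n) (hb : b < n) :
    dir₁ a * dir₁ b + dir₂ a * dir₂ b ≤ 1 - 1 / (2 * (n : ℝ) ^ 4) := by
  have := cos_le_of_ne hab ha hb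
  unfold dir₁ dir₂
  rw [div_mul_div_comm, div_mul_div_comm, ← add_div, one_mul]
  exact this

/-- Normalizing and rounding a nonnegative vector close to `(h, 1) / s` gives a vector close to the
direction of `h`. -/
theorem abs_roundTo_normalize_sub_le {p : ℕ} {h s x y : ℝ} (hh : 0 ≤ h) (hs : 1 ≤ s)
    (hx0 : 0 ≤ x) (hy0 : 0 ≤ y) (hx : |x - h / s| ≤ 1 / 2 ^ p) (hy : |y - 1 / s| ≤ 1 / 2 ^ p)
    (hp : s * (1 / 2 ^ p) ≤ 1 / 8) :
    |roundTo p (max 0 (x / √(2 * (x ^ 2 + y ^ 2)))) - dir₁ h / √2| ≤ 4 * (s * (1 / 2 ^ p)) ∧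
    |roundTo p (max 0 (y / √(2 * (x ^ 2 + y ^ 2)))) - dir₂ h / √2| ≤ 4 * (s * (1 / 2 ^ p)) := by
  obtain ⟨h1, h2⟩ := abs_normalize_sub_le hh hs hx hy hp
  have hr : 1 ≤ √(2 : ℝ) := Real.one_le_sqrt.2 one_le_two
  have hε : (0 : ℝ) < 1 / 2 ^ p := by positivity
  have hsε : 1 / 2 ^ p ≤ s * (1 / 2 ^ p) := le_mul_of_one_le_left hε.le hs
  have key : ∀ z u : ℝ, 0 ≤ z → z ^ 2 ≤ x ^ 2 + y ^ 2 →
      |z / √(x ^ 2 + y ^ 2) - u| ≤ 3 * (s * (1 / 2 ^ p)) →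
      |roundTo p (max 0 (z / √(2 * (x ^ 2 + y ^ 2)))) - u / √2| ≤ 4 * (s * (1 / 2 ^ p)) := by
    intro z u hz hzle hzu
    have hle1 : z / √(x ^ 2 + y ^ 2) ≤ 1 :=
      div_le_one_of_le₀ (Real.le_sqrt_of_sq_le hzle) (Real.sqrt_nonneg _)
    have e : z / √(2 * (x ^ 2 + y ^ 2)) = z / √(x ^ 2 + y ^ 2) / √2 := by
      rw [Real.sqrt_mul (by norm_num), div_div, mul_comm]
    have h0 : 0 ≤ z / √(x ^ 2 + y ^ 2) / √2 := by positivity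
    have hle : z / √(x ^ 2 + y ^ 2) / √2 ≤ 1 := by
      rw [div_le_one (by linarith)]; linarith
    rw [e, max_eq_right h0]
    have h3 := abs_roundTo_sub_le (p := p) (abs_le.2 ⟨by linarith, hle⟩)
    have h4 : |z / √(x ^ 2 + y ^ 2) / √2 - u / √2| ≤ 3 * (s * (1 / 2 ^ p)) := by
      rw [← sub_div, abs_div, abs_of_pos (by linarith : (0 : ℝ) < √2)]
      exact (div_le_self (abs_nonneg _) hr).trans hzu
    calc _ ≤ _ := abs_sub_le _ (z / √(x ^ 2 + y ^ 2) / √2) _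
      _ ≤ 1 / 2 ^ p + 3 * (s * (1 / 2 ^ p)) := add_le_add h3 h4
      _ ≤ _ := by linarith
  exact ⟨key x _ hx0 (by nlinarith) h1, key y _ hy0 (by nlinarith) h2⟩

theorem abs_sq_sub_sq_le {a b η : ℝ} (ha0 : 0 ≤ a) (ha : a ≤ 1) (hb0 : 0 ≤ b) (hb : b ≤ 1)
    (h : |a - b| ≤ η) : |a ^ 2 - b ^ 2| ≤ 2 * η := by
  have : a ^ 2 - b ^ 2 = (a - b) * (a + b) := by ring
  rw [this, abs_mul, abs_of_nonneg (by linarith : 0 ≤ a + b)]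
  have := mul_le_mul h (by linarith : a + b ≤ 2) (by linarith) ((abs_nonneg _).trans h)
  linarith

theorem abs_mul_sub_mul_le {a a' b b' η : ℝ} (hb0 : 0 ≤ b) (hb : b ≤ 1) (ha0 : 0 ≤ a')
    (ha : a' ≤ 1) (h1 : |a - a'| ≤ η) (h2 : |b - b'| ≤ η) : |a * b - a' * b'| ≤ 2 * η := by
  have : a * b - a' * b' = (a - a') * b + a' * (b - b') := by ring
  rw [this]
  refine (abs_add_le _ _).trans ?_
  rw [abs_mul, abs_mul, abs_of_nonneg hb0, abs_of_nonneg ha0]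
  have h0 := (abs_nonneg _).trans h1
  nlinarith [mul_le_mul h1 hb hb0 h0, mul_le_mul ha h2 (abs_nonneg _) zero_le_one]

/-- The norm of a one-hot code together with two approximate directions is approximately `2`. -/
theorem abs_sqrt_sub_two_le {p₁ p₂ q₁ q₂ a b η : ℝ} (ha : 0 ≤ a) (hb : 0 ≤ b)
    (hp₁ : p₁ ∈ Set.Icc 0 1) (hp₂ : p₂ ∈ Set.Icc 0 1) (hq₁ : q₁ ∈ Set.Icc 0 1)
    (hq₂ : q₂ ∈ Set.Icc 0 1) (h1 : |p₁ - dir₁ a / √2| ≤ η) (h2 : |p₂ - dir₂ a / √2| ≤ η)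
    (h3 : |q₁ - dir₁ b / √2| ≤ η) (h4 : |q₂ - dir₂ b / √2| ≤ η) :
    |√(2 * (1 + p₁ ^ 2 + p₂ ^ 2 + q₁ ^ 2 + q₂ ^ 2)) - 2| ≤ 8 * η := by
  have hr : 1 ≤ √(2 : ℝ) := Real.one_le_sqrt.2 one_le_two
  have hr2 : √(2 : ℝ) ^ 2 = 2 := Real.sq_sqrt zero_le_two
  have hd : ∀ u : ℝ, 0 ≤ u → u ≤ 1 → 0 ≤ u / √2 ∧ u / √2 ≤ 1 := fun u h0 h1 =>
    ⟨by positivity, (div_le_self h0 hr).trans h1⟩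
  obtain ⟨a0, a1⟩ := hd _ (dir₁_nonneg ha) (dir₁_le_one a)
  obtain ⟨a2, a3⟩ := hd _ (dir₂_nonneg a) (dir₂_le_one a)
  obtain ⟨b0, b1⟩ := hd _ (dir₁_nonneg hb) (dir₁_le_one b)
  obtain ⟨b2, b3⟩ := hd _ (dir₂_nonneg b) (dir₂_le_one b)
  have e1 := abs_le.1 (abs_sq_sub_sq_le hp₁.1 hp₁.2 a0 a1 h1)
  have e2 := abs_le.1 (abs_sq_sub_sq_le hp₂.1 hp₂.2 a2 a3 h2)
  have e3 := abs_le.1 (abs_sq_sub_sq_le hq₁.1 hq₁.2 b0 b1 h3)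
  have e4 := abs_le.1 (abs_sq_sub_sq_le hq₂.1 hq₂.2 b2 b3 h4)
  have s1 := dir_sq_add_sq a
  have s2 := dir_sq_add_sq b
  simp only [div_pow, hr2] at e1 e2 e3 e4
  set X := 2 * (1 + p₁ ^ 2 + p₂ ^ 2 + q₁ ^ 2 + q₂ ^ 2) with hX
  have hX0 : 0 ≤ X := by positivity
  have hsq : √X ^ 2 = X := Real.sq_sqrt hX0
  have hX4 : |X - 4| ≤ 16 * η := by
    rw [abs_le]
    constructor <;> linarith [e1.1, e1.2, e2.1, e2.2, e3.1, e3.2, e4.1, e4.2]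
  have hprod : (√X - 2) * (√X + 2) = X - 4 := by linear_combination hsq
  rw [← hprod, abs_mul, abs_of_nonneg (by positivity : 0 ≤ √X + 2)] at hX4
  nlinarith [abs_nonneg (√X - 2), Real.sqrt_nonneg X]

/-- The query close to the direction `u` prefers the key of direction `u` to a key of another
direction, where keys are divided by norms that are close to `2`. -/
theorem lookup_lt {A B n m η g : ℝ} (hη : 0 ≤ η) (hη1 : η ≤ 1 / 256) (hg : 128 * η < g) (hg1 : g ≤ 1)
    (hA : |A - (1 - g) / 2| ≤ 4 * η) (hB : |B - 1 / 2| ≤ 4 * η) (hn : |n - 2| ≤ 8 * η)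
    (hm : |m - 2| ≤ 8 * η) : A / n < B / m := by
  rw [abs_le] at hA hB hn hm
  rw [div_lt_div_iff₀ (by linarith) (by linarith)]
  have h1 : A * m ≤ ((1 - g) / 2 + 4 * η) * (2 + 8 * η) := by
    have : A * m ≤ ((1 - g) / 2 + 4 * η) * m :=
      mul_le_mul_of_nonneg_right (by linarith) (by linarith)
    have : ((1 - g) / 2 + 4 * η) * m ≤ ((1 - g) / 2 + 4 * η) * (2 + 8 * η) :=
      mul_le_mul_of_nonneg_left (by linarith) (by linarith)
    linarith
  have h2 : (1 / 2 - 4 * η) * (2 - 8 * η) ≤ B * n := by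
    apply mul_le_mul <;> linarith
  nlinarith

namespace TokenSystem

variable {S G F : Type} {w : ℕ} (τ : TokenSystem S G F w) {N : ℕ} {p : ℕ} {tok : Fin N → Token S w}

/-! ### Address lookup -/

open Classical in
/-- The height of the focused counter at position `i`, before the token at `i` changes it. -/
noncomputable def address (tok : Fin N → Token S w) (i : Fin N) : ℤ :=
  ∑ j ∈ Finset.univ.filter (fun j => j < i ∧ τ.focus (tok j) = τ.focus (tok i)), τ.delta (tok j)

/-- A context of `N` tokens, starting with an input token, in which all addresses are earlier
positions, and on which a precision of `p` bits is sufficient. -/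
structure IsSound (p : ℕ) (tok : Fin N → Token S w) : Prop where
  first : ∀ j : Fin N, j.1 = 0 → IsInput (tok j)
  address_nonneg : ∀ i, 0 ≤ τ.address tok i
  address_lt : ∀ i : Fin N, 0 < i.1 → τ.address tok i < i.1
  precision : 1024 * (N : ℝ) ^ 5 < 2 ^ p

theorem delta_of_isInput {t : Token S w} (h : IsInput t) : τ.delta t = 0 := by
  cases t <;> first | exact τ.delta_input _ | exact h.elim

theorem contrib_of_isInput {t : Token S w} (h : IsInput t) (g : G) : τ.contrib t g = 0 := by
  cases t <;> first | exact τ.contrib_input _ _ | exact h.elim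

theorem sum_one_sub_nfVal {s : Finset (Fin N)} {j₀ : Fin N} (h0 : j₀.1 = 0) (hs : j₀ ∈ s) :
    ∑ j ∈ s, (1 - nfVal j) = 1 := by
  rw [Finset.sum_eq_single_of_mem j₀ hs]
  · simp [nfVal, h0]
  · intro j _ hj
    have : j.1 ≠ 0 := fun h => hj (Fin.ext (h.trans h0.symm))
    simp [nfVal, this]

namespace IsSound

variable {τ}

/-- The bound on the error of all approximate directions. -/
noncomputable def tol (N p : ℕ) : ℝ := 4 * (N * (1 / 2 ^ p))

theorem tol_nonneg (N p : ℕ) : 0 ≤ tol N p := by unfold tol; positivity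

theorem one_le_card (i : Fin N) : (1 : ℝ) ≤ N := by
  exact_mod_cast (by have := i.2; omega : 1 ≤ N)

theorem tol_lt (hs : τ.IsSound p tok) (i : Fin N) : 128 * tol N p < 1 / (2 * (N : ℝ) ^ 4) := by
  have hN := one_le_card i
  have hp : (0 : ℝ) < 2 ^ p := by positivity
  unfold tol
  rw [lt_div_iff₀ (by positivity)]
  have : 128 * (4 * ((N : ℝ) * (1 / 2 ^ p))) * (2 * (N : ℝ) ^ 4) = 1024 * (N : ℝ) ^ 5 / 2 ^ p := by
    field_simp; ring
  rw [this, div_lt_one hp]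
  exact hs.precision

theorem tol_le (hs : τ.IsSound p tok) (i : Fin N) : tol N p ≤ 1 / 256 := by
  have h1 := tol_lt hs i
  have hN := one_le_card i
  have : 1 / (2 * (N : ℝ) ^ 4) ≤ 1 / 2 := by
    have : (1 : ℝ) ≤ (N : ℝ) ^ 4 := one_le_pow₀ hN
    rw [div_le_div_iff₀ (by positivity) (by norm_num)]
    linarith
  linarith

theorem eps_le_tol (i : Fin N) : 1 / 2 ^ p ≤ tol N p := by
  have hN := one_le_card i
  have : (0 : ℝ) < 1 / 2 ^ p := by positivity
  unfold tol
  nlinarith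

/-- The common form of the approximations of a position and of a height. -/
theorem abs_sub_dir_le (hs : τ.IsSound p tok) (i : Fin N) {h s x y : ℝ} (hh : 0 ≤ h) (hs1 : 1 ≤ s)
    (hsN : s ≤ N) (hx0 : 0 ≤ x) (hy0 : 0 ≤ y)
    (hx : |x - h / s| ≤ 1 / 2 ^ p) (hy : |y - 1 / s| ≤ 1 / 2 ^ p) :
    |roundTo p (max 0 (x / √(2 * (x ^ 2 + y ^ 2)))) - dir₁ h / √2| ≤ tol N p ∧
    |roundTo p (max 0 (y / √(2 * (x ^ 2 + y ^ 2)))) - dir₂ h / √2| ≤ tol N p := by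
  have hε : (0 : ℝ) < 1 / 2 ^ p := by positivity
  have h1 : s * (1 / 2 ^ p) ≤ N * (1 / 2 ^ p) := mul_le_mul_of_nonneg_right hsN hε.le
  have h2 := tol_le hs i
  unfold tol at h2 ⊢
  obtain ⟨h3, h4⟩ := abs_roundTo_normalize_sub_le hh hs1 hx0 hy0 hx hy (by linarith)
  exact ⟨h3.trans (by linarith), h4.trans (by linarith)⟩

/-- The coordinates `P₁` and `P₂` approximate the direction of the position. -/
theorem P_approx (hs : τ.IsSound p tok) (i : Fin N) :
    |P₁Val p i - dir₁ i.1 / √2| ≤ tol N p ∧ |P₂Val p i - dir₂ i.1 / √2| ≤ tol N p := by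
  have hiN : (i.1 : ℝ) ≤ N := by exact_mod_cast i.2.le
  have hp : (0 : ℝ) ≤ 1 / 2 ^ p := by positivity
  by_cases h0 : i.1 = 0
  · have hinv : invVal p i = 0 := by
      have : Finset.Iio i = ∅ := by
        ext j; simp only [Finset.mem_Iio, Fin.lt_def, h0]; simp
      simp [invVal, this]
    have hnf : nfVal i = 0 := by simp [nfVal, h0]
    apply abs_sub_dir_le hs i (s := 1) <;> simp [hinv, hnf, h0, one_le_card i]
  · have h1 : (1 : ℝ) ≤ i.1 := by exact_mod_cast Nat.one_le_iff_ne_zero.2 h0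
    have hnf : nfVal i = 1 := by simp [nfVal, h0]
    have hinv : invVal p i = roundTo p (1 / i.1) := by
      rw [invVal, sum_one_sub_nfVal (j₀ := ⟨0, by omega⟩) rfl]
      · simp
      · rw [Finset.mem_Iio, Fin.lt_def]; simp; omega
    have h2 : |1 / (i.1 : ℝ)| ≤ 1 := by
      rw [abs_of_nonneg (by positivity)]; exact (div_le_one (by linarith)).2 h1
    apply abs_sub_dir_le hs i (s := i.1) (by positivity) h1 hiN <;> rw [hnf]
    · norm_num
    · rw [hinv]; simpa using roundTo_nonneg (by positivity)
    · rw [div_self (by linarith)]; simp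
    · rw [hinv]; simpa using abs_roundTo_sub_le (p := p) h2

/-- The height of the focused counter is a sum over the attended positions, since input tokens change
no counter; and the first position is one of the attended positions, so the average of its indicator
is the reciprocal of their number. -/
theorem peers_spec (hs : τ.IsSound p tok) {i : Fin N} (hi : 0 < i.1) :
    (∑ j ∈ τ.peers tok i, (τ.delta (tok j) : ℝ)) = τ.address tok i ∧
    ∑ j ∈ τ.peers tok i, (1 - nfVal j) = 1 ∧ 1 ≤ (τ.peers tok i).card ∧
    (τ.peers tok i).card ≤ N := by
  classical
  have h0 : (⟨0, by omega⟩ : Fin N) ∈ τ.peers tok i := by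
    simp only [peers, Finset.mem_filter, Finset.mem_univ, true_and]
    exact ⟨hi, Or.inl trivial⟩
  refine ⟨?_, sum_one_sub_nfVal rfl h0, Finset.card_pos.2 ⟨_, h0⟩,
    (Finset.card_le_univ _).trans_eq (Fintype.card_fin N)⟩
  unfold address
  push_cast
  rw [peers, Finset.sum_filter, Finset.sum_filter]
  refine Finset.sum_congr rfl fun j _ => ?_
  by_cases h : IsInput (tok j)
  · simp [τ.delta_of_isInput h]
  · have : j.1 ≠ 0 := fun hj => h (hs.first j hj)
    simp [h, this]

/-- The coordinates `Q₁` and `Q₂` approximate the direction of the height of the focused counter. -/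
theorem Q_approx (hs : τ.IsSound p tok) (i : Fin N) :
    |τ.Q₁Val p tok i - dir₁ (τ.address tok i) / √2| ≤ tol N p ∧
    |τ.Q₂Val p tok i - dir₂ (τ.address tok i) / √2| ≤ tol N p := by
  classical
  have ha : (0 : ℝ) ≤ τ.address tok i := by exact_mod_cast hs.address_nonneg i
  by_cases h0 : i.1 = 0
  · have hn : ∀ j : Fin N, ¬ j < i := by intro j; rw [Fin.lt_def]; omega
    have hp : τ.peers tok i = ∅ := by
      ext j; simp [peers, hn]
    have hadr : τ.address tok i = 0 := by simp [address, hn]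
    have hnf : nfVal i = 0 := by simp [nfVal, h0]
    apply abs_sub_dir_le hs i (s := 1) <;> simp [htVal, wtVal, hp, hadr, hnf, one_le_card i]
  · have hi : 0 < i.1 := Nat.pos_of_ne_zero h0
    obtain ⟨h1, h2, h3, h4⟩ := peers_spec hs hi
    have hnf : nfVal i = 1 := by simp [nfVal, h0]
    have hlt : τ.address tok i < i.1 := hs.address_lt i hi
    have h3' : (1 : ℝ) ≤ (τ.peers tok i).card := by exact_mod_cast h3
    have h4' : ((τ.peers tok i).card : ℝ) ≤ N := by exact_mod_cast h4
    have hwt : τ.wtVal p tok i = roundTo p (1 / (τ.peers tok i).card) := by rw [wtVal, h2]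
    have hht : τ.htVal p tok i = roundTo p (τ.address tok i / (τ.peers tok i).card) := by
      rw [htVal, h1]
    have hN5 : (N : ℝ) ≤ 2 ^ p := by
      have := one_le_card i
      have := le_self_pow₀ this (by norm_num : (5 : ℕ) ≠ 0)
      have := hs.precision
      linarith
    have haN : (τ.address tok i : ℝ) ≤ N := by
      have : (τ.address tok i : ℝ) < i.1 := by exact_mod_cast hlt
      have : (i.1 : ℝ) ≤ N := by exact_mod_cast i.2.le
      linarith
    have hr1 : |1 / ((τ.peers tok i).card : ℝ)| ≤ 1 := by
      rw [abs_of_nonneg (by positivity)]; exact (div_le_one (by linarith)).2 h3'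
    have hr2 : |(τ.address tok i : ℝ) / (τ.peers tok i).card| ≤ 2 ^ p := by
      rw [abs_of_nonneg (by positivity)]
      exact (div_le_self ha h3').trans (haN.trans hN5)
    apply abs_sub_dir_le hs i ha h3' h4'
    · rw [hht]; exact roundTo_nonneg (by positivity)
    · rw [hwt, hnf]; simpa using roundTo_nonneg (by positivity)
    · rw [hht]; exact abs_roundTo_sub_le' hr2
    · rw [hwt, hnf]; simpa using abs_roundTo_sub_le (p := p) hr1

theorem nrm_mem_Icc {x X : ℝ} (h : x ^ 2 ≤ X) :
    roundTo p (max 0 (x / √(2 * X))) ∈ Set.Icc (0 : ℝ) 1 := by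
  refine ⟨roundTo_nonneg (le_max_left _ _), roundTo_le_one (max_le zero_le_one ?_)⟩
  apply div_le_one_of_le₀ _ (Real.sqrt_nonneg _)
  exact Real.le_sqrt_of_sq_le (by nlinarith [sq_nonneg x])

theorem P₁Val_mem (i : Fin N) : P₁Val p i ∈ Set.Icc (0 : ℝ) 1 :=
  nrm_mem_Icc (le_add_of_nonneg_right (sq_nonneg _))

theorem P₂Val_mem (i : Fin N) : P₂Val p i ∈ Set.Icc (0 : ℝ) 1 :=
  nrm_mem_Icc (le_add_of_nonneg_left (sq_nonneg _))

theorem Q₁Val_mem (i : Fin N) : τ.Q₁Val p tok i ∈ Set.Icc (0 : ℝ) 1 :=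
  nrm_mem_Icc (le_add_of_nonneg_right (sq_nonneg _))

theorem Q₂Val_mem (i : Fin N) : τ.Q₂Val p tok i ∈ Set.Icc (0 : ℝ) 1 :=
  nrm_mem_Icc (le_add_of_nonneg_left (sq_nonneg _))

theorem abs_lookupNorm_sub_le (hs : τ.IsSound p tok) (i : Fin N) :
    |τ.lookupNorm p tok i - 2| ≤ 8 * tol N p := by
  have ha : (0 : ℝ) ≤ τ.address tok i := by exact_mod_cast hs.address_nonneg i
  exact abs_sqrt_sub_two_le (Nat.cast_nonneg _) ha (P₁Val_mem i) (P₂Val_mem i) (Q₁Val_mem i)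
    (Q₂Val_mem i) (P_approx hs i).1 (P_approx hs i).2 (Q_approx hs i).1 (Q_approx hs i).2

theorem one_le_lookupNorm (hs : τ.IsSound p tok) (i : Fin N) : 1 ≤ τ.lookupNorm p tok i := by
  have h1 := abs_le.1 (abs_lookupNorm_sub_le hs i)
  have h2 := tol_le hs i
  linarith

/-- The position whose index is the height of the focused counter. -/
noncomputable def target (hs : τ.IsSound p tok) (i : Fin N) : Fin N :=
  ⟨(τ.address tok i).toNat, by
    have h1 := hs.address_nonneg i
    by_cases h0 : i.1 = 0
    · have hn : ∀ j : Fin N, ¬ j < i := by intro j; rw [Fin.lt_def]; omega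
      have : τ.address tok i = 0 := by simp [address, hn]
      have := i.2
      omega
    · have := hs.address_lt i (Nat.pos_of_ne_zero h0)
      have := i.2
      omega⟩

theorem cast_target (hs : τ.IsSound p tok) (i : Fin N) :
    ((target hs i).1 : ℝ) = τ.address tok i := by
  have h1 := hs.address_nonneg i
  have : ((target hs i).1 : ℤ) = τ.address tok i := Int.toNat_of_nonneg h1
  exact_mod_cast this

theorem target_lt (hs : τ.IsSound p tok) {i : Fin N} (hi : 0 < i.1) : target hs i < i := by
  have h1 := hs.address_nonneg i
  have h2 := hs.address_lt i hi
  rw [Fin.lt_def]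
  simp only [target]
  omega

theorem target_eq_iff (hs : τ.IsSound p tok) (i j : Fin N) :
    target hs i = target hs j ↔ τ.address tok i = τ.address tok j := by
  have h1 := hs.address_nonneg i
  have h2 := hs.address_nonneg j
  rw [Fin.ext_iff]
  simp only [target]
  omega

/-- The lookup layer attends exactly to the position addressed by the focused counter. -/
theorem lookupSet_eq (hs : τ.IsSound p tok) {i : Fin N} (hi : 0 < i.1) :
    τ.lookupSet p tok i = {target hs i} := by
  have hr : (√(2 : ℝ)) ^ 2 = 2 := Real.sq_sqrt zero_le_two
  have hr1 : 1 ≤ √(2 : ℝ) := Real.one_le_sqrt.2 one_le_two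
  have ha : (0 : ℝ) ≤ τ.address tok i := by exact_mod_cast hs.address_nonneg i
  have hinner : ∀ j : Fin N,
      |(τ.Q₁Val p tok i * P₁Val p j + τ.Q₂Val p tok i * P₂Val p j) -
        (dir₁ (target hs i).1 * dir₁ j.1 + dir₂ (target hs i).1 * dir₂ j.1) / 2| ≤
          4 * tol N p := by
    intro j
    rw [cast_target]
    have hd : ∀ u : ℝ, 0 ≤ u → u ≤ 1 → 0 ≤ u / √2 ∧ u / √2 ≤ 1 := fun u h0 h1 =>
      ⟨by positivity, (div_le_self h0 hr1).trans h1⟩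
    obtain ⟨a0, a1⟩ := hd _ (dir₁_nonneg ha) (dir₁_le_one _)
    obtain ⟨a2, a3⟩ := hd _ (dir₂_nonneg _) (dir₂_le_one (τ.address tok i))
    have e1 := abs_mul_sub_mul_le (P₁Val_mem j).1 (P₁Val_mem j).2 a0 a1 (Q_approx hs i).1
      (P_approx hs j).1
    have e2 := abs_mul_sub_mul_le (P₂Val_mem j).1 (P₂Val_mem j).2 a2 a3 (Q_approx hs i).2
      (P_approx hs j).2
    rw [div_mul_div_comm, ← sq, hr] at e1 e2
    rw [abs_le] at e1 e2 ⊢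
    constructor <;> linarith [e1.1, e1.2, e2.1, e2.2]
  have hscore : ∀ j, τ.lookupScore p tok i j =
      (τ.Q₁Val p tok i * P₁Val p j + τ.Q₂Val p tok i * P₂Val p j) / τ.lookupNorm p tok j /
        τ.lookupNorm p tok i := by
    intro j; unfold lookupScore; ring
  have hlt : ∀ j, j ≠ target hs i →
      τ.lookupScore p tok i j < τ.lookupScore p tok i (target hs i) := by
    intro j hj
    rw [hscore, hscore]
    have hne : (target hs i).1 ≠ j.1 := fun h => hj (Fin.ext h.symm)
    have hg := dir_inner_le hne (target hs i).2 j.2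
    set D := dir₁ (target hs i).1 * dir₁ j.1 + dir₂ (target hs i).1 * dir₂ j.1 with hD
    have hD0 : 0 ≤ D := add_nonneg
      (mul_nonneg (dir₁_nonneg (Nat.cast_nonneg _)) (dir₁_nonneg (Nat.cast_nonneg _)))
      (mul_nonneg (dir₂_nonneg _) (dir₂_nonneg _))
    have htol := tol_lt hs i
    have hpos : 0 < τ.lookupNorm p tok i := by linarith [one_le_lookupNorm hs i]
    refine (div_lt_div_iff_of_pos_right hpos).2 (lookup_lt (g := 1 - D) (tol_nonneg N p)
      (tol_le hs i) (by linarith) (by linarith) ?_ ?_ (abs_lookupNorm_sub_le hs _)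
      (abs_lookupNorm_sub_le hs _))
    · simpa using hinner j
    · have := hinner (target hs i)
      rwa [← sq, ← sq, dir_sq_add_sq] at this
  classical
  ext j
  simp only [lookupSet, attendedSet, Finset.mem_filter, Finset.mem_univ, true_and,
    Finset.mem_singleton]
  constructor
  · rintro ⟨-, h⟩
    by_contra hj
    exact absurd (hlt j hj) (not_lt.2 (h _ (target_lt hs hi)))
  · rintro rfl
    refine ⟨target_lt hs hi, fun j _ => ?_⟩
    by_cases hj : j = target hs i
    · rw [hj]
    · exact (hlt j hj).le

end IsSound

end TokenSystem

namespace TokenSystem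

variable {S G F : Type} {w : ℕ} {τ : TokenSystem S G F w} {N : ℕ} {p : ℕ} {tok : Fin N → Token S w}

namespace IsSound

/-! ### Memory lookup -/

variable (τ p tok) in
/-- First coordinate of the code of the address `j`.  It depends on the address alone, so positions
with equal addresses have exactly equal codes in spite of all rounding. -/
noncomputable def code₁ (j : Fin N) : ℝ := roundTo p (P₁Val p j / τ.lookupNorm p tok j)

variable (τ p tok) in
/-- Second coordinate of the code of the address `j`. -/
noncomputable def code₂ (j : Fin N) : ℝ := roundTo p (P₂Val p j / τ.lookupNorm p tok j)

theorem C₁Val_eq (hs : τ.IsSound p tok) {i : Fin N} (hi : 0 < i.1) :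
    τ.C₁Val p tok i = code₁ τ p tok (target hs i) := by
  simp [C₁Val, lookupSet_eq hs hi, code₁]

theorem C₂Val_eq (hs : τ.IsSound p tok) {i : Fin N} (hi : 0 < i.1) :
    τ.C₂Val p tok i = code₂ τ p tok (target hs i) := by
  simp [C₂Val, lookupSet_eq hs hi, code₂]

theorem abs_code_sub_le (hs : τ.IsSound p tok) (j : Fin N) {x u : ℝ} (hx : x ∈ Set.Icc (0 : ℝ) 1)
    (h : |x - u / √2| ≤ tol N p) :
    |√2 * (2 * roundTo p (x / τ.lookupNorm p tok j)) - u| ≤ 18 * tol N p := by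
  have hn := one_le_lookupNorm hs j
  have hn2 := abs_lookupNorm_sub_le hs j
  set n := τ.lookupNorm p tok j
  set η := tol N p with hη
  have hη0 : 0 ≤ η := tol_nonneg N p
  have hr0 : (0 : ℝ) < √2 := by positivity
  have hr32 : √(2 : ℝ) ≤ 3 / 2 := Real.sqrt_le_iff.2 ⟨by norm_num, by norm_num⟩
  have hxn : x / n ≤ 1 := (div_le_one (by linarith)).2 (hx.2.trans hn)
  have hxn0 : 0 ≤ x / n := div_nonneg hx.1 (by linarith)
  have h1 : |roundTo p (x / n) - x / n| ≤ η :=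
    (abs_roundTo_sub_le (abs_le.2 ⟨by linarith, hxn⟩)).trans (eps_le_tol j)
  have h2 : |2 * (x / n) - x| ≤ 8 * η := by
    have : 2 * (x / n) - x = (x / n) * (2 - n) := by field_simp
    rw [this, abs_mul, abs_of_nonneg hxn0, abs_sub_comm]
    nlinarith [abs_nonneg (n - 2)]
  have h3 : |2 * roundTo p (x / n) - u / √2| ≤ 11 * η := by
    rw [abs_le] at h h1 h2 ⊢
    constructor <;> linarith [h.1, h.2, h1.1, h1.2, h2.1, h2.2]
  have h4 : √2 * (2 * roundTo p (x / n)) - u = √2 * (2 * roundTo p (x / n) - u / √2) := by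
    field_simp
  rw [h4, abs_mul, abs_of_pos hr0]
  nlinarith [abs_nonneg (2 * roundTo p (x / n) - u / √2)]

/-- Different addresses have different codes. -/
theorem code_injective (hs : τ.IsSound p tok) {a b : Fin N}
    (h1 : code₁ τ p tok a = code₁ τ p tok b) (h2 : code₂ τ p tok a = code₂ τ p tok b) : a = b := by
  by_contra hab
  have e1 := abs_code_sub_le hs a (P₁Val_mem a) (P_approx hs a).1
  have e2 := abs_code_sub_le hs a (P₂Val_mem a) (P_approx hs a).2
  have e3 := abs_code_sub_le hs b (P₁Val_mem b) (P_approx hs b).1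
  have e4 := abs_code_sub_le hs b (P₂Val_mem b) (P_approx hs b).2
  unfold code₁ at h1
  unfold code₂ at h2
  rw [h1] at e1
  rw [h2] at e2
  have hg := dir_inner_le (fun h => hab (Fin.ext h)) a.2 b.2
  have htol := tol_lt hs a
  have hle := tol_le hs a
  have h0 := tol_nonneg N p
  set η := tol N p
  have d1 : |dir₁ a.1 - dir₁ b.1| ≤ 36 * η := by
    rw [abs_le] at e1 e3 ⊢
    constructor <;> linarith [e1.1, e1.2, e3.1, e3.2]
  have d2 : |dir₂ a.1 - dir₂ b.1| ≤ 36 * η := by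
    rw [abs_le] at e2 e4 ⊢
    constructor <;> linarith [e2.1, e2.2, e4.1, e4.2]
  have q1 : (dir₁ a.1 - dir₁ b.1) ^ 2 ≤ (36 * η) ^ 2 := sq_le_sq' (abs_le.1 d1).1 (abs_le.1 d1).2
  have q2 : (dir₂ a.1 - dir₂ b.1) ^ 2 ≤ (36 * η) ^ 2 := sq_le_sq' (abs_le.1 d2).1 (abs_le.1 d2).2
  have s1 := dir_sq_add_sq a.1
  have s2 := dir_sq_add_sq b.1
  have q3 : (36 * η) ^ 2 ≤ 1296 / 256 * η := by nlinarith
  nlinarith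

theorem cellNorm_pos (i : Fin N) : 0 < τ.cellNorm p tok i := by
  unfold cellNorm; positivity

theorem cellNorm_sq (i : Fin N) : τ.cellNorm p tok i ^ 2 =
    2 * (1 + τ.C₁Val p tok i ^ 2 + τ.C₂Val p tok i ^ 2) := Real.sq_sqrt (by positivity)

open Classical in
theorem cellScore_eq (i j : Fin N) : τ.cellScore p tok i j =
    ((if τ.focus (tok i) = τ.focus (tok j) then 1 else 0) + τ.C₁Val p tok i * τ.C₁Val p tok j +
      τ.C₂Val p tok i * τ.C₂Val p tok j) / (τ.cellNorm p tok i * τ.cellNorm p tok j) := by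
  have := cellNorm_pos (τ := τ) (p := p) (tok := tok) i
  have := cellNorm_pos (τ := τ) (p := p) (tok := tok) j
  unfold cellScore
  split_ifs
  · field_simp
  · rw [zero_mul, zero_add, zero_add]; field_simp

/-- By the inequality of Cauchy and Schwarz, a score in the memory layer is at most `1 / 2`, with
equality only if focus and code of the address agree. -/
theorem cellScore_le (i j : Fin N) : τ.cellScore p tok i j ≤ 1 / 2 ∧
    (τ.cellScore p tok i j = 1 / 2 ↔ τ.focus (tok j) = τ.focus (tok i) ∧
      τ.C₁Val p tok j = τ.C₁Val p tok i ∧ τ.C₂Val p tok j = τ.C₂Val p tok i) := by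
  classical
  have hi := cellNorm_pos (τ := τ) (p := p) (tok := tok) i
  have hj := cellNorm_pos (τ := τ) (p := p) (tok := tok) j
  have hi2 := cellNorm_sq (τ := τ) (p := p) (tok := tok) i
  have hj2 := cellNorm_sq (τ := τ) (p := p) (tok := tok) j
  rw [cellScore_eq]
  set n := τ.cellNorm p tok i
  set m := τ.cellNorm p tok j
  set a := τ.C₁Val p tok i
  set b := τ.C₂Val p tok i
  set c := τ.C₁Val p tok j
  set d := τ.C₂Val p tok j
  have hnm : 0 < n * m := mul_pos hi hj
  have hprod : (n * m) ^ 2 = 4 * ((1 + a ^ 2 + b ^ 2) * (1 + c ^ 2 + d ^ 2)) := by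
    rw [mul_pow, hi2, hj2]; ring
  have hcs : (1 + a ^ 2 + b ^ 2) * (1 + c ^ 2 + d ^ 2) =
      (1 + a * c + b * d) ^ 2 + (a - c) ^ 2 + (b - d) ^ 2 + (a * d - b * c) ^ 2 := by ring
  have hle : 2 * (1 + a * c + b * d) ≤ n * m := by
    refine le_of_abs_le (abs_le_of_sq_le_sq ?_ hnm.le)
    nlinarith [sq_nonneg (a - c), sq_nonneg (b - d), sq_nonneg (a * d - b * c)]
  rw [div_le_div_iff₀ hnm two_pos, div_eq_div_iff hnm.ne' two_ne_zero]
  by_cases hf : τ.focus (tok i) = τ.focus (tok j)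
  · rw [if_pos hf]
    refine ⟨by linarith, ⟨fun h => ⟨hf.symm, ?_⟩, ?_⟩⟩
    · have : (n * m) ^ 2 = (2 * (1 + a * c + b * d)) ^ 2 := by rw [← one_mul (n * m), ← h]; ring
      rw [hprod, hcs] at this
      have h1 : (a - c) ^ 2 = 0 := by
        nlinarith [sq_nonneg (a - c), sq_nonneg (b - d), sq_nonneg (a * d - b * c)]
      have h2 : (b - d) ^ 2 = 0 := by
        nlinarith [sq_nonneg (a - c), sq_nonneg (b - d), sq_nonneg (a * d - b * c)]
      exact ⟨(sub_eq_zero.1 (pow_eq_zero_iff two_ne_zero |>.1 h1)).symm,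
        (sub_eq_zero.1 (pow_eq_zero_iff two_ne_zero |>.1 h2)).symm⟩
    · rintro ⟨-, h1, h2⟩
      have hm : m = n := by
        apply (sq_eq_sq₀ hj.le hi.le).1
        rw [hi2, hj2, h1, h2]
      rw [hm, h1, h2, ← sq n, hi2]; ring
  · rw [if_neg hf]
    refine ⟨by linarith, ⟨fun h => ?_, fun h => absurd h.1.symm hf⟩⟩
    linarith

variable (τ tok) in
open Classical in
/-- The earlier positions that contribute to the memory cell addressed at position `i`. -/
noncomputable def sameCell (i : Fin N) : Finset (Fin N) :=
  Finset.univ.filter fun j => j < i ∧ τ.focus (tok j) = τ.focus (tok i) ∧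
    τ.address tok j = τ.address tok i

theorem C_eq_iff (hs : τ.IsSound p tok) {i j : Fin N} (hi : 0 < i.1) (hj : 0 < j.1) :
    (τ.C₁Val p tok j = τ.C₁Val p tok i ∧ τ.C₂Val p tok j = τ.C₂Val p tok i) ↔
      τ.address tok j = τ.address tok i := by
  rw [C₁Val_eq hs hi, C₂Val_eq hs hi, C₁Val_eq hs hj, C₂Val_eq hs hj, ← target_eq_iff hs]
  exact ⟨fun h => code_injective hs h.1 h.2, fun h => by rw [h]; exact ⟨rfl, rfl⟩⟩

theorem mem_cellSet_iff (hs : τ.IsSound p tok) {i j₀ : Fin N} (h0 : 0 < j₀.1)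
    (hj₀ : j₀ ∈ sameCell τ tok i) (j : Fin N) : j ∈ τ.cellSet p tok i ↔
      j < i ∧ τ.focus (tok j) = τ.focus (tok i) ∧
      τ.C₁Val p tok j = τ.C₁Val p tok i ∧ τ.C₂Val p tok j = τ.C₂Val p tok i := by
  classical
  simp only [sameCell, Finset.mem_filter, Finset.mem_univ, true_and] at hj₀
  have hi : 0 < i.1 := h0.trans (Fin.lt_def.1 hj₀.1)
  have hmax : τ.cellScore p tok i j₀ = 1 / 2 :=
    (cellScore_le i j₀).2.2 ⟨hj₀.2.1, (C_eq_iff hs hi h0).2 hj₀.2.2⟩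
  simp only [cellSet, attendedSet, Finset.mem_filter, Finset.mem_univ, true_and]
  refine and_congr_right fun hj => ?_
  rw [← (cellScore_le i j).2]
  constructor
  · intro h
    exact le_antisymm (cellScore_le i j).1 (hmax ▸ h j₀ hj₀.1)
  · intro h j' _
    rw [h]
    exact (cellScore_le i j').1

/-- All summands of the memory layer at position `i` carry the same factor, so what is retrieved is
a positive multiple of the content of the memory cell. -/
theorem RVal_eq (hs : τ.IsSound p tok) {i j₀ : Fin N} (h0 : 0 < j₀.1)
    (hj₀ : j₀ ∈ sameCell τ tok i) (g : G) :
    τ.RVal p tok i g = roundTo p (((∑ j ∈ sameCell τ tok i, τ.contrib (tok j) g : ℤ) : ℝ) *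
      (1 / (τ.cellNorm p tok i * (τ.cellSet p tok i).card))) := by
  classical
  have hmem := mem_cellSet_iff hs h0 hj₀
  have hi : 0 < i.1 := by
    simp only [sameCell, Finset.mem_filter] at hj₀
    exact h0.trans (Fin.lt_def.1 hj₀.2.1)
  have h1 : ∀ j ∈ τ.cellSet p tok i, (τ.contrib (tok j) g : ℝ) * (1 / τ.cellNorm p tok j) =
      τ.contrib (tok j) g * (1 / τ.cellNorm p tok i) := by
    intro j hj
    obtain ⟨-, -, h2, h3⟩ := (hmem j).1 hj
    have : τ.cellNorm p tok j = τ.cellNorm p tok i := by unfold cellNorm; rw [h2, h3]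
    rw [this]
  have h2 : (∑ j ∈ τ.cellSet p tok i, (τ.contrib (tok j) g : ℝ)) =
      ((∑ j ∈ sameCell τ tok i, τ.contrib (tok j) g : ℤ) : ℝ) := by
    push_cast
    have e : ∀ s : Finset (Fin N), ∑ j ∈ s, (τ.contrib (tok j) g : ℝ) =
        ∑ j ∈ s.filter (fun j => 0 < j.1), (τ.contrib (tok j) g : ℝ) := by
      intro s
      rw [Finset.sum_filter]
      refine Finset.sum_congr rfl fun j _ => ?_
      split_ifs with h
      · rfl
      · rw [τ.contrib_of_isInput (hs.first j (by omega))]; simp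
    rw [e, e (sameCell τ tok i)]
    congr 1
    ext j
    simp only [Finset.mem_filter, hmem, sameCell, Finset.mem_univ, true_and]
    constructor
    · rintro ⟨⟨a, b, c⟩, d⟩
      exact ⟨⟨a, b, (C_eq_iff hs hi d).1 c⟩, d⟩
    · rintro ⟨⟨a, b, c⟩, d⟩
      exact ⟨⟨a, b, (C_eq_iff hs hi d).2 c⟩, d⟩
  rw [RVal, Finset.sum_congr rfl h1, ← Finset.sum_mul, h2]
  congr 1
  rw [← div_div, mul_div_assoc]

theorem card_cellSet_pos (hs : τ.IsSound p tok) {i j₀ : Fin N} (h0 : 0 < j₀.1)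
    (hj₀ : j₀ ∈ sameCell τ tok i) : 0 < (τ.cellSet p tok i).card := by
  classical
  refine Finset.card_pos.2 ⟨j₀, (mem_cellSet_iff hs h0 hj₀ j₀).2 ?_⟩
  simp only [sameCell, Finset.mem_filter, Finset.mem_univ, true_and] at hj₀
  exact ⟨hj₀.1, hj₀.2.1, (C_eq_iff hs (h0.trans (Fin.lt_def.1 hj₀.1)) h0).2 hj₀.2.2⟩

end IsSound

end TokenSystem

namespace TokenSystem

variable {S G F : Type} {w : ℕ} {τ : TokenSystem S G F w} {N : ℕ} {p : ℕ} {tok : Fin N → Token S w}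

/-! ### The next token -/

variable (τ) in
/-- At position `i` the context shows the observation `o`: the content of the addressed memory cell,
which has been accessed before, or the input symbol at the address, as far as these are relevant for
the token at `i`. -/
structure Observes (tok : Fin N → Token S w) (i : Fin N) (o : Option (G ⊕ S)) : Prop where
  relevant : ∀ a, o = some a → τ.relevant (tok i) a
  accessed : ∀ g, τ.relevant (tok i) (.inl g) → ∃ j : Fin N, 0 < j.1 ∧ j ∈ IsSound.sameCell τ tok i
  content : ∀ g, τ.relevant (tok i) (.inl g) → ∀ g',
    (o = some (.inl g') → ∑ j ∈ IsSound.sameCell τ tok i, τ.contrib (tok j) g' = 1) ∧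
    (o ≠ some (.inl g') → ∑ j ∈ IsSound.sameCell τ tok i, τ.contrib (tok j) g' = 0)
  input : ∀ s, τ.relevant (tok i) (.inr s) → ∀ j : Fin N, (j.1 : ℤ) = τ.address tok i →
    (o = some (.inr s) ↔ tok j = .input s)

namespace IsSound

theorem IVal_eq (hs : τ.IsSound p tok) {i : Fin N} (hi : 0 < i.1) (s : S) :
    τ.IVal p tok i s = roundTo p
      (3 / 2 * (oneHot (tok (target hs i)) (.input s) / τ.lookupNorm p tok (target hs i))) := by
  simp [IVal, lookupSet_eq hs hi]

theorem one_le_bits (hs : τ.IsSound p tok) (i : Fin N) : 1 ≤ p := by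
  have h1 := one_le_pow₀ (n := 5) (one_le_card i)
  have h2 := hs.precision
  by_contra h
  have : p = 0 := by omega
  subst this
  norm_num at h2
  linarith

theorem IVal_mem (hs : τ.IsSound p tok) {i : Fin N} (hi : 0 < i.1) (s : S) :
    τ.IVal p tok i s ∈ Set.Icc (0 : ℝ) 1 ∧
    (tok (target hs i) = .input s → 1 / 2 ≤ τ.IVal p tok i s) ∧
    (tok (target hs i) ≠ .input s → τ.IVal p tok i s = 0) := by
  have h1 := abs_le.1 (abs_lookupNorm_sub_le hs (target hs i))
  have h2 := tol_le hs i
  have h3 := one_le_bits hs i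
  rw [IVal_eq hs hi]
  set n := τ.lookupNorm p tok (target hs i)
  have hn : 0 < n := by linarith
  have h4 : 1 / 2 ≤ 3 / 2 * (1 / n) := by
    rw [mul_one_div, le_div_iff₀ hn]; linarith
  have h5 : 3 / 2 * (1 / n) ≤ 1 := by
    rw [mul_one_div, div_le_iff₀ hn]; linarith
  by_cases h : tok (target hs i) = .input s
  · rw [h, oneHot_self]
    exact ⟨⟨roundTo_nonneg (by linarith), roundTo_le_one h5⟩, fun _ => half_le_roundTo h3 h4,
      fun h => absurd rfl h⟩
  · rw [oneHot_of_ne h]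
    simp [h]

theorem cellNorm_le (hs : τ.IsSound p tok) {i : Fin N} (hi : 0 < i.1) :
    τ.cellNorm p tok i ≤ 3 := by
  have hb : ∀ x ∈ Set.Icc (0 : ℝ) 1, ∀ j : Fin N,
      roundTo p (x / τ.lookupNorm p tok j) ^ 2 ≤ 1 := by
    intro x hx j
    have hn := one_le_lookupNorm hs j
    have h0 : 0 ≤ roundTo p (x / τ.lookupNorm p tok j) :=
      roundTo_nonneg (div_nonneg hx.1 (by linarith))
    have h1 : roundTo p (x / τ.lookupNorm p tok j) ≤ 1 :=
      roundTo_le_one ((div_le_one (by linarith)).2 (hx.2.trans hn))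
    nlinarith
  have h1 := hb _ (P₁Val_mem (p := p) (target hs i)) (target hs i)
  have h2 := hb _ (P₂Val_mem (p := p) (target hs i)) (target hs i)
  rw [cellNorm, C₁Val_eq hs hi, C₂Val_eq hs hi]
  exact Real.sqrt_le_iff.2 ⟨by norm_num, by unfold code₁ code₂; linarith⟩

theorem UVal_mem [Fintype G] (i : Fin N) (g : G) : τ.UVal p tok i g ∈ Set.Icc (0 : ℝ) 1 :=
  nrm_mem_Icc (p := p) (Finset.single_le_sum (f := fun g => τ.RVal p tok i g ^ 2)
    (fun _ _ => sq_nonneg _) (Finset.mem_univ g))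

theorem UVal_spec [Fintype G] (hs : τ.IsSound p tok) {i j₀ : Fin N} (h0 : 0 < j₀.1)
    (hj₀ : j₀ ∈ sameCell τ tok i) {o : Option (G ⊕ S)}
    (ho : ∀ g, (o = some (.inl g) → ∑ j ∈ sameCell τ tok i, τ.contrib (tok j) g = 1) ∧
      (o ≠ some (.inl g) → ∑ j ∈ sameCell τ tok i, τ.contrib (tok j) g = 0)) (g : G) :
    (o = some (.inl g) → 1 / 2 ≤ τ.UVal p tok i g) ∧
    (o ≠ some (.inl g) → τ.UVal p tok i g = 0) := by
  classical
  have hi : 0 < i.1 := by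
    simp only [sameCell, Finset.mem_filter] at hj₀
    exact h0.trans (Fin.lt_def.1 hj₀.2.1)
  have hzero : ∀ g, o ≠ some (.inl g) → τ.RVal p tok i g = 0 := by
    intro g hg
    rw [RVal_eq hs h0 hj₀, (ho g).2 hg]
    simp
  constructor
  · intro hg
    have hR : 0 < τ.RVal p tok i g := by
      rw [RVal_eq hs h0 hj₀, (ho g).1 hg]
      apply roundTo_pos
      rw [Int.cast_one, one_mul]
      have h1 := cellNorm_le hs hi
      have h2 := cellNorm_pos (τ := τ) (p := p) (tok := tok) i
      have h3 : (0 : ℝ) < (τ.cellSet p tok i).card := by exact_mod_cast card_cellSet_pos hs h0 hj₀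
      have h4 : ((τ.cellSet p tok i).card : ℝ) ≤ N := by
        exact_mod_cast (Finset.card_le_univ _).trans_eq (Fintype.card_fin N)
      have h5 := hs.precision
      have h6 := le_self_pow₀ (one_le_card i) (by norm_num : (5 : ℕ) ≠ 0)
      have h7 := one_le_card i
      apply one_div_le_one_div_of_le (by positivity)
      have := mul_le_mul h1 h4 h3.le (by norm_num)
      linarith
    have hsum : ∑ g', τ.RVal p tok i g' ^ 2 = τ.RVal p tok i g ^ 2 := by
      apply Finset.sum_eq_single_of_mem g (Finset.mem_univ g)
      intro g' _ hne
      rw [hzero g' (by rw [hg]; simpa using hne.symm)]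
      norm_num
    have hval : τ.RVal p tok i g / √(2 * ∑ g', τ.RVal p tok i g' ^ 2) = 1 / √2 := by
      rw [hsum, Real.sqrt_mul zero_le_two, Real.sqrt_sq hR.le]
      field_simp
    have hr : √(2 : ℝ) ≤ 2 := Real.sqrt_le_iff.2 ⟨by norm_num, by norm_num⟩
    rw [UVal, hval]
    refine half_le_roundTo (one_le_bits hs i) (le_max_of_le_right ?_)
    exact one_div_le_one_div_of_le (by positivity) hr
  · intro hg
    rw [UVal, hzero g hg]
    simp

variable [Fintype G]

theorem signalVal_mem (hs : τ.IsSound p tok) {i : Fin N} (hi : 0 < i.1) (a : G ⊕ S) :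
    τ.signalVal p tok i a ∈ Set.Icc (0 : ℝ) 1 := by
  cases a
  exacts [UVal_mem i _, (IVal_mem hs hi _).1]

/-- Among the relevant observations, exactly the actual one gives a signal. -/
theorem signalVal_spec (hs : τ.IsSound p tok) {i : Fin N} (hi : 0 < i.1) {o : Option (G ⊕ S)}
    (ho : τ.Observes tok i o) {a : G ⊕ S} (ha : τ.relevant (tok i) a) :
    (o = some a → 1 / 2 ≤ τ.signalVal p tok i a) ∧ (o ≠ some a → τ.signalVal p tok i a = 0) := by
  rcases a with g | s
  · obtain ⟨j₀, h0, hj₀⟩ := ho.accessed g ha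
    exact UVal_spec hs h0 hj₀ (ho.content g ha) g
  · have h1 := ho.input s ha (target hs i) (by
      have := hs.address_nonneg i
      exact Int.toNat_of_nonneg this)
    have h2 := IVal_mem hs hi s
    exact ⟨fun h => h2.2.1 (h1.1 h), fun h => h2.2.2 fun h' => h (h1.2 h')⟩

variable [Fintype S]

theorem outNorm_le (hs : τ.IsSound p tok) {i : Fin N} (hi : 0 < i.1) :
    0 < τ.outNorm p tok i ∧ 2 * τ.outNorm p tok i ≤ (gain S G : ℝ) := by
  have hsq : ∀ x : ℝ, x ∈ Set.Icc (0 : ℝ) 1 → x ^ 2 ≤ 1 := fun x hx => by nlinarith [hx.1, hx.2]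
  have h1 : ∑ g, τ.UVal p tok i g ^ 2 ≤ Fintype.card G := by
    simpa using Finset.sum_le_sum fun g (_ : g ∈ Finset.univ) => hsq _ (UVal_mem (τ := τ) i g)
  have h2 : ∑ s, τ.IVal p tok i s ^ 2 ≤ Fintype.card S := by
    simpa using Finset.sum_le_sum fun s (_ : s ∈ Finset.univ) => hsq _ (IVal_mem hs hi s).1
  have h3 : 0 ≤ ∑ g, τ.UVal p tok i g ^ 2 := Finset.sum_nonneg fun _ _ => sq_nonneg _
  have h4 : 0 ≤ ∑ s, τ.IVal p tok i s ^ 2 := Finset.sum_nonneg fun _ _ => sq_nonneg _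
  unfold outNorm gain
  refine ⟨Real.sqrt_pos.2 (by positivity), ?_⟩
  push_cast
  set a := (Fintype.card G : ℝ)
  set b := (Fintype.card S : ℝ)
  have : √(2 * (1 + ∑ g, τ.UVal p tok i g ^ 2 + ∑ s, τ.IVal p tok i s ^ 2)) ≤
      2 * (1 + a + b) := by
    refine Real.sqrt_le_iff.2 ⟨by linarith, ?_⟩
    nlinarith
  linarith

/-- Only the unit of the last token and the actual observation is active. -/
theorem unitVal_spec (hs : τ.IsSound p tok) {i : Fin N} (hi : 0 < i.1) {o : Option (G ⊕ S)}
    (ho : τ.Observes tok i o) :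
    0 < τ.unitVal p tok i (tok i) o ∧
    ∀ t o', ¬ (t = tok i ∧ o' = o) → τ.unitVal p tok i t o' = 0 := by
  classical
  obtain ⟨hn, hn2⟩ := outNorm_le hs hi
  set n := τ.outNorm p tok i with hnd
  set K : ℝ := ((gain S G : ℚ) : ℝ) with hK
  have hK0 : 0 < K := by linarith
  have hmem := signalVal_mem hs hi
  have hspec := fun {a} => signalVal_spec (a := a) hs hi ho
  have hpos : ∀ x : ℝ, 1 / 2 ≤ x → 0 < roundTo p (max 0 (K * x / n)) := by
    intro x hx
    refine lt_of_lt_of_le one_pos (one_le_roundTo (le_max_of_le_right ?_))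
    rw [le_div_iff₀ hn]
    nlinarith
  have hzero : ∀ x : ℝ, x ≤ 0 → roundTo p (max 0 (K * x / n)) = 0 := by
    intro x hx
    rw [max_eq_left, roundTo_zero]
    exact div_nonpos_of_nonpos_of_nonneg (mul_nonpos_of_nonneg_of_nonpos hK0.le hx) hn.le
  have hterm : ∀ t a, 0 ≤ if τ.relevant t a then τ.signalVal p tok i a else 0 := by
    intro t a
    split_ifs
    exacts [(hmem a).1, le_rfl]
  constructor
  · rcases o with _ | a
    · simp only [unitVal, oneHot_self]
      apply hpos
      have : ∑ a, (if τ.relevant (tok i) a then τ.signalVal p tok i a else 0) = 0 := by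
        refine Finset.sum_eq_zero fun a _ => ?_
        split_ifs with h
        · exact (hspec h).2 (by simp)
        · rfl
      rw [this]
      norm_num
    · have hr := ho.relevant a rfl
      simp only [unitVal, oneHot_self, if_pos hr]
      apply hpos
      have := (hspec hr).1 rfl
      linarith
  · intro t o' hne
    by_cases ht : t = tok i
    · subst ht
      have ho' : o' ≠ o := fun h => hne ⟨rfl, h⟩
      rcases o' with _ | a
      · obtain ⟨a, rfl⟩ : ∃ a, o = some a := Option.ne_none_iff_exists'.1 ho'.symm
        have hr := ho.relevant a rfl
        simp only [unitVal, oneHot_self]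
        apply hzero
        have h1 := (hspec hr).1 rfl
        have h2 := Finset.single_le_sum (fun a _ => hterm (tok i) a) (Finset.mem_univ a)
        rw [if_pos hr] at h2
        linarith
      · simp only [unitVal, oneHot_self]
        split_ifs with hr
        · apply hzero
          rw [(hspec hr).2 ho'.symm]
          norm_num
        · rfl
    · have h1 : oneHot (tok i) t = 0 := oneHot_of_ne (Ne.symm ht)
      rcases o' with _ | a
      · simp only [unitVal, h1]
        apply hzero
        have := Finset.sum_nonneg fun a (_ : a ∈ Finset.univ) => hterm t a
        linarith
      · simp only [unitVal, h1]
        split_ifs with hr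
        · apply hzero
          have := (hmem a).2
          linarith
        · rfl

end IsSound

/-! ### The Transformer of a token system -/

variable (τ) in
open Classical in
/-- There is a Transformer, with any prescribed number of bits, whose hidden states are the features
computed above, and whose next token is therefore the next token of the token system. -/
theorem exists_transformer [Fintype (Token S w)] [Fintype G] [Fintype S] (b : ℕ) :
    ∃ (d : ℕ) (emb : Token S w → Fin d → ℚ) (layers : List (Layer d))
      (un : Token S w → Fin d → ℚ),
      ∀ (x : List (Token S w)) (i : Fin x.length) (o : Option (G ⊕ S)),
        i.1 + 1 = x.length → 0 < i.1 →
        τ.IsSound (b * (Nat.log 2 x.length + 1)) (fun i : Fin x.length => x[i]) →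
        τ.Observes (fun i : Fin x.length => x[i]) i o →
        Transformer.Next ⟨w, d, b, emb, layers, un, 0⟩ x (τ.next x[i] o) := by
  let ι := Coord (Token S w) G S
  let e : Fin (Fintype.card (ι ⊕ ι)) ≃ ι ⊕ ι := (Fintype.equivFin _).symm
  obtain ⟨Λ₁, h₁⟩ := (isRational_layer₁ (S := S) (G := G) (w := w)).exists_layer e
  obtain ⟨Λ₂, h₂⟩ := (isRational_layer₂ (S := S) (G := G) (w := w)).exists_layer e
  obtain ⟨Λ₃, h₃⟩ := τ.isRational_layer₃.exists_layer e
  obtain ⟨Λ₄, h₄⟩ := (isRational_layer₄ (S := S) (G := G) (w := w)).exists_layer e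
  obtain ⟨Λ₅, h₅⟩ := τ.isRational_layer₅.exists_layer e
  obtain ⟨Λ₆, h₆⟩ := τ.isRational_layer₆.exists_layer e
  let embed : Token S w → ι → ℚ := fun t k =>
    match k with
    | .tok t' => if t = t' then 1 else 0
    | _ => 0
  let unembed : Token S w → ι → ℚ := fun t k =>
    match k with
    | .unit t' o => if τ.next t' o = t then 1 else 0
    | _ => 0
  refine ⟨_, fun t c => Sum.elim (embed t) 0 (e c), [Λ₁, Λ₂, Λ₃, Λ₄, Λ₅, Λ₆],
    fun t c => Sum.elim (unembed t) 0 (e c), fun x i o hi hi0 hs ho => ?_⟩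
  set T : Transformer S := ⟨w, _, b, fun t c => Sum.elim (embed t) 0 (e c),
    [Λ₁, Λ₂, Λ₃, Λ₄, Λ₅, Λ₆], fun t c => Sum.elim (unembed t) 0 (e c), 0⟩
  set p := b * (Nat.log 2 x.length + 1) with hp
  set tok : Fin x.length → Token S w := fun i => x[i] with htok
  have hemb : ∀ t c, T.embed t c = Sum.elim (embed t) 0 (e c) := fun _ _ => rfl
  have hun : ∀ t c, T.unembed t c = Sum.elim (unembed t) 0 (e c) := fun _ _ => rfl
  have hbias : ∀ t, T.unembedBias t = 0 := fun _ => rfl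
  have h0 : (fun (i : Fin x.length) c => roundTo p ((T.embed x[i] c : ℚ) : ℝ)) =
      fun i => pairVec e (features₀ tok i : Features (Token S w) G S).vec 0 := by
    funext i c
    rw [hemb]
    simp only [pairVec]
    rcases e c with k | k
    · cases k <;> simp [embed, Features.vec, features₀, oneHot, htok]
      split_ifs <;> simp
    · simp
  have hhid : T.hidden x = fun i => pairVec e (τ.features₆ p tok i).vec 0 := by
    have : T.hidden x = [Λ₁, Λ₂, Λ₃, Λ₄, Λ₅, Λ₆].foldl
        (fun h Λ => Λ.feedforward p (Λ.attention p h))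
        fun i c => roundTo p ((T.embed x[i] c : ℚ) : ℝ) := rfl
    rw [this, h0]
    simp only [List.foldl_cons, List.foldl_nil]
    rw [h₁, attention_layer₁, feedforward_layer₁, h₂, sublayers_layer₂, h₃,
      τ.sublayers_layer₃ p tok hs.first, h₄, sublayers_layer₄, h₅, sublayers_layer₅, h₆,
      sublayers_layer₆]
  obtain ⟨hpos, hzero⟩ := IsSound.unitVal_spec hs hi0 ho
  have hlogit : ∀ t, T.logit x i t =
      if τ.next x[i] o = t then τ.unitVal p tok i (tok i) o else 0 := by
    intro t
    have h1 : T.logit x i t = ∑ c, pairVec e (fun k => (unembed t k : ℝ)) 0 c *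
        pairVec e (τ.features₆ p tok i).vec 0 c := by
      rw [Transformer.logit, hhid]
      rw [hbias, Rat.cast_zero, add_zero]
      refine Finset.sum_congr rfl fun c _ => ?_
      rw [hun]
      simp only [pairVec]
      cases e c <;> simp
    have h2 : (fun c => pairVec e (fun k => (unembed t k : ℝ)) 0 c *
        pairVec e (τ.features₆ p tok i).vec 0 c) =
        pairVec e (fun k => (unembed t k : ℝ) * (τ.features₆ p tok i).vec k) 0 := by
      funext c
      simp only [pairVec]
      cases e c <;> simp
    rw [h1, h2, sum_pairVec, Coord.sum_eq]
    simp only [unembed, Rat.cast_zero, zero_mul, Finset.sum_const_zero, Pi.zero_apply, add_zero,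
      zero_add]
    rw [Finset.sum_eq_single_of_mem (tok i, o) (Finset.mem_univ _)]
    · simp only [Features.vec, features₆, htok]
      split_ifs <;> simp
    · rintro ⟨t', o'⟩ - hne
      have : τ.unitVal p tok i t' o' = 0 := hzero t' o' fun h => hne (Prod.ext h.1 h.2)
      simp [Features.vec, features₆, this]
  refine ⟨i, hi, fun s hne => ?_⟩
  rw [hlogit, hlogit, if_neg (Ne.symm hne), if_pos rfl]
  exact hpos

end TokenSystem

namespace TokenSystem

variable {S G F : Type} {w : ℕ} (τ : TokenSystem S G F w)

/-! ### Histories -/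

open Classical in
/-- The height of the counter `f` before position `i` of the context `x`. -/
noncomputable def height (x : List (Token S w)) (f : F) (i : ℕ) : ℤ :=
  ∑ j ∈ Finset.range i, (x[j]?).elim 0 fun t => if τ.focus t = f then τ.delta t else 0

open Classical in
/-- The content of the memory cell `l` of the counter `f` before position `i` of the context `x`:
the multiplicity of every symbol. -/
noncomputable def cell (x : List (Token S w)) (f : F) (l : ℤ) (g : G) (i : ℕ) : ℤ :=
  ∑ j ∈ Finset.range i, (x[j]?).elim 0 fun t =>
    if τ.focus t = f ∧ τ.height x f j = l then τ.contrib t g else 0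

variable {τ} {x : List (Token S w)} {t : Token S w}

theorem height_append (y : List (Token S w)) (f : F) {i : ℕ} (hi : i ≤ x.length) :
    τ.height (x ++ y) f i = τ.height x f i := by
  refine Finset.sum_congr rfl fun j hj => ?_
  rw [List.getElem?_append_left ((Finset.mem_range.1 hj).trans_le hi)]

theorem cell_append (y : List (Token S w)) (f : F) (l : ℤ) (g : G) {i : ℕ} (hi : i ≤ x.length) :
    τ.cell (x ++ y) f l g i = τ.cell x f l g i := by
  refine Finset.sum_congr rfl fun j hj => ?_
  have hj' := (Finset.mem_range.1 hj).trans_le hi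
  rw [List.getElem?_append_left hj', height_append _ _ hj'.le]

open Classical in
theorem height_snoc (x : List (Token S w)) (t : Token S w) (f : F) :
    τ.height (x ++ [t]) f (x ++ [t]).length =
      τ.height x f x.length + if τ.focus t = f then τ.delta t else 0 := by
  rw [List.length_append, List.length_singleton, height, Finset.sum_range_succ, ← height,
    height_append _ _ le_rfl]
  simp

open Classical in
theorem cell_snoc (x : List (Token S w)) (t : Token S w) (f : F) (l : ℤ) (g : G) :
    τ.cell (x ++ [t]) f l g (x ++ [t]).length = τ.cell x f l g x.length +
      if τ.focus t = f ∧ τ.height x f x.length = l then τ.contrib t g else 0 := by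
  rw [List.length_append, List.length_singleton, cell, Finset.sum_range_succ, ← cell,
    cell_append _ _ _ _ le_rfl, height_append _ _ le_rfl]
  simp

theorem sum_filter_lt {N : ℕ} (i : Fin N) (φ : Fin N → ℤ) (ψ : ℕ → ℤ) (h : ∀ j, φ j = ψ j) :
    ∑ j with j < i, φ j = ∑ j ∈ Finset.range i, ψ j := by
  rw [Finset.sum_filter]
  simp only [h, Fin.lt_def]
  rw [Fin.sum_univ_eq_sum_range (fun j => if j < i.1 then ψ j else 0), ← Finset.sum_filter]
  congr 1
  ext j
  have := i.2
  simp only [Finset.mem_filter, Finset.mem_range]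
  omega

theorem address_eq_height (x : List (Token S w)) (i : Fin x.length) :
    τ.address (fun i : Fin x.length => x[i]) i = τ.height x (τ.focus x[i]) i := by
  classical
  rw [address, ← Finset.filter_filter, Finset.sum_filter, height]
  exact sum_filter_lt i _ _ fun j => by simp

theorem sum_sameCell_eq_cell (x : List (Token S w)) (i : Fin x.length) (g : G) :
    ∑ j ∈ IsSound.sameCell τ (fun i : Fin x.length => x[i]) i, τ.contrib x[j] g =
      τ.cell x (τ.focus x[i]) (τ.height x (τ.focus x[i]) i) g i := by
  classical
  rw [IsSound.sameCell, ← Finset.filter_filter, Finset.sum_filter, cell]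
  refine sum_filter_lt i _ _ fun j => ?_
  simp only [Fin.getElem_fin, j.2, getElem?_pos, Option.elim_some]
  refine if_congr (and_congr_right fun h => ?_) rfl rfl
  have hi := address_eq_height (τ := τ) x i
  have hj := address_eq_height (τ := τ) x j
  simp only [Fin.getElem_fin] at hi hj
  rw [hi, hj, h]

variable (τ) in
/-- A context that starts with an input token and in which no height is negative. -/
structure WellFormed (x : List (Token S w)) : Prop where
  head : ∃ s, x[0]? = some (.input s)
  height_nonneg : ∀ i (h : i < x.length), 0 ≤ τ.height x (τ.focus x[i]) i

namespace WellFormed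

theorem snoc (hx : τ.WellFormed x) (h : 0 ≤ τ.height x (τ.focus t) x.length) :
    τ.WellFormed (x ++ [t]) := by
  constructor
  · obtain ⟨s, hs⟩ := hx.head
    refine ⟨s, ?_⟩
    rw [List.getElem?_append_left, hs]
    by_contra h
    rw [List.getElem?_eq_none (not_lt.1 h)] at hs
    cases hs
  · intro i hi
    rw [height_append _ _ (by simp at hi; omega)]
    by_cases h' : i < x.length
    · rw [List.getElem_append_left h']
      exact hx.height_nonneg i h'
    · obtain rfl : i = x.length := by simp at hi; omega
      simpa using h

theorem length_pos (hx : τ.WellFormed x) : 0 < x.length := by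
  obtain ⟨s, hs⟩ := hx.head
  by_contra h
  rw [List.getElem?_eq_none (not_lt.1 h)] at hs
  cases hs

/-- A height is less than the position, as the first token changes no height. -/
theorem height_lt (hx : τ.WellFormed x) (hτ : ∀ t, τ.delta t ≤ 1) (f : F) {i : ℕ} (hi : 0 < i) :
    τ.height x f i < i := by
  classical
  obtain ⟨s, hs⟩ := hx.head
  obtain ⟨n, rfl⟩ := Nat.exists_eq_add_of_lt hi
  rw [height, zero_add, Finset.sum_range_succ', hs]
  simp only [Option.elim_some, τ.delta_input, ite_self, add_zero]
  have : ∀ j ∈ Finset.range n,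
      (x[j + 1]?).elim 0 (fun t => if τ.focus t = f then τ.delta t else 0) ≤ 1 := by
    intro j _
    rcases x[j + 1]? with _ | t
    · exact zero_le_one
    · simp only [Option.elim_some]
      split_ifs
      exacts [hτ t, zero_le_one]
  have := Finset.sum_le_card_nsmul _ _ _ this
  simp at this
  push_cast
  omega

theorem isSound (hx : τ.WellFormed x) (hτ : ∀ t, τ.delta t ≤ 1) :
    τ.IsSound (24 * (Nat.log 2 x.length + 1)) (fun i : Fin x.length => x[i]) := by
  refine ⟨fun j hj => ?_, fun i => ?_, fun i hi => ?_, ?_⟩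
  · obtain ⟨s, hs⟩ := hx.head
    have : x[j] = .input s := by
      have h := getElem?_pos x j.1 j.2
      simp only [hj, hs, Option.some.injEq] at h
      simpa [hj] using h.symm
    change IsInput x[j]
    rw [this]
    trivial
  · rw [address_eq_height]
    exact hx.height_nonneg i i.2
  · rw [address_eq_height]
    exact hx.height_lt hτ _ hi
  · have h1 : x.length < 2 ^ (Nat.log 2 x.length + 1) := Nat.lt_pow_succ_log_self one_lt_two _
    have h0 := hx.length_pos
    set n := x.length
    have h2 : 1024 * n ^ 5 < 2 ^ (24 * (Nat.log 2 n + 1)) := by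
      rw [mul_comm 24, pow_mul]
      set m := 2 ^ (Nat.log 2 n + 1)
      have h3 : 2 ≤ m := by omega
      have h4 : 2 ^ 10 ≤ m ^ 10 := Nat.pow_le_pow_left h3 10
      have h5 : n ^ 5 < m ^ 5 := Nat.pow_lt_pow_left h1 (by norm_num)
      calc 1024 * n ^ 5 < 1024 * m ^ 5 := by omega
        _ ≤ m ^ 10 * m ^ 5 := Nat.mul_le_mul_right _ h4
        _ = m ^ 15 := by ring
        _ ≤ m ^ 24 := Nat.pow_le_pow_right (by omega) (by norm_num)
    exact_mod_cast h2

end WellFormed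

/-! ### Decoding steps -/

variable (τ) in
/-- The relation `R` between contexts and their next tokens is the one of the token system, on
well-formed contexts. -/
def Determines (R : List (Token S w) → Token S w → Prop) : Prop :=
  ∀ (x : List (Token S w)) (t : Token S w) (o : Option (G ⊕ S)), x ≠ [] → τ.WellFormed (x ++ [t]) →
    τ.Observes (fun i : Fin (x ++ [t]).length => (x ++ [t])[i]) ⟨x.length, by simp⟩ o →
    R (x ++ [t]) (τ.next t o)

variable (τ) in
/-- With `24 (log₂ N + 1)` bits, the precision `2 ^ p` is at least `N ^ 24` and at least `2 ^ 24`, so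
it exceeds `1024 N ^ 5`. -/
theorem exists_transformer_determines [Finite S] [Finite G] (hτ : ∀ t, τ.delta t ≤ 1) :
    ∃ (d : ℕ) (emb : Token S w → Fin d → ℚ) (layers : List (Layer d))
      (un : Token S w → Fin d → ℚ),
      τ.Determines (Transformer.Next ⟨w, d, 24, emb, layers, un, 0⟩) := by
  have := Fintype.ofFinite S
  have := Fintype.ofFinite G
  have : Finite (Token S w) := by
    refine Finite.of_injective (β := S ⊕ Fin w ⊕ Bool)
      (fun | .input s => .inl s | .work i => .inr (.inl i) | .verdict b => .inr (.inr b)) ?_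
    rintro (_ | _ | _) (_ | _ | _) h <;> simp_all
  have := Fintype.ofFinite (Token S w)
  obtain ⟨d, emb, layers, un, h⟩ := τ.exists_transformer 24
  refine ⟨d, emb, layers, un, fun x t o hx hwf ho => ?_⟩
  have := h (x ++ [t]) ⟨x.length, by simp⟩ o (by simp) (List.length_pos_iff.2 hx) (hwf.isSound hτ) ho
  simpa using this

namespace Determines

variable {R : List (Token S w) → Token S w → Prop}

/-- The next token after a token that depends on no observation. -/
theorem next_of_not_relevant (hR : τ.Determines R) (h0 : x ≠ []) (hx : τ.WellFormed (x ++ [t]))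
    (ht : ∀ a, ¬ τ.relevant t a) : R (x ++ [t]) (τ.next t none) := by
  refine hR x t none h0 hx ⟨fun a h => (by cases h), fun g h => ?_, fun g h => ?_,
    fun s h => ?_⟩ <;>
  · simp only [Fin.getElem_fin, List.getElem_concat_length] at h
    exact (ht _ h).elim

/-- The next token after a token that looks up a memory cell.  The token before it focuses on the
same cell. -/
theorem next_of_cell (hR : τ.Determines R) {u : Token S w} (h0 : x ≠ [])
    (hx : τ.WellFormed ((x ++ [u]) ++ [t])) (ht : ∀ a, τ.relevant t a ↔ ∃ g, a = .inl g)
    (hu : τ.focus u = τ.focus t) (hd : τ.delta u = 0) (hc : ∀ g, τ.contrib u g = 0) {o : Option G}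
    (ho : ∀ g, (o = some g → τ.cell x (τ.focus t) (τ.height x (τ.focus t) x.length) g x.length = 1) ∧
      (o ≠ some g → τ.cell x (τ.focus t) (τ.height x (τ.focus t) x.length) g x.length = 0)) :
    R ((x ++ [u]) ++ [t]) (τ.next t (o.map .inl)) := by
  classical
  have hh : τ.height (x ++ [u]) (τ.focus t) (x ++ [u]).length = τ.height x (τ.focus t) x.length := by
    rw [height_snoc, hd, ite_self, add_zero]
  refine hR (x ++ [u]) t _ (by simp) hx ⟨fun a h => ?_, fun g _ => ?_, fun g _ g' => ?_,
    fun s h => ?_⟩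
  · simp only [Fin.getElem_fin, List.getElem_concat_length, ht]
    rcases o with _ | g
    · cases h
    · exact ⟨g, by simpa using h.symm⟩
  · refine ⟨⟨x.length, by simp⟩, List.length_pos_iff.2 h0, ?_⟩
    simp only [IsSound.sameCell, Finset.mem_filter, Finset.mem_univ, true_and, address_eq_height]
    refine ⟨by simp [Fin.lt_def], by simpa using hu, ?_⟩
    simp only [Fin.getElem_fin, List.getElem_concat_length]
    rw [height_append _ _ le_rfl, hh]
    simp only [List.append_assoc]
    rw [height_append _ _ le_rfl]
    simp [hu]
  · have h1 := sum_sameCell_eq_cell (τ := τ) ((x ++ [u]) ++ [t]) ⟨(x ++ [u]).length, by simp⟩ g'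
    simp only [Fin.getElem_fin, List.getElem_concat_length] at h1 ⊢
    rw [h1, height_append _ _ le_rfl, cell_append _ _ _ _ le_rfl, hh, cell_snoc, hc, ite_self,
      add_zero]
    have h2 : (o.map Sum.inl = some (Sum.inl g' : G ⊕ S)) ↔ o = some g' := by
      rcases o with _ | _ <;> simp
    rw [h2, Ne, h2]
    exact ho g'
  · simp only [Fin.getElem_fin, List.getElem_concat_length, ht] at h
    obtain ⟨_, h⟩ := h
    cases h

/-- The next token after a token that looks up an input symbol. -/
theorem next_of_input (hR : τ.Determines R) (h0 : x ≠ []) (hx : τ.WellFormed (x ++ [t]))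
    (ht : ∀ a, τ.relevant t a ↔ ∃ s, a = .inr s) {r : ℕ} (hr : r < x.length)
    (hh : τ.height x (τ.focus t) x.length = r) {o : Option S}
    (ho : ∀ s, x[r]? = some (.input s) ↔ o = some s) :
    R (x ++ [t]) (τ.next t (o.map .inr)) := by
  refine hR x t _ h0 hx ⟨fun a h => ?_, fun g h => ?_, fun g h => ?_, fun s _ j hj => ?_⟩
  · simp only [Fin.getElem_fin, List.getElem_concat_length, ht]
    rcases o with _ | s
    · cases h
    · exact ⟨s, by simpa using h.symm⟩
  iterate 2
    simp only [Fin.getElem_fin, List.getElem_concat_length, ht] at h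
    obtain ⟨_, h⟩ := h
    cases h
  · rw [address_eq_height] at hj
    simp only [Fin.getElem_fin, List.getElem_concat_length] at hj
    rw [height_append _ _ le_rfl, hh] at hj
    have hj : j.1 = r := by exact_mod_cast hj
    have h2 : (o.map Sum.inr = some (Sum.inr s : G ⊕ S)) ↔ o = some s := by
      rcases o with _ | _ <;> simp
    rw [h2, ← ho]
    simp only [Fin.getElem_fin, hj, List.getElem_append_left hr, getElem?_pos, hr, Option.some.injEq]

end Determines
end TokenSystem

/-! ### Programs with stacks -/

/-- The instructions of a program with stacks indexed by `K`, stack symbols `G`, states `Q`, and a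
read-once input over `S`. -/
inductive Instr (K G Q S : Type)
  | push (k : K) (g : G) (q : Q)
  | pop (k : K) (f : Option G → Q)
  | read (f : Option S → Q)
  | jump (q : Q)
  | halt (b : Bool)

/-- A program is a finite control over stack instructions. -/
structure Program (S : Type) where
  K : Type
  [decidableEqK : DecidableEq K]
  G : Type
  Q : Type
  start : Q
  instr : Q → Instr K G Q S

namespace Program

attribute [instance] decidableEqK

variable {S : Type} (p : Program S)

/-- Started in a state with given stacks and a given remaining input, the program halts with output
`b` after at most `n` steps. -/
inductive Outputs : ℕ → p.Q → (p.K → List p.G) → List S → Bool → Prop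
  | halt {n q stk inp b} : p.instr q = .halt b → Outputs n q stk inp b
  | jump {n q stk inp b q'} : p.instr q = .jump q' → Outputs n q' stk inp b →
      Outputs (n + 1) q stk inp b
  | push {n q stk inp b k g q'} : p.instr q = .push k g q' →
      Outputs n q' (Function.update stk k (g :: stk k)) inp b → Outputs (n + 1) q stk inp b
  | pop {n q stk inp b k f} : p.instr q = .pop k f →
      Outputs n (f (stk k).head?) (Function.update stk k (stk k).tail) inp b →
      Outputs (n + 1) q stk inp b
  | read {n q stk inp b f} : p.instr q = .read f → Outputs n (f inp.head?) stk inp.tail b →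
      Outputs (n + 1) q stk inp b

/-- The work tokens of a program.  An instruction takes two or three tokens: `start` moves a stack
pointer up for a push, `probe` writes the pushed symbol or observes the top of a stack or the next
input symbol, and the observed symbol is erased from the stack, or the input pointer advances. -/
inductive Work
  | start (q : p.Q)
  | probe (q : p.Q)
  | erase (q : p.Q) (g : p.G)
  | advance (q : p.Q) (s : S)

namespace Work

variable {p}

/-- The counter a work token refers to: a stack pointer or (`none`) the input pointer. -/
def focus (a : p.Work) : Option p.K :=
  match p.instr (match a with | start q | probe q | erase q _ | advance q _ => q) with
  | .push k _ _ | .pop k _ => some k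
  | _ => none

/-- The change of the counter. -/
def delta : p.Work → ℤ
  | start q =>
    match p.instr q with
    | .push .. => 1
    | _ => 0
  | probe _ => 0
  | erase _ _ => -1
  | advance _ _ => 1

open Classical in
/-- The change of the memory cell at the pointer. -/
noncomputable def contrib : p.Work → p.G → ℤ
  | probe q, g =>
    match p.instr q with
    | .push _ g' _ => if g' = g then 1 else 0
    | _ => 0
  | erase _ g', g => if g' = g then -1 else 0
  | _, _ => 0

/-- The observations that a work token depends on. -/
def relevant : p.Work → p.G ⊕ S → Prop
  | probe q, a =>
    match p.instr q with
    | .pop .. => ∃ g, a = .inl g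
    | .read _ => ∃ s, a = .inr s
    | _ => False
  | _, _ => False

/-- The work token, or the verdict, that follows a work token. -/
def next : p.Work → Option (p.G ⊕ S) → p.Work ⊕ Bool
  | start q, _ =>
    match p.instr q with
    | .halt b => .inr b
    | _ => .inl (probe q)
  | probe q, o =>
    match p.instr q with
    | .push _ _ q' | .jump q' => .inl (start q')
    | .pop _ f =>
      match o with
      | some (.inl g) => .inl (erase q g)
      | _ => .inl (start (f none))
    | .read f =>
      match o with
      | some (.inr s) => .inl (advance q s)
      | _ => .inl (start (f none))
    | .halt b => .inr b
  | erase q g, _ =>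
    match p.instr q with
    | .pop _ f => .inl (start (f (some g)))
    | _ => .inl (start q)
  | advance q s, _ =>
    match p.instr q with
    | .read f => .inl (start (f (some s)))
    | _ => .inl (start q)

end Work

variable {w : ℕ} (e : p.Work ≃ Fin w)

/-- The token system that runs a program. -/
noncomputable def tokenSystem : TokenSystem S p.G (Option p.K) w where
  focus
    | .work i => (e.symm i).focus
    | _ => none
  delta
    | .work i => (e.symm i).delta
    | _ => 0
  contrib
    | .work i => (e.symm i).contrib
    | _ => 0
  relevant
    | .work i => (e.symm i).relevant
    | _ => fun _ => False
  next
    | .input _, _ => .work (e (.start p.start))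
    | .work i, o => Sum.elim (fun a => .work (e a)) .verdict ((e.symm i).next o)
    | .verdict b, _ => .verdict b
  delta_input _ := rfl
  contrib_input _ _ := rfl

section

variable (a : p.Work)

@[simp] theorem focus_work : (p.tokenSystem e).focus (.work (e a)) = a.focus := by
  simp [tokenSystem]

@[simp] theorem delta_work : (p.tokenSystem e).delta (.work (e a)) = a.delta := by
  simp [tokenSystem]

@[simp] theorem contrib_work : (p.tokenSystem e).contrib (.work (e a)) = a.contrib := by
  simp [tokenSystem]

@[simp] theorem relevant_work : (p.tokenSystem e).relevant (.work (e a)) = a.relevant := by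
  simp [tokenSystem]

@[simp] theorem next_work (o : Option (p.G ⊕ S)) : (p.tokenSystem e).next (.work (e a)) o =
    Sum.elim (fun a => .work (e a)) .verdict (a.next o) := by
  simp [tokenSystem]

end

theorem delta_le_one (t : Token S w) : (p.tokenSystem e).delta t ≤ 1 := by
  have : ∀ a : p.Work, a.delta ≤ 1 := by
    rintro (q | q | q | q) <;> simp only [Work.delta] <;> try norm_num
    split <;> norm_num
  cases t <;> simp [tokenSystem, this]

variable {p}

/-- The symbol at height `l` of a stack, where the bottom of the stack has height `1`. -/
def level {G : Type} : List G → ℕ → Option G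
  | [], _ => none
  | g :: s, l => if l = s.length + 1 then some g else level s l

theorem level_of_lt {G : Type} {s : List G} {l : ℕ} (h : s.length < l) : level s l = none := by
  induction s with
  | nil => rfl
  | cons g s ih =>
    simp only [List.length_cons] at h
    rw [level, if_neg (by omega), ih (by omega)]

theorem level_length {G : Type} (s : List G) : level s s.length = s.head? := by
  cases s <;> simp [level]

open Classical in
/-- The context `x` on the prompt `s` encodes the stacks `stk` and a number `r` of input symbols that
have been read. -/
structure Encodes (s : List S) (x : List (Token S w)) (stk : p.K → List p.G) (r : ℕ) : Prop where
  wellFormed : (p.tokenSystem e).WellFormed x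
  prompt : ∃ y, x = s.map .input ++ y ∧ ∀ t ∈ y, ¬ IsInput t
  height_stack : ∀ k, (p.tokenSystem e).height x (some k) x.length = (stk k).length
  height_input : (p.tokenSystem e).height x none x.length = r
  cell : ∀ k (l : ℕ) g, (p.tokenSystem e).cell x (some k) l g x.length =
    if level (stk k) l = some g then 1 else 0

namespace Encodes

variable {e} {s : List S} {x : List (Token S w)} {stk : p.K → List p.G} {r : ℕ}

theorem height_nonneg (h : Encodes e s x stk r) (f : Option p.K) :
    0 ≤ (p.tokenSystem e).height x f x.length := by
  rcases f with _ | k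
  · rw [h.height_input]; positivity
  · rw [h.height_stack]; positivity

theorem wellFormed_snoc (h : Encodes e s x stk r) (a : p.Work) :
    (p.tokenSystem e).WellFormed (x ++ [Token.work (e a)]) :=
  h.wellFormed.snoc (h.height_nonneg _)

theorem prompt_snoc (h : Encodes e s x stk r) (a : p.Work) :
    ∃ y, x ++ [Token.work (e a)] = s.map .input ++ y ∧ ∀ t ∈ y, ¬ IsInput t := by
  obtain ⟨y, rfl, hy⟩ := h.prompt
  refine ⟨y ++ [Token.work (e a)], by simp, fun t ht => ?_⟩
  rcases List.mem_append.1 ht with ht | ht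
  · exact hy t ht
  · rw [List.mem_singleton.1 ht]
    exact id

theorem height_snoc (a : p.Work) (f : Option p.K) :
    (p.tokenSystem e).height (x ++ [Token.work (e a)]) f (x ++ [Token.work (e a)]).length =
      (p.tokenSystem e).height x f x.length + if a.focus = f then a.delta else 0 := by
  rw [TokenSystem.height_snoc, focus_work, delta_work]
  congr

open Classical in
theorem cell_snoc (a : p.Work) (f : Option p.K) (l : ℤ) (g : p.G) :
    (p.tokenSystem e).cell (x ++ [Token.work (e a)]) f l g (x ++ [Token.work (e a)]).length =
      (p.tokenSystem e).cell x f l g x.length +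
      if a.focus = f ∧ (p.tokenSystem e).height x f x.length = l then a.contrib g else 0 := by
  rw [TokenSystem.cell_snoc, focus_work, contrib_work]
  congr

theorem snoc_of_neutral (h : Encodes e s x stk r) {a : p.Work} (hd : a.delta = 0)
    (hc : ∀ g, a.contrib g = 0) : Encodes e s (x ++ [Token.work (e a)]) stk r where
  wellFormed := h.wellFormed_snoc a
  prompt := h.prompt_snoc a
  height_stack k := by rw [height_snoc, hd, ite_self, add_zero, h.height_stack]
  height_input := by rw [height_snoc, hd, ite_self, add_zero, h.height_input]
  cell k l g := by rw [cell_snoc, hc, ite_self, add_zero, h.cell]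

open Classical in
theorem snoc_push (h : Encodes e s x stk r) {q q' : p.Q} {k : p.K} {g : p.G}
    (hq : p.instr q = .push k g q') :
    Encodes e s (x ++ [Token.work (e (.start q))] ++ [Token.work (e (.probe q))])
      (Function.update stk k (g :: stk k)) r where
  wellFormed := by
    refine (h.wellFormed_snoc _).snoc ?_
    rw [height_snoc]
    refine add_nonneg (h.height_nonneg _) ?_
    split_ifs
    · simp [Work.delta, hq]
    · exact le_rfl
  prompt := by
    obtain ⟨y, h1, h2⟩ := h.prompt_snoc (.start q)
    refine ⟨y ++ [Token.work (e (.probe q))], by rw [h1]; simp, fun t ht => ?_⟩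
    rcases List.mem_append.1 ht with ht | ht
    · exact h2 t ht
    · rw [List.mem_singleton.1 ht]
      exact id
  height_stack k' := by
    rw [height_snoc, height_snoc, h.height_stack]
    by_cases hk : k' = k
    · subst hk; simp [Work.focus, Work.delta, hq]
    · simp [Work.focus, hq, hk, Ne.symm hk]
  height_input := by
    rw [height_snoc, height_snoc, h.height_input]
    simp [Work.focus, hq]
  cell k' l g' := by
    rw [cell_snoc, cell_snoc, height_snoc, h.cell, h.height_stack]
    by_cases hk : k' = k
    · subst hk
      simp only [Work.focus, Work.delta, Work.contrib, hq, true_and, if_true, ite_self, add_zero,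
        Function.update_self, level]
      by_cases hl : l = (stk k').length + 1
      · subst hl
        simp [level_of_lt]
      · have : ¬ ((stk k').length + 1 : ℤ) = l := by omega
        simp [hl, this]
    · simp [Work.focus, hq, hk, Ne.symm hk]

open Classical in
theorem snoc_erase (h : Encodes e s x stk r) {q : p.Q} {k : p.K} {f : Option p.G → p.Q} {g : p.G}
    {st : List p.G} (hq : p.instr q = .pop k f) (hst : stk k = g :: st) :
    Encodes e s (x ++ [Token.work (e (.erase q g))]) (Function.update stk k st) r where
  wellFormed := h.wellFormed_snoc _
  prompt := h.prompt_snoc _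
  height_stack k' := by
    rw [height_snoc, h.height_stack]
    by_cases hk : k' = k
    · subst hk; simp [Work.focus, Work.delta, hq, hst]
    · simp [Work.focus, hq, hk, Ne.symm hk]
  height_input := by
    rw [height_snoc, h.height_input]
    simp [Work.focus, hq]
  cell k' l g' := by
    rw [cell_snoc, h.cell, h.height_stack]
    by_cases hk : k' = k
    · subst hk
      simp only [Work.focus, Work.contrib, hq, true_and, Function.update_self, hst, level,
        List.length_cons]
      by_cases hl : l = st.length + 1
      · subst hl
        rw [level_of_lt (Nat.lt_succ_self _)]
        by_cases hg : g = g' <;> simp [hg]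
      · have : ¬ ((st.length + 1 : ℕ) : ℤ) = l := by omega
        rw [if_neg hl, if_neg this, add_zero]
    · simp [Work.focus, hq, hk, Ne.symm hk]

theorem snoc_advance (h : Encodes e s x stk r) {q : p.Q} {f : Option S → p.Q} {a : S}
    (hq : p.instr q = .read f) : Encodes e s (x ++ [Token.work (e (.advance q a))]) stk (r + 1) where
  wellFormed := h.wellFormed_snoc _
  prompt := h.prompt_snoc _
  height_stack k' := by
    rw [height_snoc, h.height_stack]
    simp [Work.focus, hq]
  height_input := by
    rw [height_snoc, h.height_input]
    simp [Work.focus, Work.delta, hq]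
  cell k' l g' := by
    rw [cell_snoc, h.cell]
    simp [Work.focus, hq]

theorem initial (hs : s ≠ []) : Encodes e s (s.map .input) (fun _ => []) 0 := by
  have hh : ∀ f i, (p.tokenSystem e).height (s.map .input) f i = 0 := fun f i =>
    Finset.sum_eq_zero fun j _ => by
      rw [List.getElem?_map]
      cases s[j]? <;> simp [TokenSystem.delta_input]
  have hc : ∀ f l g i, (p.tokenSystem e).cell (s.map .input) f l g i = 0 := fun f l g i =>
    Finset.sum_eq_zero fun j _ => by
      rw [List.getElem?_map]
      cases s[j]? <;> simp [TokenSystem.contrib_input]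
  refine ⟨⟨?_, fun i _ => (hh _ _).ge⟩, ⟨[], by simp⟩, fun k => by simp [hh], by simp [hh],
    fun k l g => by simp [hc, level]⟩
  obtain ⟨a, s, rfl⟩ := List.exists_cons_of_ne_nil hs
  exact ⟨a, rfl⟩

/-- The input pointer points to the next input symbol, or behind the prompt. -/
theorem getElem?_eq (h : Encodes e s x stk r) (hr : r ≤ s.length) (a : S) :
    x[r]? = some (.input a) ↔ (s.drop r).head? = some a := by
  obtain ⟨y, rfl, hy⟩ := h.prompt
  rw [List.head?_drop]
  rcases hr.lt_or_eq with hr | rfl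
  · rw [List.getElem?_append_left (by simpa using hr), List.getElem?_map]
    rcases s[r]? with _ | b <;> simp
  · rw [List.getElem?_append_right (by simp)]
    simp only [List.length_map, Nat.sub_self, List.getElem?_eq_none le_rfl]
    refine ⟨fun h => ?_, fun h => by cases h⟩
    exact (hy _ (List.mem_of_getElem? h) trivial).elim

end Encodes
/-! ### Running a program by decoding -/

/-- Starting from the context `x`, the tokens `y` are appended one after the other, each in the
relation `R` to its context. -/
def Chain (R : List (Token S w) → Token S w → Prop) : List (Token S w) → List (Token S w) → Prop
  | _, [] => True
  | x, t :: y => R x t ∧ Chain R (x ++ [t]) y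

theorem Chain.getElem {R : List (Token S w) → Token S w → Prop} {x y : List (Token S w)}
    (h : Chain R x y) (i : Fin y.length) : R (x ++ y.take i) y[i] := by
  induction y generalizing x with
  | nil => exact i.elim0
  | cons t y ih =>
    obtain ⟨_ | i, hi⟩ := i
    · simpa using h.1
    · simpa using ih h.2 ⟨i, by simpa using hi⟩

variable {e} {R : List (Token S w) → Token S w → Prop}

/-- If `start q` is the next token on a context that encodes a configuration with state `q`, then
decoding simulates the program. -/
theorem Outputs.exists_chain (hR : (p.tokenSystem e).Determines R) {s : List S} {n : ℕ} {q : p.Q}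
    {stk : p.K → List p.G} {inp : List S} {b : Bool} (h : p.Outputs n q stk inp b) :
    ∀ (x : List (Token S w)) (r : ℕ), Encodes e s x stk r → r ≤ s.length → inp = s.drop r →
      R x (.work (e (.start q))) →
      ∃ y : List p.Work, y.length ≤ 3 * n + 1 ∧
        Chain R x (y.map (fun a => .work (e a)) ++ [.verdict b]) := by
  have hstart : ∀ {q : p.Q} {x stk r}, Encodes e s x stk r →
      R (x ++ [Token.work (e (.start q))])
        (Sum.elim (fun a => .work (e a)) .verdict ((Work.start q).next none)) := by
    intro q x stk r hx
    have := hR.next_of_not_relevant (List.length_pos_iff.1 hx.wellFormed.length_pos)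
      (hx.wellFormed_snoc (.start q)) (by simp [Work.relevant])
    simpa using this
  have hprobe : ∀ {q : p.Q} {x stk r}, Encodes e s x stk r →
      (p.tokenSystem e).WellFormed
        (x ++ [Token.work (e (.start q))] ++ [Token.work (e (.probe q))]) →
      (∀ a, ¬ (Work.probe q).relevant a) →
      R (x ++ [Token.work (e (.start q))] ++ [Token.work (e (.probe q))])
        (Sum.elim (fun a => .work (e a)) .verdict ((Work.probe q).next none)) := by
    intro q x stk r hx hw ha
    have := hR.next_of_not_relevant (by simp) hw (by simpa using ha)
    simpa using this
  induction h with
  | @halt n q stk inp b hq =>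
    intro x r hx _ _ h1
    have h2 := hstart (q := q) hx
    refine ⟨[.start q], by simp, ?_⟩
    simp only [Work.next, hq, Sum.elim_inr] at h2
    exact ⟨h1, h2, trivial⟩
  | @jump n q stk inp b q' hq _ ih =>
    intro x r hx hr hinp h1
    have hx1 : Encodes e s (x ++ [Token.work (e (.start q))]) stk r :=
      hx.snoc_of_neutral (by simp [Work.delta, hq]) (by simp [Work.contrib])
    have hx2 : Encodes e s (x ++ [Token.work (e (.start q))] ++ [Token.work (e (.probe q))]) stk r :=
      hx1.snoc_of_neutral rfl (by simp [Work.contrib, hq])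
    have h2 := hstart (q := q) hx
    have h3 := hprobe hx hx2.wellFormed (by simp [Work.relevant, hq])
    simp only [Work.next, hq, Sum.elim_inl] at h2 h3
    obtain ⟨y, hy, hc⟩ := ih _ r hx2 hr hinp h3
    exact ⟨.start q :: .probe q :: y, by simp; omega, h1, h2, hc⟩
  | @push n q stk inp b k g q' hq _ ih =>
    intro x r hx hr hinp h1
    have hx2 := hx.snoc_push hq
    have h2 := hstart (q := q) hx
    have h3 := hprobe hx hx2.wellFormed (by simp [Work.relevant, hq])
    simp only [Work.next, hq, Sum.elim_inl] at h2 h3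
    obtain ⟨y, hy, hc⟩ := ih _ r hx2 hr hinp h3
    exact ⟨.start q :: .probe q :: y, by simp; omega, h1, h2, hc⟩
  | @pop n q stk inp b k f hq _ ih =>
    intro x r hx hr hinp h1
    have hx1 : Encodes e s (x ++ [Token.work (e (.start q))]) stk r :=
      hx.snoc_of_neutral (by simp [Work.delta, hq]) (by simp [Work.contrib])
    have hx2 : Encodes e s (x ++ [Token.work (e (.start q))] ++ [Token.work (e (.probe q))]) stk r :=
      hx1.snoc_of_neutral rfl (by simp [Work.contrib, hq])
    have h2 := hstart (q := q) hx
    have hf : (Work.probe q : p.Work).focus = some k := by simp [Work.focus, hq]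
    have h3 := hR.next_of_cell (x := x) (u := .work (e (.start q))) (t := .work (e (.probe q)))
      (o := (stk k).head?) (List.length_pos_iff.1 hx.wellFormed.length_pos) hx2.wellFormed
      (by simp [Work.relevant, hq]) (by simp [Work.focus]) (by simp [Work.delta, hq])
      (by simp [Work.contrib]) (by
        intro g
        rw [focus_work, hf, hx.height_stack, hx.cell, level_length]
        exact ⟨fun h => if_pos h, fun h => if_neg h⟩)
    simp only [Work.next, hq, Sum.elim_inl, next_work] at h2 h3
    rcases hst : stk k with _ | ⟨g, st⟩
    · simp only [hst, List.head?_nil, Option.map_none, Sum.elim_inl, List.tail_nil] at h3 ih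
      rw [← hst, Function.update_eq_self] at ih
      obtain ⟨y, hy, hc⟩ := ih _ r hx2 hr hinp h3
      exact ⟨.start q :: .probe q :: y, by simp; omega, h1, h2, hc⟩
    · simp only [hst, List.head?_cons, Option.map_some, Sum.elim_inl, List.tail_cons] at h3 ih
      have hx3 := hx2.snoc_erase hq hst
      have h4 := hR.next_of_not_relevant (by simp) hx3.wellFormed (by simp [Work.relevant])
      simp only [Work.next, hq, Sum.elim_inl, next_work] at h4
      obtain ⟨y, hy, hc⟩ := ih _ r hx3 hr hinp h4
      exact ⟨.start q :: .probe q :: .erase q g :: y, by simp; omega, h1, h2, h3, hc⟩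
  | @read n q stk inp b f hq _ ih =>
    intro x r hx hr hinp h1
    have hx1 : Encodes e s (x ++ [Token.work (e (.start q))]) stk r :=
      hx.snoc_of_neutral (by simp [Work.delta, hq]) (by simp [Work.contrib])
    have hx2 : Encodes e s (x ++ [Token.work (e (.start q))] ++ [Token.work (e (.probe q))]) stk r :=
      hx1.snoc_of_neutral rfl (by simp [Work.contrib, hq])
    have h2 := hstart (q := q) hx
    have hf : (Work.probe q : p.Work).focus = none := by simp [Work.focus, hq]
    have hlen : s.length ≤ x.length := by
      obtain ⟨y, rfl, -⟩ := hx.prompt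
      simp
    have h3 := hR.next_of_input (x := x ++ [Token.work (e (.start q))]) (t := .work (e (.probe q)))
      (o := inp.head?) (by simp) hx2.wellFormed (by simp [Work.relevant, hq]) (r := r)
      (by simp; omega) (by rw [focus_work, hf, hx1.height_input])
      (by rw [hinp]; exact hx1.getElem?_eq hr)
    simp only [Work.next, hq, Sum.elim_inl, next_work] at h2 h3
    rcases hst : inp with _ | ⟨a, inp'⟩
    · simp only [hst, List.head?_nil, Option.map_none, Sum.elim_inl, List.tail_nil] at h3 ih
      obtain ⟨y, hy, hc⟩ := ih _ r hx2 hr (hst ▸ hinp) h3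
      exact ⟨.start q :: .probe q :: y, by simp; omega, h1, h2, hc⟩
    · simp only [hst, List.head?_cons, Option.map_some, Sum.elim_inl, List.tail_cons] at h3 ih
      have hx3 := hx2.snoc_advance (a := a) hq
      have h4 := hR.next_of_not_relevant (by simp) hx3.wellFormed (by simp [Work.relevant])
      simp only [Work.next, hq, Sum.elim_inl, next_work] at h4
      have hr' : r < s.length := by
        by_contra h
        rw [List.drop_eq_nil_of_le (not_lt.1 h), hst] at hinp
        cases hinp
      have hinp' : inp' = s.drop (r + 1) := by
        rw [← List.tail_drop, ← hinp, hst, List.tail_cons]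
      obtain ⟨y, hy, hc⟩ := ih _ (r + 1) hx3 hr' hinp' h4
      exact ⟨.start q :: .probe q :: .advance q a :: y, by simp; omega, h1, h2, h3, hc⟩

/-- A finite program is simulated by a Transformer, in at most three tokens per instruction. -/
theorem exists_transformer_returns (p : Program S) [Finite S] [Finite p.G] [Finite p.Q] :
    ∃ T : Transformer S, ∀ (s : List S) (n : ℕ) (b : Bool), 2 ≤ s.length →
      p.Outputs n p.start (fun _ => []) s b → ∃ ℓ ≤ s.length + (3 * n + 2), T.Returns s b ℓ := by
  have : Finite p.Work := by
    refine Finite.of_injective (β := p.Q ⊕ p.Q ⊕ (p.Q × p.G) ⊕ (p.Q × S))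
      (fun
        | .start q => .inl q
        | .probe q => .inr (.inl q)
        | .erase q g => .inr (.inr (.inl (q, g)))
        | .advance q s => .inr (.inr (.inr (q, s)))) ?_
    rintro (_ | _ | _ | _) (_ | _ | _ | _) h <;> simp_all
  obtain ⟨w, ⟨e⟩⟩ := Finite.exists_equiv_fin p.Work
  obtain ⟨d, emb, layers, un, hR⟩ :=
    (p.tokenSystem e).exists_transformer_determines (p.delta_le_one e)
  refine ⟨⟨w, d, 24, emb, layers, un, 0⟩, fun s n b hs h => ?_⟩
  have hx := Encodes.initial (e := e) (List.length_pos_iff.1 (by omega : 0 < s.length))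
  have h1 : Transformer.Next ⟨w, d, 24, emb, layers, un, 0⟩ (s.map .input)
      (.work (e (.start p.start))) := by
    obtain ⟨s', a, rfl⟩ : ∃ s' a, s = s' ++ [a] :=
      ⟨s.dropLast, s.getLast (List.length_pos_iff.1 (by omega)),
        (List.dropLast_append_getLast _).symm⟩
    simp only [List.map_append, List.map_cons, List.map_nil] at hx ⊢
    refine hR.next_of_not_relevant ?_ hx.wellFormed (fun _ h => h)
    simp only [List.length_append, List.length_singleton] at hs
    exact List.length_pos_iff.1 (by simp; omega)
  obtain ⟨y, hy, hc⟩ := h.exists_chain hR _ 0 hx (Nat.zero_le _) rfl h1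
  exact ⟨_, by simpa using by omega, y.map fun a => .work (e a), by simp,
    fun i => hc.getElem i, rfl⟩

end Program

theorem Program.Outputs.mono {S : Type} {p : Program S} {n m : ℕ} {q : p.Q}
    {stk : p.K → List p.G} {inp : List S} {b : Bool} (h : p.Outputs n q stk inp b) (hnm : n ≤ m) :
    p.Outputs m q stk inp b := by
  induction h generalizing m with
  | halt hq => exact .halt hq
  | jump hq _ ih => cases m with
    | zero => omega
    | succ m => exact .jump hq (ih (by omega))
  | push hq _ ih => cases m with
    | zero => omega
    | succ m => exact .push hq (ih (by omega))
  | pop hq _ ih => cases m with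
    | zero => omega
    | succ m => exact .pop hq (ih (by omega))
  | read hq _ ih => cases m with
    | zero => omega
    | succ m => exact .read hq (ih (by omega))

/-! ### Turing machines as programs -/

namespace Compiler

open Turing

variable {S : Type} (M : TM2ComputableAux S Bool)

/-- The statements that occur in the code of the machine. -/
def Code : Type := {q : TM2.Stmt M.tm.Γ M.tm.Λ M.tm.σ // ∃ l, q ∈ TM2.stmts₁ (M.tm.m l)}

instance : Finite (Code M) := by
  have := M.tm.ΛFin
  have : (⋃ l, (TM2.stmts₁ (M.tm.m l) : Set (TM2.Stmt M.tm.Γ M.tm.Λ M.tm.σ))).Finite :=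
    Set.finite_iUnion fun l => Finset.finite_toSet _
  refine (this.subset fun q hq => ?_ : {q | ∃ l, q ∈ TM2.stmts₁ (M.tm.m l)}.Finite).to_subtype
  obtain ⟨l, hl⟩ := hq
  exact Set.mem_iUnion.2 ⟨l, hl⟩

/-- The symbol that a statement pushes, together with its stack. -/
def pushed : TM2.Stmt M.tm.Γ M.tm.Λ M.tm.σ → M.tm.σ → Option (Σ k, M.tm.Γ k)
  | .push k f _, v => some ⟨k, f v⟩
  | _, _ => none

/-- An input symbol as a symbol of the input stack. -/
def inputSymbol (s : S) : Σ k, M.tm.Γ k := ⟨M.tm.k₀, M.inputAlphabet.symm s⟩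

/-- The symbols that can occur on the stacks. -/
def Letter : Type :=
  {g : Σ k, M.tm.Γ k //
    g ∈ Set.range (inputSymbol M) ∨ ∃ (q : Code M) (v : _), pushed M q.1 v = some g}

variable {M} in
/-- The stack of a letter, and the symbol. -/
def Letter.val (g : Letter M) : Σ k, M.tm.Γ k := Subtype.val g

instance [Finite S] : Finite (Letter M) := by
  have := M.tm.σFin
  have h1 := Set.finite_range (inputSymbol M)
  have h2 := (Set.finite_range fun a : Code M × M.tm.σ => pushed M a.1.1 a.2).preimage
    (Option.some_injective _).injOn
  refine ((h1.union h2).subset ?_).to_subtype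
  rintro g (h | ⟨q, v, h⟩)
  exacts [.inl h, .inr ⟨(q, v), h⟩]

/-- The letter of an input symbol. -/
def inputLetter (s : S) : Letter M := ⟨inputSymbol M s, .inl ⟨s, rfl⟩⟩

/-- A letter as a symbol of the stack `k`. -/
def symbol (k : M.tm.K) (g : Letter M) : Option (M.tm.Γ k) :=
  if h : g.val.1 = k then some (h ▸ g.val.2) else none

/-- The states of the program: about to execute a statement; about to execute a statement on the
input stack when all symbols on the stack of the program, which sit on top of the unread input, have
been used up; about to return a symbol to its stack; halted. -/
inductive State
  | run (q : Code M) (v : M.tm.σ)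
  | behind (q : Code M) (v : M.tm.σ)
  | restore (g : Letter M) (q : Code M) (v : M.tm.σ)
  | done (b : Bool)

instance [Finite S] : Finite (State M) := by
  have := M.tm.σFin
  refine Finite.of_injective
    (β := (Code M × M.tm.σ) ⊕ (Code M × M.tm.σ) ⊕ (Letter M × Code M × M.tm.σ) ⊕ Bool)
    (fun
      | .run q v => .inl (q, v)
      | .behind q v => .inr (.inl (q, v))
      | .restore g q v => .inr (.inr (.inl (g, q, v)))
      | .done b => .inr (.inr (.inr b))) ?_
  rintro (_ | _ | _ | _) (_ | _ | _ | _) h <;> simp_all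

variable {M}

/-- A part of a statement of the code belongs to the code. -/
def Code.part (q : Code M) {q' : TM2.Stmt M.tm.Γ M.tm.Λ M.tm.σ} (h : q' ∈ TM2.stmts₁ q.1) : Code M :=
  ⟨q', q.2.imp fun _ hl => TM2.stmts₁_trans hl h⟩

variable (M) in
/-- The code of a label. -/
def label (l : M.tm.Λ) : Code M := ⟨M.tm.m l, l, TM2.stmts₁_self⟩

theorem mem_push {k f} {q : TM2.Stmt M.tm.Γ M.tm.Λ M.tm.σ} : q ∈ TM2.stmts₁ (.push k f q) :=
  by classical exact Finset.mem_insert_of_mem TM2.stmts₁_self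

theorem mem_peek {k f} {q : TM2.Stmt M.tm.Γ M.tm.Λ M.tm.σ} : q ∈ TM2.stmts₁ (.peek k f q) :=
  by classical exact Finset.mem_insert_of_mem TM2.stmts₁_self

theorem mem_pop {k f} {q : TM2.Stmt M.tm.Γ M.tm.Λ M.tm.σ} : q ∈ TM2.stmts₁ (.pop k f q) :=
  by classical exact Finset.mem_insert_of_mem TM2.stmts₁_self

theorem mem_load {f} {q : TM2.Stmt M.tm.Γ M.tm.Λ M.tm.σ} : q ∈ TM2.stmts₁ (.load f q) :=
  by classical exact Finset.mem_insert_of_mem TM2.stmts₁_self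

theorem mem_branch {f} {q₁ q₂ : TM2.Stmt M.tm.Γ M.tm.Λ M.tm.σ} (b : Bool) :
    cond b q₁ q₂ ∈ TM2.stmts₁ (.branch f q₁ q₂) := by
  classical
  refine Finset.mem_insert_of_mem ?_
  cases b
  exacts [Finset.mem_union_right _ TM2.stmts₁_self, Finset.mem_union_left _ TM2.stmts₁_self]

/-- What remains to be done after the statement `q` has received the top symbol of a stack, which
has been removed from the stack.  A halting machine receives the top of the output stack. -/
def resume : Code M → M.tm.σ → Option (Letter M) → State M
  | ⟨.peek k f q, h⟩, v, o =>
    let next := Code.part ⟨.peek k f q, h⟩ mem_peek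
    match o with
    | some g => .restore g next (f v (symbol M k g))
    | none => .run next (f v none)
  | ⟨.pop k f q, h⟩, v, o =>
    .run (Code.part ⟨.pop k f q, h⟩ mem_pop) (f v (o.bind (symbol M k)))
  | _, _, o => .done ((o.bind (symbol M M.tm.k₁)).elim false M.outputAlphabet)

/-- What remains to be done after an attempt to pop the stack `k` for the statement `q`. -/
noncomputable def receive (k : M.tm.K) (q : Code M) (v : M.tm.σ) : Option (Letter M) → State M
  | some g => resume q v (some g)
  | none => if k = M.tm.k₀ then .behind q v else resume q v none

/-- The instructions of the program of a Turing machine. -/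
noncomputable def instr : State M → Instr M.tm.K (Letter M) (State M) S
  | .run ⟨.push k f q, h⟩ v =>
    .push k ⟨⟨k, f v⟩, .inr ⟨⟨.push k f q, h⟩, v, rfl⟩⟩ (.run (Code.part ⟨.push k f q, h⟩ mem_push) v)
  | .run ⟨.peek k f q, h⟩ v => .pop k (receive k ⟨.peek k f q, h⟩ v)
  | .run ⟨.pop k f q, h⟩ v => .pop k (receive k ⟨.pop k f q, h⟩ v)
  | .run ⟨.load f q, h⟩ v => .jump (.run (Code.part ⟨.load f q, h⟩ mem_load) (f v))
  | .run ⟨.branch f q₁ q₂, h⟩ v =>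
    .jump (.run (Code.part ⟨.branch f q₁ q₂, h⟩ (mem_branch (f v))) v)
  | .run ⟨.goto f, _⟩ v => .jump (.run (label M (f v)) v)
  | .run ⟨.halt, h⟩ v => .pop M.tm.k₁ (receive M.tm.k₁ ⟨.halt, h⟩ v)
  | .behind q v => .read fun o => resume q v (o.map (inputLetter M))
  | .restore g q v => .push g.val.1 g (.run q v)
  | .done b => .halt b

variable (M) in
/-- The program of a Turing machine. -/
noncomputable def program : Program S where
  K := M.tm.K
  G := Letter M
  Q := State M
  start := .run (label M M.tm.main) M.tm.initialState
  instr := instr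

theorem outputs_pop {n : ℕ} {q : State M} {stk stk' : M.tm.K → List (Letter M)} {inp : List S}
    {b : Bool} {k : M.tm.K} {f : Option (Letter M) → State M} {o : Option (Letter M)}
    (hq : instr q = .pop k f) (ho : (stk k).head? = o)
    (hs : Function.update stk k (stk k).tail = stk') (h : (program M).Outputs n (f o) stk' inp b) :
    (program M).Outputs (n + 1) q stk inp b := by
  subst ho hs
  exact .pop hq h

theorem outputs_behind {n : ℕ} {q : Code M} {v : M.tm.σ} {stk : M.tm.K → List (Letter M)}
    {inp : List S} {b : Bool}
    (h : (program M).Outputs n (resume q v (inp.head?.map (inputLetter M))) stk inp.tail b) :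
    (program M).Outputs (n + 1) (.behind q v) stk inp b :=
  .read (f := fun o => resume q v (o.map (inputLetter M))) rfl h

/-- The stacks `T` of the machine are represented by the stacks of the program, where the unread
input forms the bottom part of the input stack. -/
def Represents (stk : M.tm.K → List (Letter M)) (inp : List S) (T : ∀ k, List (M.tm.Γ k)) : Prop :=
  ∀ k, (stk k).map Letter.val ++ (if k = M.tm.k₀ then inp.map (inputSymbol M) else []) =
    (T k).map (Sigma.mk k)

namespace Represents

variable {stk : M.tm.K → List (Letter M)} {inp : List S} {T : ∀ k, List (M.tm.Γ k)}

theorem push (h : Represents stk inp T) {k : M.tm.K} {a : M.tm.Γ k} {g : Letter M}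
    (hg : g.val = ⟨k, a⟩) :
    Represents (Function.update stk k (g :: stk k)) inp (Function.update T k (a :: T k)) := by
  intro k'
  by_cases hk : k' = k
  · subst hk
    simp [hg, h k']
  · simp [hk, h k']

theorem symbol_eq {k : M.tm.K} {a : M.tm.Γ k} {g : Letter M} (hg : g.val = ⟨k, a⟩) :
    symbol M k g = some a := by
  rw [symbol, dif_pos (congrArg Sigma.fst hg)]
  congr 1
  obtain ⟨g, hg'⟩ := g
  change g = _ at hg
  subst hg
  rfl

theorem pop (h : Represents stk inp T) {k : M.tm.K} {g : Letter M} {st : List (Letter M)}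
    (hst : stk k = g :: st) : ∃ a, g.val = ⟨k, a⟩ ∧ (T k).head? = some a ∧
      Represents (Function.update stk k st) inp (Function.update T k (T k).tail) := by
  have hk := h k
  rw [hst] at hk
  rcases hT : T k with _ | ⟨a, t⟩
  · simp [hT] at hk
  · simp only [hT, List.map_cons, List.cons_append, List.cons.injEq] at hk
    refine ⟨a, hk.1, rfl, fun k' => ?_⟩
    by_cases hk' : k' = k
    · subst hk'
      simpa using hk.2
    · simp [hk', h k']

theorem read (h : Represents stk inp T) {s : S} {inp' : List S} (hst : stk M.tm.k₀ = [])
    (hinp : inp = s :: inp') : (T M.tm.k₀).head? = some (M.inputAlphabet.symm s) ∧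
      Represents stk inp' (Function.update T M.tm.k₀ (T M.tm.k₀).tail) := by
  have hk := h M.tm.k₀
  rw [hst, hinp] at hk
  rcases hT : T M.tm.k₀ with _ | ⟨a, t⟩
  · simp [hT] at hk
  · simp only [hT, List.map_nil, List.nil_append, if_true, List.map_cons, List.cons.injEq] at hk
    refine ⟨?_, fun k' => ?_⟩
    · have := hk.1
      simp only [inputSymbol, Sigma.mk.injEq, heq_eq_eq, true_and] at this
      simp [this]
    · by_cases hk' : k' = M.tm.k₀
      · subst hk'
        simpa [hst] using hk.2
      · have := h k'
        simp only [if_neg hk'] at this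
        simp [hk', this]

/-- Popping a stack of the program, and reading the input if the input stack is empty there, yields
the top symbol of the stack of the machine. -/
theorem exists_receive (h : Represents stk inp T) {k : M.tm.K} {q : Code M} {v : M.tm.σ}
    (hq : instr (.run q v) = .pop k (receive k q v)) :
    ∃ (o : Option (Letter M)) (stk' : M.tm.K → List (Letter M)) (inp' : List S),
      o.map Letter.val = (T k).head?.map (Sigma.mk k) ∧ o.bind (symbol M k) = (T k).head? ∧
      Represents stk' inp' (Function.update T k (T k).tail) ∧
      ∀ n b, (program M).Outputs n (resume q v o) stk' inp' b →
        (program M).Outputs (n + 2) (.run q v) stk inp b := by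
  rcases hst : stk k with _ | ⟨g, st⟩
  · by_cases hk : k = M.tm.k₀
    · subst hk
      rcases hinp : inp with _ | ⟨s, inp'⟩
      · have hT : T M.tm.k₀ = [] := by simpa [hst, hinp] using (h M.tm.k₀).symm
        refine ⟨none, stk, [], by simp [hT], by simp [hT], ?_, fun n b hn => ?_⟩
        · rw [hT, List.tail_nil, ← hT, Function.update_eq_self, ← hinp]
          exact h
        · refine outputs_pop hq (o := none) (by rw [hst]; rfl)
            (by rw [hst, List.tail_nil, ← hst, Function.update_eq_self]) ?_
          simp only [receive, if_true]
          exact outputs_behind hn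
      · obtain ⟨h1, h2⟩ := h.read hst hinp
        refine ⟨some (inputLetter M s), stk, inp', by rw [h1]; rfl,
          by rw [h1]; exact symbol_eq rfl, h2, fun n b hn => ?_⟩
        refine outputs_pop hq (o := none) (by rw [hst]; rfl)
          (by rw [hst, List.tail_nil, ← hst, Function.update_eq_self]) ?_
        simp only [receive, if_true]
        exact outputs_behind hn
    · have hT : T k = [] := by simpa [hst, hk] using (h k).symm
      refine ⟨none, stk, inp, by simp [hT], by simp [hT], ?_, fun n b hn => ?_⟩
      · rw [hT, List.tail_nil, ← hT, Function.update_eq_self]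
        exact h
      · refine .mono (outputs_pop hq (n := n) (o := none) (by rw [hst]; rfl)
          (by rw [hst, List.tail_nil, ← hst, Function.update_eq_self]) ?_) (Nat.le_succ _)
        simpa only [receive, if_neg hk] using hn
  · obtain ⟨a, ha, hT, h'⟩ := h.pop hst
    refine ⟨some g, _, inp, by simp [ha, hT], by simpa [hT] using symbol_eq ha, h',
      fun n b hn => ?_⟩
    exact .mono (outputs_pop hq (o := some g) (by rw [hst]; rfl) (by rw [hst, List.tail_cons]) hn)
      (Nat.le_succ _)

end Represents

variable (M) in
/-- A bound on the number of instructions that are needed for a statement. -/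
def cost : TM2.Stmt M.tm.Γ M.tm.Λ M.tm.σ → ℕ
  | .push _ _ q | .peek _ _ q | .pop _ _ q | .load _ q => cost q + 3
  | .branch _ q₁ q₂ => cost q₁ + cost q₂ + 3
  | .goto _ | .halt => 3

/-- A configuration of the machine from which the program outputs `b` after at most `n` steps. -/
def Leads (n : ℕ) (b : Bool) (c : TM2.Cfg M.tm.Γ M.tm.Λ M.tm.σ) : Prop :=
  match c.l with
  | some l => ∀ stk inp, Represents stk inp c.stk →
      (program M).Outputs n (.run (label M l) c.var) stk inp b
  | none => (c.stk M.tm.k₁).head? = some (M.outputAlphabet.symm b)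

theorem outputs_run {n : ℕ} {b : Bool} (q : TM2.Stmt M.tm.Γ M.tm.Λ M.tm.σ) :
    ∀ (h : ∃ l, q ∈ TM2.stmts₁ (M.tm.m l)) (v : M.tm.σ) (T : ∀ k, List (M.tm.Γ k)),
      Leads n b (TM2.stepAux q v T) → ∀ stk inp, Represents stk inp T →
      (program M).Outputs (n + cost M q) (.run ⟨q, h⟩ v) stk inp b := by
  induction q with
  | push k f q ih =>
    intro h v T hl stk inp hr
    refine .mono (.push (p := program M) (q := .run ⟨.push k f q, h⟩ v) rfl
      (ih _ _ _ hl _ _ ?_)) (m := n + cost M q + 3) (by omega)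
    exact hr.push rfl
  | peek k f q ih =>
    intro h v T hl stk inp hr
    obtain ⟨o, stk', inp', h1, h2, h3, h4⟩ := hr.exists_receive
      (q := ⟨.peek k f q, h⟩) (v := v) rfl
    refine .mono (h4 (n + cost M q + 1) b ?_) (m := n + cost M q + 3) (by omega)
    rcases hT : T k with _ | ⟨a, t⟩
    · obtain rfl : o = none := by simpa [hT] using h1
      rw [hT, List.tail_nil, ← hT, Function.update_eq_self] at h3
      refine .mono (ih (Code.part ⟨.peek k f q, h⟩ mem_peek).2 _ T ?_ _ _ h3) (Nat.le_succ _)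
      simpa [hT] using hl
    · obtain ⟨g, rfl, hg⟩ : ∃ g, o = some g ∧ g.val = ⟨k, a⟩ := by
        simpa [hT] using h1
      refine .push (p := program M) (q := .restore g _ _) rfl
        (ih (Code.part ⟨.peek k f q, h⟩ mem_peek).2 _ T ?_ _ _ ?_)
      · rw [Represents.symbol_eq hg]
        simpa [hT] using hl
      · have h5 := h3.push hg
        rw [Function.update_idem, Function.update_self, hT, List.tail_cons, ← hT,
          Function.update_eq_self] at h5
        have hk : g.val.1 = k := congrArg Sigma.fst hg
        change Represents (Function.update stk' g.val.1 (g :: stk' g.val.1)) inp' T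
        rwa [hk]
  | pop k f q ih =>
    intro h v T hl stk inp hr
    obtain ⟨o, stk', inp', h1, h2, h3, h4⟩ := hr.exists_receive
      (q := ⟨.pop k f q, h⟩) (v := v) rfl
    refine .mono (h4 (n + cost M q) b ?_) (m := n + cost M q + 3) (by omega)
    refine ih (Code.part ⟨.pop k f q, h⟩ mem_pop).2 _ _ ?_ _ _ h3
    rw [h2]
    exact hl
  | load f q ih =>
    intro h v T hl stk inp hr
    exact .mono (.jump (p := program M) (q := .run ⟨.load f q, h⟩ v) rfl
      (ih _ _ _ hl _ _ hr)) (m := n + cost M q + 3) (by omega)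
  | branch f q₁ q₂ ih₁ ih₂ =>
    intro h v T hl stk inp hr
    refine .mono (.jump (p := program M) (q := .run ⟨.branch f q₁ q₂, h⟩ v) (b := b)
      (n := n + cost M q₁ + cost M q₂) rfl ?_) (m := n + (cost M q₁ + cost M q₂ + 3)) (by omega)
    simp only [TM2.stepAux] at hl
    generalize hq : Code.part ⟨.branch f q₁ q₂, h⟩ (mem_branch (f v)) = q
    obtain ⟨q, hq'⟩ := q
    have hq := congrArg Subtype.val hq
    simp only [Code.part] at hq
    cases hf : f v <;> simp only [hf, cond_true, cond_false] at hl hq <;> subst hq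
    · exact .mono (ih₂ hq' v T hl _ _ hr) (by omega)
    · exact .mono (ih₁ hq' v T hl _ _ hr) (by omega)
  | goto f =>
    intro h v T hl stk inp hr
    exact .mono (.jump (p := program M) (q := .run ⟨.goto f, h⟩ v) rfl (hl stk inp hr))
      (m := n + 3) (by omega)
  | halt =>
    intro h v T hl stk inp hr
    obtain ⟨o, stk', inp', h1, h2, h3, h4⟩ := hr.exists_receive (q := ⟨.halt, h⟩) (v := v) rfl
    refine .mono (h4 0 b (.halt ?_)) (m := n + 3) (by omega)
    have : (T M.tm.k₁).head? = some (M.outputAlphabet.symm b) := hl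
    simp only [resume, h2, this]
    simp [program, instr]

variable (M) in
/-- The largest cost of a step of the machine. -/
noncomputable def maxCost : ℕ :=
  have := M.tm.ΛFin
  Finset.univ.sup fun l => cost M (M.tm.m l)

theorem leads_of_iterate {b : Bool} {c' : TM2.Cfg M.tm.Γ M.tm.Λ M.tm.σ} (hl : c'.l = none)
    (hb : (c'.stk M.tm.k₁).head? = some (M.outputAlphabet.symm b)) (i : ℕ) :
    ∀ c : TM2.Cfg M.tm.Γ M.tm.Λ M.tm.σ, (flip bind (TM2.step M.tm.m))^[i] (some c) = some c' →
      Leads (i * maxCost M) b c := by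
  induction i with
  | zero =>
    intro c h
    obtain rfl : c = c' := by simpa using h
    simpa only [Leads, hl] using hb
  | succ i ih =>
    rintro ⟨_ | l, v, T⟩ h
    · have hn : ∀ i, (flip bind (TM2.step M.tm.m))^[i] none = none := by
        intro i
        induction i with
        | zero => rfl
        | succ i ih => rw [Function.iterate_succ_apply]; exact ih
      rw [Function.iterate_succ_apply] at h
      have : flip bind (TM2.step M.tm.m) (some ⟨none, v, T⟩) = none := rfl
      rw [this, hn] at h
      cases h
    · rw [Function.iterate_succ_apply] at h
      have h1 := ih (TM2.stepAux (M.tm.m l) v T) h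
      intro stk inp hr
      refine .mono (outputs_run _ _ v T h1 stk inp hr) ?_
      have h2 : cost M (M.tm.m l) ≤ maxCost M :=
        Finset.le_sup (f := fun l => cost M (M.tm.m l)) (@Finset.mem_univ _ M.tm.ΛFin l)
      rw [Nat.succ_mul]
      omega

/-- The program of a Turing machine has the same output, and takes the same time up to a constant
factor. -/
theorem outputs_of_tm2Outputs {s : List S} {b : Bool} {t : ℕ}
    (h : TM2OutputsInTime M.tm (s.map M.inputAlphabet.invFun)
      (some ([b].map M.outputAlphabet.invFun)) t) :
    (program M).Outputs (t * maxCost M) (program M).start (fun _ => []) s b := by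
  have h1 := leads_of_iterate (b := b)
    (c' := haltList M.tm ([b].map M.outputAlphabet.invFun)) rfl (by simp [haltList]) h.steps
    (initList M.tm (s.map M.inputAlphabet.invFun)) h.evals_in_steps
  refine .mono (h1 (fun _ => []) s fun k => ?_) (Nat.mul_le_mul_right _ h.steps_le_m)
  by_cases hk : k = M.tm.k₀
  · subst hk
    simp [initList, inputSymbol, Function.comp_def]
  · simp [initList, hk]

end Compiler

/-! ### The length of module contexts -/

section Length

variable {α : Type}

theorem length_serializeText (s : List α) : (serializeText s).length = s.length + 1 := by
  simp [serializeText]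

theorem length_serializeTexts (l : List (List α)) :
    (serializeTexts l).length = (l.map List.length).sum + l.length + 1 := by
  induction l with
  | nil => rfl
  | cons s l ih =>
    simp only [serializeTexts, List.flatMap_cons, List.length_append, List.append_assoc,
      List.map_cons, List.sum_cons, List.length_cons,
      length_serializeText] at ih ⊢
    omega

theorem sum_le_mul_of_forall_le {l : List ℕ} {b : ℕ} (h : ∀ a ∈ l, a ≤ b) :
    l.sum ≤ l.length * b := by
  simpa using List.sum_le_card_nsmul l b h

namespace PFProof

variable (P : PFProof α) (v : Fin P.n)

theorem mem_dfsList {S : Fin P.n → Prop} {u : Fin P.n} : u ∈ P.dfsList S ↔ S u := by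
  simp [dfsList]

theorem nodup_dfsList (S : Fin P.n → Prop) : (P.dfsList S).Nodup :=
  (List.mergeSort_perm _ _).nodup_iff.2 ((List.nodup_finRange _).filter _)

theorem length_ancestors_le : (P.ancestors v).length ≤ P.scopeDepth :=
  Finset.le_sup (f := fun v => (P.ancestors v).length) (Finset.mem_univ v)

/-- Different dependencies are invoked at different characters of the proof text. -/
theorem length_dependencies_le : (P.dependencies v).length ≤ (P.modules v).proof.length := by
  classical
  have h : (P.dependencies v).toFinset.image some ⊆ Finset.univ.image (P.citation v) := by
    intro o ho
    obtain ⟨u, hu, rfl⟩ := Finset.mem_image.1 ho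
    obtain ⟨i, hi⟩ := P.mem_dfsList.1 (List.mem_toFinset.1 hu)
    exact Finset.mem_image.2 ⟨i, Finset.mem_univ i, hi⟩
  have h' := (Finset.card_le_card h).trans Finset.card_image_le
  rwa [Finset.card_image_of_injective _ (Option.some_injective _),
    dependencies, List.toFinset_card_of_nodup (P.nodup_dfsList _), Finset.card_univ, Fintype.card_fin] at h'

variable {P} {D L : ℕ}

theorem IsGood.length_serialize_le (h : P.IsGood D L) (hL : 1 ≤ L) :
    (P.context v).serialize.length ≤ 20 * (L * (L + D + 1)) := by
  have hp : ∀ u, (serializeTexts (P.modules u).premises).length ≤ 3 * L := fun u => by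
    rw [length_serializeTexts]
    have := h.premises_count_le u
    have := h.premises_length_le u
    omega
  have h1 : ((P.context v).ancestorPremises.flatMap serializeTexts).length ≤ D * (3 * L) := by
    rw [List.length_flatMap]
    refine (sum_le_mul_of_forall_le (b := 3 * L) ?_).trans ?_
    · simp only [context, List.map_map, List.mem_map]
      rintro _ ⟨u, -, rfl⟩
      exact hp u
    · simp only [context, List.map_map, List.length_map]
      exact Nat.mul_le_mul_right _ ((P.length_ancestors_le v).trans h.depth_le)
  have h2 : (serializeTexts (P.context v).dependencyConclusions).length ≤ L * L + L + 1 := by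
    rw [length_serializeTexts]
    have h3 := (P.length_dependencies_le v).trans (h.proof_le v)
    have h4 : ((P.context v).dependencyConclusions.map List.length).sum ≤
        (P.dependencies v).length * L := by
      refine (sum_le_mul_of_forall_le (b := L) ?_).trans ?_
      · simp only [context, List.map_map, List.mem_map]
        rintro _ ⟨u, -, rfl⟩
        exact h.conclusion_le u
      · simp [context]
    have h5 : (P.context v).dependencyConclusions.length = (P.dependencies v).length := by
      simp [context]
    have h6 := Nat.mul_le_mul_right L h3
    omega
  have h3 := h.conclusion_le v
  have h4 := h.proof_le v
  have h5 := hp v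
  have h6 : (P.context v).premises = (P.modules v).premises := rfl
  have h7 : (P.context v).conclusion = (P.modules v).conclusion := rfl
  have h8 : (P.context v).proof = (P.modules v).proof := rfl
  simp only [ModuleContext.serialize, List.length_append, List.length_singleton, h6, h7, h8,
    length_serializeText]
  have h9 : 1 * 1 ≤ L * L := Nat.mul_le_mul hL hL
  have h10 : L * (L + D + 1) = L * L + D * L + L := by ring
  have h11 : D * (3 * L) = 3 * (D * L) := by ring
  rw [h10]
  omega

end PFProof

theorem ModuleContext.two_le_length_serialize (C : ModuleContext α) : 2 ≤ C.serialize.length := by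
  simp only [ModuleContext.serialize, List.length_append, List.length_singleton]
  omega

instance [Finite α] : Finite (Sym α) := by
  refine Finite.of_injective (β := α ⊕ Fin 3)
    (fun
      | .char a => .inl a
      | .endText => .inr 0
      | .endList => .inr 1
      | .endSection => .inr 2) ?_
  rintro (_ | _ | _ | _) (_ | _ | _ | _) h <;> simp_all

end Length

/-! ### Calls of the Transformer -/

namespace Transformer

variable {S : Type} {T : Transformer S}

theorem Next.unique {x : List (Token S T.work)} {t t' : Token S T.work} (h : T.Next x t)
    (h' : T.Next x t') : t = t' := by
  obtain ⟨i, hi, h⟩ := h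
  obtain ⟨j, hj, h'⟩ := h'
  obtain rfl : i = j := Fin.ext (by omega)
  by_contra hne
  exact lt_asymm (h t' (Ne.symm hne)) (h' t hne)

theorem Generates.take_eq {x y y' : List (Token S T.work)} (h : T.Generates x y)
    (h' : T.Generates x y') (i : ℕ) (hi : i ≤ y.length) (hi' : i ≤ y'.length) :
    y.take i = y'.take i := by
  induction i with
  | zero => rfl
  | succ i ih =>
    have h1 := ih (by omega) (by omega)
    have h2 := h ⟨i, hi⟩
    have h3 := h' ⟨i, hi'⟩
    simp only [h1] at h2
    rw [List.take_succ_eq_append_getElem hi, List.take_succ_eq_append_getElem hi', h1]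
    congr 2
    exact h2.unique h3

/-- Decoding is deterministic, so that a call has only one verdict. -/
theorem Returns.unique {s : List S} {b b' : Bool} {ℓ ℓ' : ℕ} (h : T.Returns s b ℓ)
    (h' : T.Returns s b' ℓ') : b = b' := by
  obtain ⟨y, hy, hg, -⟩ := h
  obtain ⟨y', hy', hg', -⟩ := h'
  wlog hle : y.length ≤ y'.length generalizing b b' y y'
  · exact (this y' hy' hg' y hy hg (by omega)).symm
  have h1 := hg.take_eq hg' (y.length + 1) (by simp) (by simp; omega)
  rw [List.take_of_length_le (by simp)] at h1
  rcases hle.lt_or_eq with hlt | heq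
  · rw [List.take_append_of_le_length (by omega)] at h1
    have h2 : Token.verdict b ∈ y'.take (y.length + 1) := h1 ▸ by simp
    exact (hy' b (List.mem_of_mem_take h2)).elim
  · rw [List.take_of_length_le (by simp; omega)] at h1
    have := List.append_inj_right h1 heq
    simpa using this

end Transformer

end PseudoFormal

theorem theorem1 {α : Type} [Fintype α] (A : PseudoFormal.BlockwiseVerifier α) :
    ∃ (T : PseudoFormal.Transformer (PseudoFormal.Sym α)) (c k : ℕ),
      ∀ (P : PseudoFormal.PFProof α) (D L : ℕ), 1 ≤ L → P.IsGood D L →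
        ∃ calls : List (Fin P.n),
          calls.length ≤ k * P.n ∧
          (∀ v, v ∈ calls) ∧
          (∀ v ∈ calls, ∃ ℓ ≤ c * (L * (L + D + 1)),
            T.Returns (P.context v).serialize (A.check (P.context v)) ℓ) ∧
          (A.Accepts P ↔ ∀ v ∈ calls, ∃ ℓ, T.Returns (P.context v).serialize true ℓ) := by
  obtain ⟨a, b, hab⟩ := A.linear_time
  set M := A.machine.toTM2ComputableAux with hM
  have : Finite (PseudoFormal.Compiler.program M).G :=
    inferInstanceAs (Finite (PseudoFormal.Compiler.Letter M))
  have : Finite (PseudoFormal.Compiler.program M).Q :=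
    inferInstanceAs (Finite (PseudoFormal.Compiler.State M))
  obtain ⟨T, hT⟩ := (PseudoFormal.Compiler.program M).exists_transformer_returns
  set m := PseudoFormal.Compiler.maxCost M
  have hcall : ∀ (P : PseudoFormal.PFProof α) (v : Fin P.n),
      ∃ ℓ ≤ (1 + 3 * m * (a + b) + 2) * (P.context v).serialize.length,
        T.Returns (P.context v).serialize (A.check (P.context v)) ℓ := by
    intro P v
    have h2 := (P.context v).two_le_length_serialize
    obtain ⟨ℓ, hℓ, hr⟩ := hT _ _ _ h2 (PseudoFormal.Compiler.outputs_of_tm2Outputs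
      (A.machine.outputsFun ⟨P.context v, P, v, rfl⟩))
    refine ⟨ℓ, hℓ.trans ?_, hr⟩
    set N := (P.context v).serialize.length
    have h3 : A.machine.time N ≤ (a + b) * N := by
      have := hab N
      have : b * 1 ≤ b * N := Nat.mul_le_mul_left _ (by omega)
      rw [add_mul]
      omega
    have h4 := Nat.mul_le_mul_right (3 * m) h3
    calc _ = N + (A.machine.time N * (3 * m) + 2) := by ring
      _ ≤ N + ((a + b) * N * (3 * m) + 2 * N) := by omega
      _ = _ := by ring
  refine ⟨T, (1 + 3 * m * (a + b) + 2) * 20, 1, fun P D L hL hP => ⟨List.finRange P.n, by simp,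
    List.mem_finRange, fun v _ => ?_, ?_⟩⟩
  · obtain ⟨ℓ, hℓ, hr⟩ := hcall P v
    refine ⟨ℓ, hℓ.trans ?_, hr⟩
    rw [mul_assoc (1 + 3 * m * (a + b) + 2)]
    exact Nat.mul_le_mul_left _ (hP.length_serialize_le v hL)
  · refine ⟨fun h v _ => ?_, fun h v => ?_⟩
    · obtain ⟨ℓ, -, hr⟩ := hcall P v
      exact ⟨ℓ, h v ▸ hr⟩
    · obtain ⟨ℓ, -, hr⟩ := hcall P v
      obtain ⟨ℓ', hr'⟩ := h v (List.mem_finRange v)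
      exact hr.unique hr'
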